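/- **Conventions.** A strict partition is $\lambda=(\lambda_1>\dots>\lambda_\ell>0)$ (with $\lambda_i=0$ for $i>\ell$); its shifted shape is $S(\lambda)=\{(i,j): 1\le i\le \ell,\ i\le j\le \lambda_i+i-1\}$ in matrix coordinates, with main diagonal $i=j$. For $\mu\subseteq\lambda$ put $S(\lambda/\mu)=S(\lambda)\setminus S(\mu)$. Letters are ordered $1'<1<2'<2<\cdots$; a bold $\mathbf a$ stands for $a$ or $a'$. A *shifted Young tableau* of shape $\lambda/\mu$ is a filling of $S(\lambda/\mu)$ by letters, weakly increasing along rows and down columns, with at most one $k$ in each column and at most one $k'$ in each row, for each $k\ge1$; it is *semistandard* (SSYT) if no entry on the main diagonal is primed. $T$ *extends* $S$ if there are strict partitions $\nu\subseteq\mu\subseteq\lambda$ such that $S$ has shape $\mu/\nu$ and $T$ has shape $\lambda/\mu$. The $k$th weight of $T$ is the number of its entries $k$ and $k'$; $\max(T)$ is the largest $k$ with nonzero weight ($0$ if $T$ is empty). The word $w(T)$ is obtained by reading each row from right to left, starting with the top row. For a word $w$ of length $n$, $\hat w$ is obtained by reading $w$ from right to left and replacing $k$ by $(k+1)'$ and $k'$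 by $k$. Let $m_i(j)$ be the number of unprimed letters $i$ among the first $j$ letters of $w\hat w=a_1\cdots a_{2n}$. The word $w$ is a *lattice word* if, for $i\ge2$ and $0\le j<2n$, $m_i(j)=m_{i-1}(j)$ implies $a_{j+1}\notin\{i,i'\}$. A *modified LRS tableau* is an SSYT whose weight is a strict partition and whose word is a lattice word. **The switching.** Let $T$ extend $S$. Consider the filling $S\cup T$ in which each letter remembers whether it comes from $S$ or from $T$. For $a,b\ge1$ the process on $(a,b)$ is as follows; $\mathbf a$ always denotes letters from $S$, $\mathbf b$ letters from $T$. An $\mathbf a$-box is *switchable* if its neighbor to the south or to the east is a $\mathbf b$-box. As long as there is a switchable $\mathbf a$-box, take the easternmost switchable $a$-box, or, if there is no switchable $a$-box, the southernmost switchable $a'$-box, and apply the switch that fits (rows are separated by $/$, a star marks a place below the main diagonal, a dot a box that plays no role): * exactly one of the south and east neighbors is a $\mathbf b$-box: (S1) $\mathbf a\,\mathbf b\mapsto\mathbf b\,\mathbf a$; (S2) $\mathbf a\,/\,\mathbf b\mapsto\mathbf b\,/\,\mathbf a$ (one column); (S3) $\mathbf a\,b'\,/\,*\,\mathbf b\mapsto\mathbf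 b\,b\,/\,*\,\mathbf a$ (chosen box: the diagonal one); (S4) $\mathbf a\,a\,/\,*\,\mathbf b\mapsto\mathbf b\,a'\,/\,*\,\mathbf a$ (chosen box: the unprimed $a$ in the upper right); (S1$'$) $a\,b'\mapsto b\,a'$ if the $a$-box is on the main diagonal; (S2$'$) $a'\,/\,b\mapsto b'\,/\,a$ if the $b$-box is on the main diagonal; * both are $\mathbf b$-boxes: (S5) $\mathbf a\,b'\,/\,\mathbf b\,\cdot\mapsto b'\,\mathbf a\,/\,\mathbf b\,\cdot$; (S6) $\mathbf a\,b\,/\,\mathbf b\,\cdot\mapsto\mathbf b\,b\,/\,\mathbf a\,\cdot$; (S7) $\mathbf a\,a\,b\,/\,*\,\mathbf b\,\cdot\mapsto\mathbf b\,a'\,b\,/\,*\,\mathbf a\,\cdot$ (chosen box: the unprimed $a$ in the middle); (S6$'$) $a'\,b\,/\,b\,\cdot\mapsto b'\,b\,/\,a\,\cdot$ if the lower $b$-box is on the main diagonal. (S3) takes precedence over (S1) and (S1$'$), (S4) over (S2), (S7) over (S6), and (S1$'$), (S2$'$), (S6$'$) over (S1), (S2), (S6). The process on $(a,b)$ stops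 when no $\mathbf a$-box is switchable. The *modified shifted tableau switching* runs these processes for $a=\max(S),\dots,2,1$ and, for each $a$, for $b=1,2,\dots,\max(T)$. It transforms $(S,T)$ into $(\widetilde{{}^ST},\widetilde{S_T})$, where $\widetilde{{}^ST}$ consists of the final positions and letters of $T$ and $\widetilde{S_T}$ of those of $S$. **Theorem.** Let $S$ and $T$ be semistandard shifted Young tableaux such that $T$ extends $S$. Then the modified shifted tableau switching of $(S,T)$ is well defined (it terminates, with exactly one outcome), and its outcome $(\widetilde{{}^ST},\widetilde{S_T})$ is again a pair of semistandard shifted Young tableaux such that $\widetilde{S_T}$ extends $\widetilde{{}^ST}$. Moreover: (a) the modified shifted tableau switching transforms $(\widetilde{{}^ST},\widetilde{S_T})$ into $(S,T)$; (b) if $T$ is a modified LRS tableau, then so is $\widetilde{{}^ST}$; (c) if $S$ is a modified LRS tableau, then so is $\widetilde{S_T}$. -/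

import Mathlib

namespace ShiftedTableau

/-! ### Strict partitions and skew shifted shapes -/

/-- A strict partition `row 0 > row 1 > ⋯ > row (ℓ - 1) > 0 = row ℓ = row (ℓ + 1) = ⋯`.
(The condition forces `row` to vanish eventually.) -/
structure StrictPartition where
  row : ℕ → ℕ
  strict : ∀ i, row (i + 1) = 0 ∨ row (i + 1) < row i

/-- Containment of strict partitions. -/
def StrictPartition.Contained (mu lam : StrictPartition) : Prop :=
  ∀ i, mu.row i ≤ lam.row i

/-- A box `(i, j)` in matrix coordinates (row `i` from the top, column `j` from the left).
Rows and columns are numbered from `0`; the main diagonal is `i = j`. -/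
abbrev Box := ℕ × ℕ

/-- The shifted shape of `lam`: its row `i` starts in column `i` and has `lam.row i` boxes. -/
def shiftedShape (lam : StrictPartition) : Set Box :=
  {c | c.1 ≤ c.2 ∧ c.2 < lam.row c.1 + c.1}

/-- The skew shifted shape `lam / mu`. -/
def skewShape (lam mu : StrictPartition) : Set Box :=
  shiftedShape lam \ shiftedShape mu

/-! ### Letters, fillings, and tableaux -/

/-- The letter `val` or, if `primed`, the letter `val'`. -/
@[ext]
structure Letter where
  val : ℕ
  primed : Bool

instance : DecidableEq Letter := fun x y =>
  decidable_of_iff (x.val = y.val ∧ x.primed = y.primed) Letter.ext_iff.symm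

/-- The order `1' < 1 < 2' < 2 < ⋯`. -/
instance : LE Letter where
  le x y := x.val < y.val ∨ (x.val = y.val ∧ (x.primed = true ∨ y.primed = false))

/-- A partial filling of the quadrant by letters; `none` marks a box that is not filled. -/
abbrev Filling := Box → Option Letter

/-- The set of filled boxes. -/
def Filling.shape (T : Filling) : Set Box := {c | T c ≠ none}

/-- Shifted Young tableaux (of some skew shifted shape). -/
structure IsSYT (T : Filling) : Prop where
  shape_eq : ∃ lam mu : StrictPartition, mu.Contained lam ∧ T.shape = skewShape lam mu
  val_pos : ∀ c x, T c = some x → 1 ≤ x.val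
  row_weak : ∀ i j j' x y, j ≤ j' → T (i, j) = some x → T (i, j') = some y → x ≤ y
  col_weak : ∀ i i' j x y, i ≤ i' → T (i, j) = some x → T (i', j) = some y → x ≤ y
  col_unprimed : ∀ i i' j k, T (i, j) = some ⟨k, false⟩ → T (i', j) = some ⟨k, false⟩ → i = i'
  row_primed : ∀ i j j' k, T (i, j) = some ⟨k, true⟩ → T (i, j') = some ⟨k, true⟩ → j = j'

/-- Semistandard shifted Young tableaux: no primed letter on the main diagonal. -/
structure IsSSYT (T : Filling) : Prop extends IsSYT T where
  diag_unprimed : ∀ i x, T (i, i) = some x → x.primed = false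

/-- `T` extends `S`: for some `nu ⊆ mu ⊆ lam`, `S` has shape `mu / nu` and `T` has shape
`lam / mu`. -/
def Extends (T S : Filling) : Prop :=
  ∃ lam mu nu : StrictPartition, nu.Contained mu ∧ mu.Contained lam ∧
    S.shape = skewShape mu nu ∧ T.shape = skewShape lam mu

/-- The largest `k` such that `k` or `k'` occurs in `T` (`0` if `T` is empty). -/
noncomputable def Filling.maxEntry (T : Filling) : ℕ :=
  sSup {k | ∃ c p, T c = some ⟨k, p⟩}

/-- The number of occurrences of `k` and `k'` in `T`. -/
noncomputable def Filling.weight (T : Filling) (k : ℕ) : ℕ :=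
  Set.ncard {c | ∃ p, T c = some ⟨k, p⟩}

/-! ### Reading words, the lattice property, modified LRS tableaux -/

/-- The entries in rows and columns `0, …, n - 1`, each row read from right to left, starting
with the top row. -/
def Filling.wordUpTo (T : Filling) (n : ℕ) : List Letter :=
  (List.range n).flatMap fun i => (List.range n).reverse.filterMap fun j => T (i, j)

/-- The least `n` such that all filled boxes lie in rows and columns `0, …, n - 1`
(for a filling with finitely many filled boxes). -/
noncomputable def Filling.extent (T : Filling) : ℕ :=
  sSup {n | ∃ c ∈ T.shape, n = c.1 + 1 ∨ n = c.2 + 1}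

/-- The word of `T`: rows read from right to left, starting with the top row. -/
noncomputable def Filling.word (T : Filling) : List Letter := T.wordUpTo T.extent

/-- `k ↦ (k + 1)'` and `k' ↦ k`. -/
def Letter.hat (x : Letter) : Letter :=
  if x.primed then ⟨x.val, false⟩ else ⟨x.val + 1, true⟩

/-- `ŵ`: read `w` from right to left, replacing `k` by `(k + 1)'` and `k'` by `k`. -/
def hatWord (w : List Letter) : List Letter := w.reverse.map Letter.hat

/-- The lattice property. With `a = w ŵ` and `m_i(j)` the number of unprimed letters `i` among
the first `j` letters of `a`: whenever `i ≥ 2` and `m_i(j) = m_{i-1}(j)`, the next letter of `a`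
is neither `i` nor `i'`. (Below, `i = k + 1`.) -/
def IsLatticeWord (w : List Letter) : Prop :=
  ∀ k j : ℕ, ∀ x : Letter, 1 ≤ k → (w ++ hatWord w)[j]? = some x →
    ((w ++ hatWord w).take j).count ⟨k + 1, false⟩ = ((w ++ hatWord w).take j).count ⟨k, false⟩ →
    x.val ≠ k + 1

/-- Modified Littlewood–Richardson–Stembridge tableaux: semistandard shifted Young tableaux
whose weight is a strict partition and whose word has the lattice property. -/
structure IsModifiedLRS (T : Filling) : Prop extends IsSSYT T where
  weight_strict : ∃ mu : StrictPartition, ∀ k, T.weight (k + 1) = mu.row k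
  lattice : IsLatticeWord T.word

/-! ### The modified shifted switching process -/

/-- A filling in which each letter is remembered as coming from the first tableau (`inl`) or from
the second one (`inr`). -/
abbrev PairFilling := Box → Option (Letter ⊕ Letter)

/-- `S ∪ T`, for `S` and `T` with disjoint shapes. -/
def union (S T : Filling) : PairFilling := fun c =>
  match S c with
  | some x => some (Sum.inl x)
  | none => (T c).map Sum.inr

/-- The letters of the first tableau. -/
def PairFilling.first (U : PairFilling) : Filling := fun c => (U c).bind Sum.getLeft?

/-- The letters of the second tableau. -/
def PairFilling.second (U : PairFilling) : Filling := fun c => (U c).bind Sum.getRight?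

/-- The letter `k` (`p = false`) or `k'` (`p = true`) of the first tableau, as a box content. -/
abbrev fstL (k : ℕ) (p : Bool) : Option (Letter ⊕ Letter) := some (Sum.inl ⟨k, p⟩)

/-- The letter `k` (`p = false`) or `k'` (`p = true`) of the second tableau, as a box content. -/
abbrev sndL (k : ℕ) (p : Bool) : Option (Letter ⊕ Letter) := some (Sum.inr ⟨k, p⟩)

/-- `c` contains `a` or `a'` of the first tableau. -/
def IsABox (a : ℕ) (U : PairFilling) (c : Box) : Prop := ∃ p, U c = fstL a p

/-- `c` contains `b` or `b'` of the second tableau. -/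
def IsBBox (b : ℕ) (U : PairFilling) (c : Box) : Prop := ∃ p, U c = sndL b p

/-- The box `c` contains `a` (`p = false`) or `a'` (`p = true`) of the first tableau, and is the
neighbor to the north or to the west of a `b`- or `b'`-box of the second tableau. -/
def Switchable (a b : ℕ) (U : PairFilling) (p : Bool) (c : Box) : Prop :=
  U c = fstL a p ∧ (IsBBox b U (c.1 + 1, c.2) ∨ IsBBox b U (c.1, c.2 + 1))

/-- No box containing `a` or `a'` of the first tableau can be switched. -/
def FullySwitched (a b : ℕ) (U : PairFilling) : Prop := ∀ p c, ¬ Switchable a b U p c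

/-- The box to which the next switch is applied: the easternmost switchable `a`-box if there is
one, and otherwise the southernmost switchable `a'`-box. -/
def IsNextBox (a b : ℕ) (U : PairFilling) (c : Box) : Prop :=
  (Switchable a b U false c ∧ ∀ d, Switchable a b U false d → d.2 ≤ c.2) ∨
  ((∀ d, ¬ Switchable a b U false d) ∧
    Switchable a b U true c ∧ ∀ d, Switchable a b U true d → d.1 ≤ c.1)

/-- `Switch a b U c V`: the switch applied to the box `c` turns `U` into `V`. In the pictures,
bold letters `𝐚`, `𝐛` stand for letters that may be primed or not, a dot marks a box that plays no
role, and `*` marks a place below the main diagonal. -/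
inductive Switch (a b : ℕ) (U : PairFilling) : Box → PairFilling → Prop
  /-- (S1) `𝐚 𝐛 ↦ 𝐛 𝐚`, unless (S3) or (S1') applies. -/
  | s1 (i j : ℕ) (p q : Bool) :
      U (i, j) = fstL a p → U (i, j + 1) = sndL b q → ¬ IsBBox b U (i + 1, j) →
      ¬ (i = j ∧ q = true ∧ IsBBox b U (i + 1, j + 1)) →
      ¬ (i = j ∧ p = false ∧ q = true) →
      Switch a b U (i, j)
        (Function.update (Function.update U (i, j) (sndL b q)) (i, j + 1) (fstL a p))
  /-- (S1') `a b' ↦ b a'`, with the `a`-box on the main diagonal, unless (S3) applies. -/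
  | s1' (i : ℕ) :
      U (i, i) = fstL a false → U (i, i + 1) = sndL b true → ¬ IsBBox b U (i + 1, i) →
      ¬ IsBBox b U (i + 1, i + 1) →
      Switch a b U (i, i)
        (Function.update (Function.update U (i, i) (sndL b false)) (i, i + 1) (fstL a true))
  /-- (S2) `𝐚 / 𝐛 ↦ 𝐛 / 𝐚` in a column, unless (S4) or (S2') applies. -/
  | s2 (i j : ℕ) (p q : Bool) :
      U (i, j) = fstL a p → U (i + 1, j) = sndL b q → ¬ IsBBox b U (i, j + 1) →
      ¬ (i + 1 = j ∧ p = false ∧ IsABox a U (i, i)) →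
      ¬ (i + 1 = j ∧ p = true ∧ q = false) →
      Switch a b U (i, j)
        (Function.update (Function.update U (i, j) (sndL b q)) (i + 1, j) (fstL a p))
  /-- (S2') `a' / b ↦ b' / a` in a column, with the `b`-box on the main diagonal. -/
  | s2' (i : ℕ) :
      U (i, i + 1) = fstL a true → U (i + 1, i + 1) = sndL b false →
      ¬ IsBBox b U (i, i + 2) →
      Switch a b U (i, i + 1)
        (Function.update (Function.update U (i, i + 1) (sndL b true)) (i + 1, i + 1)
          (fstL a false))
  /-- (S3) `𝐚 b' / * 𝐛 ↦ 𝐛 b / * 𝐚`. -/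
  | s3 (i : ℕ) (p q : Bool) :
      U (i, i) = fstL a p → U (i, i + 1) = sndL b true → U (i + 1, i + 1) = sndL b q →
      ¬ IsBBox b U (i + 1, i) →
      Switch a b U (i, i)
        (Function.update (Function.update (Function.update U (i, i) (sndL b q))
          (i, i + 1) (sndL b false)) (i + 1, i + 1) (fstL a p))
  /-- (S4) `𝐚 a / * 𝐛 ↦ 𝐛 a' / * 𝐚`, applied to the `a`-box `(i, i + 1)`. -/
  | s4 (i : ℕ) (p q : Bool) :
      U (i, i) = fstL a p → U (i, i + 1) = fstL a false → U (i + 1, i + 1) = sndL b q →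
      ¬ IsBBox b U (i, i + 2) →
      Switch a b U (i, i + 1)
        (Function.update (Function.update (Function.update U (i, i) (sndL b q))
          (i, i + 1) (fstL a true)) (i + 1, i + 1) (fstL a p))
  /-- (S5) `𝐚 b' / 𝐛 . ↦ b' 𝐚 / 𝐛 .`. -/
  | s5 (i j : ℕ) (p q : Bool) :
      U (i, j) = fstL a p → U (i, j + 1) = sndL b true → U (i + 1, j) = sndL b q →
      Switch a b U (i, j)
        (Function.update (Function.update U (i, j) (sndL b true)) (i, j + 1) (fstL a p))
  /-- (S6) `𝐚 b / 𝐛 . ↦ 𝐛 b / 𝐚 .`, unless (S7) or (S6') applies. -/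
  | s6 (i j : ℕ) (p q : Bool) :
      U (i, j) = fstL a p → U (i, j + 1) = sndL b false → U (i + 1, j) = sndL b q →
      ¬ (i + 1 = j ∧ p = false ∧ IsABox a U (i, i)) →
      ¬ (i + 1 = j ∧ p = true ∧ q = false) →
      Switch a b U (i, j)
        (Function.update (Function.update U (i, j) (sndL b q)) (i + 1, j) (fstL a p))
  /-- (S6') `a' b / b . ↦ b' b / a .`, with the lower `b`-box on the main diagonal. -/
  | s6' (i : ℕ) :
      U (i, i + 1) = fstL a true → U (i, i + 2) = sndL b false →
      U (i + 1, i + 1) = sndL b false →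
      Switch a b U (i, i + 1)
        (Function.update (Function.update U (i, i + 1) (sndL b true)) (i + 1, i + 1)
          (fstL a false))
  /-- (S7) `𝐚 a b / * 𝐛 . ↦ 𝐛 a' b / * 𝐚 .`, applied to the `a`-box `(i, i + 1)`. -/
  | s7 (i : ℕ) (p q : Bool) :
      U (i, i) = fstL a p → U (i, i + 1) = fstL a false → U (i, i + 2) = sndL b false →
      U (i + 1, i + 1) = sndL b q →
      Switch a b U (i, i + 1)
        (Function.update (Function.update (Function.update U (i, i) (sndL b q))
          (i, i + 1) (fstL a true)) (i + 1, i + 1) (fstL a p))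

/-- One step of the modified shifted switching process on the `a`-boxes of the first and the
`b`-boxes of the second tableau. -/
def Step (a b : ℕ) (U V : PairFilling) : Prop := ∃ c, IsNextBox a b U c ∧ Switch a b U c V

/-- The modified shifted switching process on the `a`-boxes of the first and the `b`-boxes of the
second tableau: steps are made until the filling is fully switched. -/
def RunPair (a b : ℕ) (U V : PairFilling) : Prop :=
  Relation.ReflTransGen (Step a b) U V ∧ FullySwitched a b V

/-- The processes for the listed pairs `(a, b)`, one after the other. -/
inductive RunAll : List (ℕ × ℕ) → PairFilling → PairFilling → Prop
  | nil (U : PairFilling) : RunAll [] U U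
  | cons (a b : ℕ) (l : List (ℕ × ℕ)) (U V W : PairFilling) :
      RunPair a b U V → RunAll l V W → RunAll ((a, b) :: l) U W

/-- `(m, 1), …, (m, n), (m - 1, 1), …, (m - 1, n), …, (1, 1), …, (1, n)`. -/
def schedule (m n : ℕ) : List (ℕ × ℕ) :=
  (List.range m).reverse.flatMap fun i => (List.range n).map fun j => (i + 1, j + 1)

/-- The modified shifted tableau switching transforms `(S, T)` into `(P, Q)`: running the process
on `S ∪ T` moves `T` to `P` and `S` to `Q`. -/
def SwitchesTo (S T P Q : Filling) : Prop :=
  ∃ V : PairFilling, RunAll (schedule S.maxEntry T.maxEntry) (union S T) V ∧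
    P = V.second ∧ Q = V.first

end ShiftedTableau

/-! The proof standardizes both tableaux. For each letter the boxes of `k'` are listed along
decreasing diagonals (top to bottom), then those of `k` along increasing diagonals (left to right).
In this order the boxes of `S` and then those of `T` can be added one at a time to the inner shape,
every stage being an order ideal. A box `x` of `S` passes the box `y` of `T` that directly follows
it by `BoxMove`: neighbors keep their places and exchange owners, other boxes commute. The inverse
of this local rule is the rule itself, so a whole rectangle of moves can be read from its opposite
corner (`Grid.symm`). On unlabelled chains this is the involution.

What remains is the primes. Local moves preserve decreasing and increasing diagonals, that is, the
two halves of the strip of a letter, because three consecutive boxes of a chain do not begin and end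
on one diagonal. The only exception is `(i, i), (i, i + 1), (i + 1, i + 1)`, as `(i + 1, i)` is
missing (`Grows.dg_triple`). This is where the modified rules act: (S1'), (S2') and (S6') hand a
prime from one strip to the other, (S3) destroys a prime, (S4) and (S7) create one. Following the
algorithm on two strips (`exists_run`) shows that each step is forced and that the boxes undergo
exactly the grid of local moves. The primes of the outcome can be recovered from its boxes: in a
strip that meets the main diagonal the primed boxes are those listed before the diagonal box; if at
most one of the two strips meets it, the total number of primes is preserved; if neither does, each
number is. These facts form `SwapRel`, which determines the outcome (`SwapRel.unique`) and is
symmetric (`SwapRel.symm`). So the involution lifts to tableaux.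

For the lattice property fix `k`. Reading `w ŵ` changes the height `m_k - m_{k+1}` in a way
described by two numbers, the height needed at the start and the gain above it, and putting a letter
in front of `w` changes this pair by `scanStep` (`height_hatWord`). The lattice property says that
no height is needed (`isLatticeWord_iff`). While a box of `S` passes through `T` it is a hole, into
which the letters of `T` move one by one. Each such move affects at most two rows, and the final
pair does not change (`Slide.scanRows_eq`, `Leave.scanRows_eq`, `Leave.scanRows_eq'`). This gives
(b). Applied to the reversed switching supplied by (a), it also gives (c). The number of boxes of
each letter is preserved throughout, hence so are the weights. -/

namespace ShiftedTableau

/-! ### Grids of local moves -/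

/-- `x` moves through the list `ys`, one local move `R` at a time. -/
inductive Row {α β : Type*} (R : α → β → β → α → Prop) : α → List β → List β → α → Prop
  | nil (x : α) : Row R x [] [] x
  | cons {x y y' x₁ ys ys' x'} : R x y y' x₁ → Row R x₁ ys ys' x' →
      Row R x (y :: ys) (y' :: ys') x'

/-- All entries of `xs` move through the list `ys`, starting with the last one. -/
inductive Grid {α β : Type*} (R : α → β → β → α → Prop) :
    List α → List β → List β → List α → Prop
  | nil (ys : List β) : Grid R [] ys ys []
  | cons {x xs ys ys₁ ys₂ xs' x'} : Grid R xs ys ys₁ xs' → Row R x ys₁ ys₂ x' →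
      Grid R (x :: xs) ys ys₂ (x' :: xs')

section Grid
variable {α β : Type*} {R : α → β → β → α → Prop} {R' : β → α → α → β → Prop}

/-- A row read backwards contributes one further square to the bottom of each column; this is the
induction step for transposing a grid. -/
theorem Row.grid_cons (h : ∀ x y y' x', R x y y' x' → R' y' x' x y)
    {x : α} {ys₁ ys₂ : List β} {x' : α} (hr : Row R x ys₁ ys₂ x') :
    ∀ {xs xs' : List α} {ys : List β}, Grid R' ys₁ xs' xs ys →
      Grid R' ys₂ (x' :: xs') (x :: xs) ys := by
  induction hr with
  | nil x => intro xs xs' ys hg; cases hg; exact Grid.nil _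
  | cons h1 _ ih =>
    intro xs xs' ys hg
    cases hg with
    | cons hg hr => exact Grid.cons (ih hg) (Row.cons (h _ _ _ _ h1) hr)

/-- A rectangle of invertible squares can be filled in from the opposite corner, with rows and
columns exchanged. Both the involution and the column arguments below rest on this. -/
theorem Grid.symm (h : ∀ x y y' x', R x y y' x' → R' y' x' x y)
    {xs : List α} {ys ys' : List β} {xs' : List α} (hg : Grid R xs ys ys' xs') :
    Grid R' ys' xs' xs ys := by
  induction hg with
  | nil ys =>
    induction ys with
    | nil => exact Grid.nil _
    | cons y ys ih => exact Grid.cons ih (Row.nil _)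
  | cons _ hr ih => exact hr.grid_cons h ih

theorem Row.unique (h : ∀ x y y₁ x₁ y₂ x₂, R x y y₁ x₁ → R x y y₂ x₂ → y₁ = y₂ ∧ x₁ = x₂)
    {x : α} {ys ys₁ : List β} {x₁ : α} (h1 : Row R x ys ys₁ x₁) :
    ∀ {ys₂ x₂}, Row R x ys ys₂ x₂ → ys₁ = ys₂ ∧ x₁ = x₂ := by
  induction h1 with
  | nil x => intro _ _ h2; cases h2; exact ⟨rfl, rfl⟩
  | cons a _ ih =>
    intro _ _ h2
    cases h2 with
    | cons b h2 =>
      obtain ⟨rfl, rfl⟩ := h _ _ _ _ _ _ a b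
      obtain ⟨rfl, rfl⟩ := ih h2
      exact ⟨rfl, rfl⟩

theorem Grid.unique (h : ∀ x y y₁ x₁ y₂ x₂, R x y y₁ x₁ → R x y y₂ x₂ → y₁ = y₂ ∧ x₁ = x₂)
    {xs : List α} {ys ys₁ : List β} {xs₁ : List α} (h1 : Grid R xs ys ys₁ xs₁) :
    ∀ {ys₂ xs₂}, Grid R xs ys ys₂ xs₂ → ys₁ = ys₂ ∧ xs₁ = xs₂ := by
  induction h1 with
  | nil ys => intro _ _ h2; cases h2; exact ⟨rfl, rfl⟩
  | cons _ a ih =>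
    intro _ _ h2
    cases h2 with
    | cons h2 b =>
      obtain ⟨rfl, rfl⟩ := ih h2
      obtain ⟨rfl, rfl⟩ := Row.unique h a b
      exact ⟨rfl, rfl⟩

theorem Row.length_eq {x : α} {ys ys' : List β} {x' : α} (h : Row R x ys ys' x') :
    ys'.length = ys.length := by
  induction h with
  | nil => rfl
  | cons _ _ ih => simp [ih]

theorem Grid.length_eq {xs : List α} {ys ys' : List β} {xs' : List α}
    (h : Grid R xs ys ys' xs') : ys'.length = ys.length ∧ xs'.length = xs.length := by
  induction h with
  | nil => exact ⟨rfl, rfl⟩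
  | cons _ hr ih => exact ⟨hr.length_eq.trans ih.1, by simp [ih.2]⟩

theorem Row.append {x x₁ x' : α} {ys ys' zs zs' : List β} (h : Row R x ys ys' x₁)
    (h' : Row R x₁ zs zs' x') : Row R x (ys ++ zs) (ys' ++ zs') x' := by
  induction h with
  | nil => exact h'
  | cons a _ ih => exact Row.cons a (ih h')

theorem Grid.append {xs₁ xs₂ : List α} {ys zs ws : List β} {xs₁' xs₂' : List α}
    (h₂ : Grid R xs₂ ys zs xs₂') (h₁ : Grid R xs₁ zs ws xs₁') :
    Grid R (xs₁ ++ xs₂) ys ws (xs₁' ++ xs₂') := by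
  induction h₁ with
  | nil => exact h₂
  | cons _ hr ih => exact Grid.cons (ih h₂) hr

theorem Grid.split {xs₁ xs₂ : List α} : ∀ {ys ws : List β} {xs' : List α},
    Grid R (xs₁ ++ xs₂) ys ws xs' → ∃ xs₁' xs₂' zs, xs' = xs₁' ++ xs₂' ∧
      Grid R xs₂ ys zs xs₂' ∧ Grid R xs₁ zs ws xs₁' := by
  induction xs₁ with
  | nil => intro ys ws xs' h; exact ⟨[], xs', ws, rfl, h, Grid.nil _⟩
  | cons x xs₁ ih =>
    intro ys ws xs' h
    cases h with
    | cons h hr =>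
      obtain ⟨xs₁', xs₂', zs, rfl, h1, h2⟩ := ih h
      exact ⟨_, xs₂', zs, rfl, h1, Grid.cons h2 hr⟩

end Grid

/-! ### Diagonals and local moves of boxes -/

/-- The diagonal of a box. -/
def dg (c : Box) : ℤ := (c.2 : ℤ) - c.1

/-- The diagonals of two boxes are adjacent. -/
def Adj (x y : Box) : Prop := dg x = dg y + 1 ∨ dg y = dg x + 1

instance (x y : Box) : Decidable (Adj x y) := by unfold Adj; infer_instance

theorem Adj.symm {x y : Box} (h : Adj x y) : Adj y x := Or.symm h

/-- Two boxes added one after the other exchange their order: if they are neighbors they keep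
their places and exchange their names, otherwise they commute. -/
def BoxMove (x y y' x' : Box) : Prop :=
  (Adj x y ∧ y' = x ∧ x' = y) ∨ (¬ Adj x y ∧ y' = y ∧ x' = x)

theorem BoxMove.symm (x y y' x' : Box) (h : BoxMove x y y' x') : BoxMove y' x' x y := by
  rcases h with ⟨h, rfl, rfl⟩ | ⟨h, rfl, rfl⟩
  · exact Or.inl ⟨h, rfl, rfl⟩
  · exact Or.inr ⟨fun h' => h h'.symm, rfl, rfl⟩

theorem BoxMove.unique (x y y₁ x₁ y₂ x₂ : Box) (h₁ : BoxMove x y y₁ x₁)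
    (h₂ : BoxMove x y y₂ x₂) : y₁ = y₂ ∧ x₁ = x₂ := by
  rcases h₁ with ⟨h, rfl, rfl⟩ | ⟨h, rfl, rfl⟩ <;>
    rcases h₂ with ⟨h', rfl, rfl⟩ | ⟨h', rfl, rfl⟩ <;> first | exact ⟨rfl, rfl⟩ | contradiction

theorem BoxMove.adj {x y : Box} (h : Adj x y) : BoxMove x y x y := Or.inl ⟨h, rfl, rfl⟩

theorem BoxMove.comm {x y : Box} (h : ¬ Adj x y) : BoxMove x y y x := Or.inr ⟨h, rfl, rfl⟩

theorem exists_row (x : Box) (L : List Box) : ∃ L' x', Row BoxMove x L L' x' := by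
  induction L generalizing x with
  | nil => exact ⟨[], x, Row.nil _⟩
  | cons y L ih =>
    by_cases h : Adj x y
    · obtain ⟨L', x', h'⟩ := ih y
      exact ⟨_, _, Row.cons (BoxMove.adj h) h'⟩
    · obtain ⟨L', x', h'⟩ := ih x
      exact ⟨_, _, Row.cons (BoxMove.comm h) h'⟩

theorem row_of_not_adj {x : Box} {L : List Box} (h : ∀ y ∈ L, ¬ Adj x y) :
    Row BoxMove x L L x := by
  induction L with
  | nil => exact Row.nil _
  | cons y L ih =>
    exact Row.cons (BoxMove.comm (h y (by simp))) (ih fun z hz => h z (by simp [hz]))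

theorem Row.perm {x x' : Box} {L L' : List Box} (h : Row BoxMove x L L' x') :
    (x :: L).Perm (x' :: L') := by
  induction h with
  | nil => exact List.Perm.refl _
  | cons a _ ih =>
    rcases a with ⟨_, rfl, rfl⟩ | ⟨_, rfl, rfl⟩
    · exact (List.Perm.cons _ ih).trans (List.Perm.swap _ _ _)
    · exact (List.Perm.swap _ _ _).trans ((List.Perm.cons _ ih).trans (List.Perm.swap _ _ _))

theorem Grid.perm {xs ys ys' xs' : List Box} (h : Grid BoxMove xs ys ys' xs') :
    (xs ++ ys).Perm (ys' ++ xs') := by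
  induction h with
  | nil => simp
  | @cons x xs ys ys₁ ys₂ xs' x' _ hr ih =>
    have h2 : (x :: (ys₁ ++ xs')).Perm (x' :: (ys₂ ++ xs')) :=
      List.Perm.append_right xs' hr.perm
    exact ((List.Perm.cons x ih).trans h2).trans List.perm_middle.symm

/-! ### Order ideals and chains of order ideals -/

/-- The order ideals of the shifted quadrant; the finite ones are the shifted shapes. -/
def IsIdeal (X : Set Box) : Prop :=
  (∀ c ∈ X, c.1 ≤ c.2) ∧
    ∀ c ∈ X, ∀ c' : Box, c'.1 ≤ c'.2 → c'.1 ≤ c.1 → c'.2 ≤ c.2 → c' ∈ X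

/-- The boxes in the list can be added to the ideal one after the other. -/
def Grows : Set Box → List Box → Prop
  | N, [] => IsIdeal N
  | N, c :: L => IsIdeal N ∧ c ∉ N ∧ Grows (insert c N) L

/-- The union of a set of boxes and the entries of a list. -/
def extend (N : Set Box) (L : List Box) : Set Box := N ∪ {c | c ∈ L}

@[simp] theorem extend_nil (N : Set Box) : extend N [] = N := by simp [extend]

theorem extend_cons (N : Set Box) (c : Box) (L : List Box) :
    extend N (c :: L) = extend (insert c N) L := by
  ext d; simp only [extend, Set.mem_union, Set.mem_ofPred_eq, List.mem_cons, Set.mem_insert_iff]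
  tauto

theorem mem_extend {N : Set Box} {L : List Box} {c : Box} :
    c ∈ extend N L ↔ c ∈ N ∨ c ∈ L := Iff.rfl

theorem Grows.isIdeal {N : Set Box} {L : List Box} (h : Grows N L) : IsIdeal N := by
  cases L with
  | nil => exact h
  | cons c L => exact h.1

theorem grows_append {N : Set Box} {L L' : List Box} :
    Grows N (L ++ L') ↔ Grows N L ∧ Grows (extend N L) L' := by
  induction L generalizing N with
  | nil => simp only [List.nil_append, extend_nil]; exact ⟨fun h => ⟨h.isIdeal, h⟩, And.right⟩
  | cons c L ih =>
    simp only [List.cons_append, Grows, ih, extend_cons, and_assoc]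

theorem Grows.isIdeal_extend {N : Set Box} {L : List Box} (h : Grows N L) :
    IsIdeal (extend N L) := by
  have : Grows N (L ++ []) := by simpa using h
  exact (grows_append.1 this).2

theorem Grows.not_mem {N : Set Box} {L : List Box} (h : Grows N L) {c : Box} (hc : c ∈ L) :
    c ∉ N := by
  induction L generalizing N with
  | nil => simp at hc
  | cons d L ih =>
    rcases List.mem_cons.1 hc with rfl | hc
    · exact h.2.1
    · exact fun h' => ih h.2.2 hc (Set.mem_insert_of_mem _ h')

theorem Grows.le {N : Set Box} {L : List Box} (h : Grows N L) {c : Box} (hc : c ∈ L) :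
    c.1 ≤ c.2 := h.isIdeal_extend.1 c (Or.inr hc)

/-- A box that is added later is not weakly northwest of a box added before. -/
theorem Grows.pairwise {N : Set Box} {L : List Box} (h : Grows N L) :
    L.Pairwise fun c c' => ¬ (c'.1 ≤ c.1 ∧ c'.2 ≤ c.2) := by
  induction L generalizing N with
  | nil => exact List.Pairwise.nil
  | cons c L ih =>
    refine List.Pairwise.cons (fun c' hc' hle => ?_) (ih h.2.2)
    exact h.2.2.not_mem hc'
      (h.2.2.isIdeal.2 c (Set.mem_insert _ _) c' (h.2.2.le hc') hle.1 hle.2)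

theorem Grows.nodup {N : Set Box} {L : List Box} (h : Grows N L) : L.Nodup :=
  h.pairwise.imp fun h heq => h (by simp [heq])

/-- Boxes weakly northwest of a box of the chain are in the ideal or have been added before. -/
theorem Grows.mem_of_le {N : Set Box} {P Q : List Box} {c c' : Box}
    (h : Grows N (P ++ c' :: Q)) (hc : c.1 ≤ c.2) (h1 : c.1 ≤ c'.1) (h2 : c.2 ≤ c'.2)
    (hne : c ≠ c') : c ∈ N ∨ c ∈ P := by
  have h3 := (grows_append.1 h).2.2.2.isIdeal
  have := h3.2 c' (Set.mem_insert _ _) c hc h1 h2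
  rcases this with h | h
  · exact absurd h hne
  · exact h

/-- Every box of the quadrant northwest of `c'` and southeast of `c` has to be present before `c'`,
yet only `c` itself is. So `c'` cannot lie further away than a neighbor, unless it is incomparable
to `c`, and then the diagonals differ by more than one. -/
theorem Grows.adj_iff {N : Set Box} {c c' : Box} {L : List Box} (h : Grows N (c :: c' :: L)) :
    Adj c c' ↔ c' = (c.1, c.2 + 1) ∨ c' = (c.1 + 1, c.2) := by
  have hp := h.pairwise
  have hc := h.le (c := c) (by simp)
  have hc' := h.le (c := c') (by simp)
  have hn : ¬(c'.1 ≤ c.1 ∧ c'.2 ≤ c.2) := by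
    have := (List.pairwise_cons.1 hp).1 c' (by simp)
    exact this
  have hN : c ∉ N := h.2.1
  have hNi := h.isIdeal
  constructor
  · intro ha
    have hge : c.1 ≤ c'.1 ∧ c.2 ≤ c'.2 := by unfold Adj dg at ha; omega
    by_contra hne
    push Not at hne
    obtain ⟨hne1, hne2⟩ := hne
    have key : ∀ d : Box, d.1 ≤ d.2 → d.1 ≤ c'.1 → d.2 ≤ c'.2 → d ≠ c' → c.1 ≤ d.1 → c.2 ≤ d.2 →
        d = c := by
      intro d hd h1 h2 h3 h4 h5
      have := Grows.mem_of_le (P := [c]) (Q := L) (by simpa using h) hd h1 h2 h3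
      rcases this with h' | h'
      · exact absurd (hNi.2 d h' c hc h4 h5) hN
      · simpa using h'
    by_cases h2 : c.2 < c'.2
    · have := key (c.1, c.2 + 1) (by simp; omega) hge.1 (by simp; omega) (Ne.symm hne1) le_rfl (by simp)
      simp [Prod.ext_iff] at this
    · have h1 : c.1 < c'.1 := by omega
      have := key (c.1 + 1, c.2) (by simp; omega) (by simp; omega) hge.2 (Ne.symm hne2) (by simp) le_rfl
      simp [Prod.ext_iff] at this
  · rintro (rfl | rfl) <;> unfold Adj dg <;> push_cast <;> omega

theorem Grows.not_le_of_not_adj {N : Set Box} {c c' : Box} {L : List Box}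
    (h : Grows N (c :: c' :: L)) (ha : ¬ Adj c c') : ¬ (c.1 ≤ c'.1 ∧ c.2 ≤ c'.2) := by
  intro hge
  have hp := h.pairwise
  have hc := h.le (c := c) (by simp)
  have hn : ¬(c'.1 ≤ c.1 ∧ c'.2 ≤ c.2) := (List.pairwise_cons.1 hp).1 c' (by simp)
  have hN : c ∉ N := h.2.1
  have key : ∀ d : Box, d.1 ≤ d.2 → d.1 ≤ c'.1 → d.2 ≤ c'.2 → d ≠ c' → c.1 ≤ d.1 → c.2 ≤ d.2 →
      d = c := by
    intro d hd h1 h2 h3 h4 h5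
    have := Grows.mem_of_le (P := [c]) (Q := L) (by simpa using h) hd h1 h2 h3
    rcases this with h' | h'
    · exact absurd (h.isIdeal.2 d h' c hc h4 h5) hN
    · simpa using h'
  rw [h.adj_iff] at ha
  push Not at ha
  have hc' := h.le (c := c') (by simp)
  by_cases h2 : c.2 < c'.2
  · have := key (c.1, c.2 + 1) (by simp; omega) hge.1 (by simp; omega) (Ne.symm ha.1) le_rfl (by simp)
    simp [Prod.ext_iff] at this
  · have := key (c.1 + 1, c.2) (by simp; omega) (by simp; omega) hge.2 (Ne.symm ha.2) (by simp) le_rfl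
    simp [Prod.ext_iff] at this

theorem Grows.dg_ne {N : Set Box} {c c' : Box} {L : List Box}
    (h : Grows N (c :: c' :: L)) : dg c ≠ dg c' := by
  intro hd
  have hn : ¬(c'.1 ≤ c.1 ∧ c'.2 ≤ c.2) := (List.pairwise_cons.1 h.pairwise).1 c' (by simp)
  refine h.not_le_of_not_adj (by unfold Adj; omega) ?_
  unfold dg at hd; omega

/-- Consecutive boxes that are not neighbors are incomparable in the northwest order, so either may
be added first. -/
theorem Grows.swap {N : Set Box} {c c' : Box} {L : List Box}
    (h : Grows N (c :: c' :: L)) (ha : ¬ Adj c c') : Grows N (c' :: c :: L) := by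
  have hnle := h.not_le_of_not_adj ha
  have hne : c ≠ c' := fun h => hnle (by simp [h])
  have hc' : c' ∉ N := h.not_mem (by simp)
  have h2 := h.2.2.2.2.isIdeal
  refine ⟨h.1, hc', ⟨?_, ?_⟩, ?_, ?_⟩
  · intro d hd; exact h2.1 d (by rcases hd with rfl | hd <;> simp_all)
  · intro d hd e he h3 h4
    have : e ∈ insert c' (insert c N) := h2.2 d (by rcases hd with rfl | hd <;> simp_all) e he h3 h4
    rcases this with rfl | rfl | h'
    · simp
    · exfalso
      rcases hd with rfl | hd
      · exact hnle ⟨h3, h4⟩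
      · exact h.2.1 (h.1.2 d hd e he h3 h4)
    · exact Set.mem_insert_of_mem _ h'
  · rintro (h' | h')
    · exact hne h'
    · exact h.2.1 h'
  · rw [Set.insert_comm]; exact h.2.2.2.2

/-- Diagonals of three consecutive boxes of a chain. -/
theorem Grows.dg_triple {N : Set Box} {c₁ c₂ c₃ : Box} {L : List Box}
    (h : Grows N (c₁ :: c₂ :: c₃ :: L)) (hd : dg c₁ = dg c₃) : dg c₁ = 0 ∧ dg c₂ = 1 := by
  by_cases ha : Adj c₁ c₂
  · have h2 := h.2.2
    have hp := (List.pairwise_cons.1 h.pairwise).1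
    have hn3 : ¬(c₃.1 ≤ c₁.1 ∧ c₃.2 ≤ c₁.2) := hp c₃ (by simp)
    have hc1 := h.le (c := c₁) (by simp)
    have key : ∀ d : Box, d.1 ≤ d.2 → d.1 ≤ c₃.1 → d.2 ≤ c₃.2 → d ≠ c₃ → c₁.1 ≤ d.1 →
        c₁.2 ≤ d.2 → d = c₁ ∨ d = c₂ := by
      intro d hd h1 h2 h3 h4 h5
      have := Grows.mem_of_le (P := [c₁, c₂]) (Q := L) (by simpa using h) hd h1 h2 h3
      rcases this with h' | h'
      · exact absurd (h.isIdeal.2 d h' c₁ hc1 h4 h5) h.2.1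
      · simpa using h'
    have hE := key (c₁.1, c₁.2 + 1) (by simp; omega) (by unfold dg at hd; simp; omega)
      (by unfold dg at hd; simp; omega)
      (by intro h; rw [← h] at hd; unfold dg at hd; simp at hd) le_rfl (by simp)
    rcases hE with hE | hE
    · simp [Prod.ext_iff] at hE
    -- Off the main diagonal the south neighbor of `c₁` would also have to be `c₂`, which is already
    -- the east neighbor. On the main diagonal there is no south neighbor; this is the sole
    -- exception, and the origin of the modified rules.
    by_cases h0 : c₁.1 = c₁.2
    · rw [← hE]; unfold dg; simp [h0]
    · have hS := key (c₁.1 + 1, c₁.2) (by simp; omega) (by unfold dg at hd; simp; omega)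
        (by unfold dg at hd; simp; omega)
        (by intro h; rw [← h] at hd; unfold dg at hd; simp at hd) (by simp) le_rfl
      rcases hS with hS | hS
      · simp [Prod.ext_iff] at hS
      · rw [← hE] at hS; simp [Prod.ext_iff] at hS
  · exact absurd hd (h.swap ha).2.2.dg_ne

theorem Grows.row {N : Set Box} {x x' : Box} {L L' Q : List Box} (hr : Row BoxMove x L L' x')
    (h : Grows N (x :: L ++ Q)) : Grows N (L' ++ x' :: Q) := by
  induction hr generalizing N with
  | nil => exact h
  | cons a _ ih =>
    rcases a with ⟨_, rfl, rfl⟩ | ⟨ha, rfl, rfl⟩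
    · exact ⟨h.1, h.2.1, ih h.2.2⟩
    · have h' := Grows.swap h ha
      exact ⟨h'.1, h'.2.1, ih h'.2.2⟩

theorem Grows.grid {N : Set Box} {xs ys ys' xs' : List Box} (hg : Grid BoxMove xs ys ys' xs') :
    ∀ {Q : List Box}, Grows N (xs ++ (ys ++ Q)) → Grows N (ys' ++ (xs' ++ Q)) := by
  induction hg generalizing N with
  | nil => intro Q h; simpa using h
  | @cons x xs ys ys₁ ys₂ xs' x' _ hr ih =>
    intro Q h
    exact Grows.row (Q := xs' ++ Q) hr ⟨h.1, h.2.1, ih h.2.2⟩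


/-! ### Preservation of ascents and descents -/

/-- The diagonals of the boxes decrease strictly. -/
def Desc (L : List Box) : Prop := L.Pairwise fun c c' => dg c' < dg c

/-- The diagonals of the boxes increase strictly. -/
def Asc (L : List Box) : Prop := L.Pairwise fun c c' => dg c < dg c'

theorem desc_cons_cons {c c' : Box} {L : List Box} :
    Desc (c :: c' :: L) ↔ dg c' < dg c ∧ Desc (c' :: L) := by
  simp only [Desc, List.pairwise_cons, List.mem_cons, forall_eq_or_imp]
  constructor
  · rintro ⟨⟨h1, -⟩, h2⟩; exact ⟨h1, h2⟩
  · rintro ⟨h1, h2, h3⟩; exact ⟨⟨h1, fun d hd => (h2 d hd).trans h1⟩, h2, h3⟩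

theorem asc_cons_cons {c c' : Box} {L : List Box} :
    Asc (c :: c' :: L) ↔ dg c < dg c' ∧ Asc (c' :: L) := by
  simp only [Asc, List.pairwise_cons, List.mem_cons, forall_eq_or_imp]
  constructor
  · rintro ⟨⟨h1, -⟩, h2⟩; exact ⟨h1, h2⟩
  · rintro ⟨h1, h2, h3⟩; exact ⟨⟨h1, fun d hd => h1.trans (h2 d hd)⟩, h2, h3⟩

theorem Grows.move {N : Set Box} {x y y' x' : Box} {L : List Box} (a : BoxMove x y y' x')
    (h : Grows N (x :: y :: L)) : Grows N (y' :: x' :: L) := by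
  rcases a with ⟨_, rfl, rfl⟩ | ⟨ha, rfl, rfl⟩
  · exact h
  · exact h.swap ha

theorem BoxMove.dg {x y y' x' : Box} (a : BoxMove x y y' x') :
    ((dg x = dg y + 1 ∨ dg y = dg x + 1) ∧ dg y' = dg x ∧ dg x' = dg y) ∨
      (¬ (dg x = dg y + 1 ∨ dg y = dg x + 1) ∧ dg y' = dg y ∧ dg x' = dg x) := by
  rcases a with ⟨h, rfl, rfl⟩ | ⟨h, rfl, rfl⟩
  · exact Or.inl ⟨h, rfl, rfl⟩
  · exact Or.inr ⟨h, rfl, rfl⟩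

/-- Two consecutive outputs can fail to descend only if `x` and the second of two adjacent boxes of
`D` lie on one diagonal. By `Grows.dg_triple` this is the main diagonal, which positivity rules out.
-/
theorem Row.desc {x x' : Box} {D D' : List Box} (hr : Row BoxMove x D D' x') :
    ∀ {N : Set Box}, Grows N (x :: D) → Desc D → (∀ c ∈ D, 0 < ShiftedTableau.dg c) → Desc D' := by
  induction hr with
  | nil => intro _ _ _ _; exact List.Pairwise.nil
  | @cons x y y' x₁ ys ys' x' a hr ih =>
    intro N h hd hpos
    have h' := h.move a
    have ih' := ih h'.2.2 (List.pairwise_cons.1 hd).2 (fun c hc => hpos c (by simp [hc]))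
    cases hr with
    | nil => simp [Desc]
    | @cons _ z z' x₂ zs zs' _ b hr =>
      rw [desc_cons_cons] at hd ⊢
      refine ⟨?_, ih'⟩
      have h1 := h.dg_ne
      have h2 := h.dg_triple
      have h3 := hpos z (by simp)
      have h4 := hd.1
      rcases a.dg with ⟨a1, a2, a3⟩ | ⟨a1, a2, a3⟩ <;>
        rcases b.dg with ⟨b1, b2, b3⟩ | ⟨b1, b2, b3⟩ <;> omega

/-- No positivity is needed: in the exceptional triple of `Grows.dg_triple` the middle box has the
larger diagonal, so its last two boxes are not ascending. -/
theorem Row.asc {x x' : Box} {D D' : List Box} (hr : Row BoxMove x D D' x') :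
    ∀ {N : Set Box}, Grows N (x :: D) → Asc D → Asc D' := by
  induction hr with
  | nil => intro _ _ _; exact List.Pairwise.nil
  | @cons x y y' x₁ ys ys' x' a hr ih =>
    intro N h hd
    have h' := h.move a
    have ih' := ih h'.2.2 (List.pairwise_cons.1 hd).2
    cases hr with
    | nil => simp [Asc]
    | @cons _ z z' x₂ zs zs' _ b hr =>
      rw [asc_cons_cons] at hd ⊢
      refine ⟨?_, ih'⟩
      have h1 := h.dg_ne
      have h2 := h.dg_triple
      have h4 := hd.1
      rcases a.dg with ⟨a1, a2, a3⟩ | ⟨a1, a2, a3⟩ <;>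
        rcases b.dg with ⟨b1, b2, b3⟩ | ⟨b1, b2, b3⟩ <;> omega

theorem Row.grid_singleton {z y : Box} {xs xs' : List Box} (h : Row BoxMove z xs' xs y) :
    Grid BoxMove xs [y] [z] xs' :=
  Grid.symm BoxMove.symm (Grid.cons (Grid.nil _) h)

theorem Row.mem_of_mem {x x' : Box} {L L' : List Box} (h : Row BoxMove x L L' x') {c : Box}
    (hc : c ∈ L' ∨ c = x') : c ∈ L ∨ c = x := by
  have : c ∈ x' :: L' := by rcases hc with hc | hc <;> simp [hc]
  have := h.perm.mem_iff.2 this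
  rcases List.mem_cons.1 this with h | h
  · exact Or.inr h
  · exact Or.inl h

theorem Row.mem_of_mem' {x x' : Box} {L L' : List Box} (h : Row BoxMove x L L' x') {c : Box}
    (hc : c ∈ L ∨ c = x) : c ∈ L' ∨ c = x' := by
  have : c ∈ x :: L := by rcases hc with hc | hc <;> simp [hc]
  have := h.perm.mem_iff.1 this
  rcases List.mem_cons.1 this with h | h
  · exact Or.inr h
  · exact Or.inl h

/-- The row is read as a column here: the boxes `xs` one after the other pass the single box `y`,
which ends up at `z`. The exceptional triple would begin with an ascent, so descents always survive.
-/
theorem Row.desc_col {z y : Box} {xs xs' : List Box} (hr : Row BoxMove z xs' xs y) :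
    ∀ {N : Set Box}, Grows N (xs ++ [y]) → Desc xs → Desc xs' := by
  induction hr with
  | nil => intro _ _ _; exact List.Pairwise.nil
  | @cons z x' x z₁ xs' xs y a hr ih =>
    intro N h hd
    have ih' := ih h.2.2 (List.pairwise_cons.1 hd).2
    cases hr with
    | nil => simp [Desc]
    | @cons _ w' w z₂ ws' ws _ b hr =>
      rw [desc_cons_cons] at hd ⊢
      refine ⟨?_, ih'⟩
      have h0 : Grows N (x :: w :: z₂ :: ws') := by
        have := Grows.grid (Q := []) hr.grid_singleton (N := insert w (insert x N))
          (by simpa using h.2.2.2.2)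
        exact ⟨h.1, h.2.1, h.2.2.1, h.2.2.2.1, by simpa using this⟩
      have h1 := h0.dg_ne
      have h2 := h0.dg_triple
      have h3 := h0.2.2.dg_ne
      have h4 := hd.1
      rcases a.dg with ⟨a1, a2, a3⟩ | ⟨a1, a2, a3⟩ <;>
        rcases b.dg with ⟨b1, b2, b3⟩ | ⟨b1, b2, b3⟩ <;> omega

/-- Ascents can break only at boxes `(i, i)`, `(i, i + 1)` passing a box at `(i + 1, i + 1)`, the
situation of (S4) and (S7). The disjunction excludes it, since either the moving boxes avoid the
main diagonal or `y` does. -/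
theorem Row.asc_col {z y : Box} {xs xs' : List Box} (hr : Row BoxMove z xs' xs y) :
    ∀ {N : Set Box}, Grows N (xs ++ [y]) → Asc xs →
      ((∀ c ∈ xs, 0 < ShiftedTableau.dg c) ∨ ShiftedTableau.dg y ≠ 0) → Asc xs' := by
  induction hr with
  | nil => intro _ _ _ _; exact List.Pairwise.nil
  | @cons z x' x z₁ xs' xs y a hr ih =>
    intro N h hd hpos
    have ih' := ih h.2.2 (List.pairwise_cons.1 hd).2
      (hpos.imp (fun hpos c hc => hpos c (by simp [hc])) id)
    have hmem := hr
    cases hr with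
    | nil => simp [Asc]
    | @cons _ w' w z₂ ws' ws _ b hr =>
      have hlt := (List.pairwise_cons.1 (List.pairwise_cons.1 hd).2).1
      rw [asc_cons_cons] at hd ⊢
      refine ⟨?_, ih'⟩
      have h0 : Grows N (x :: w :: z₂ :: ws') := by
        have := Grows.grid (Q := []) hr.grid_singleton (N := insert w (insert x N))
          (by simpa using h.2.2.2.2)
        exact ⟨h.1, h.2.1, h.2.2.1, h.2.2.2.1, by simpa using this⟩
      have h1 := h0.dg_ne
      have h2 := h0.dg_triple
      have h3 := h0.2.2.dg_ne
      have h4 := hd.1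
      -- If `x` is on the main diagonal, then the place `z₂` just behind the next box is not: it is
      -- either a later box of the ascending list or `y` itself.
      have h5 : ShiftedTableau.dg x = 0 → ShiftedTableau.dg z₂ ≠ 0 := by
        intro hx
        rcases hr.mem_of_mem' (Or.inr rfl) with hz | rfl
        · have := hlt _ hz; omega
        · rcases hpos with hpos | hpos
          · have := hpos x (by simp); omega
          · exact hpos
      rcases a.dg with ⟨a1, a2, a3⟩ | ⟨a1, a2, a3⟩ <;>
        rcases b.dg with ⟨b1, b2, b3⟩ | ⟨b1, b2, b3⟩ <;> omega

/-- By the symmetry of local moves a grid can also be peeled off by columns: all boxes of `xs` pass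
the first box `y` before any of them meets the others. -/
theorem Grid.uncons {xs ys ws xs' : List Box} {y : Box} (h : Grid BoxMove xs (y :: ys) ws xs') :
    ∃ z zs m, ws = z :: zs ∧ Row BoxMove z m xs y ∧ Grid BoxMove m ys zs xs' := by
  have h' := Grid.symm BoxMove.symm h
  cases h' with
  | cons h' hr => exact ⟨_, _, _, rfl, hr, Grid.symm BoxMove.symm h'⟩

theorem Grid.nil_right {xs ws xs' : List Box} (h : Grid BoxMove xs [] ws xs') :
    ws = [] ∧ xs' = xs := by
  have h' := Grid.symm BoxMove.symm h
  have := h.length_eq.1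
  cases ws with
  | nil => cases h'; exact ⟨rfl, rfl⟩
  | cons => simp at this

theorem Grid.grows_uncons {N : Set Box} {xs ys m : List Box} {y z : Box}
    (hr : Row BoxMove z m xs y) (h : Grows N (xs ++ (y :: ys))) :
    Grows N (xs ++ [y]) ∧ Grows (insert z N) (m ++ ys) := by
  constructor
  · rw [show xs ++ (y :: ys) = (xs ++ [y]) ++ ys by simp] at h
    exact (grows_append.1 h).1
  · have := Grows.grid (Q := ys) hr.grid_singleton (by simpa using h)
    exact this.2.2

theorem Grid.desc {ys : List Box} : ∀ {N : Set Box} {xs ws xs' : List Box},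
    Grid BoxMove xs ys ws xs' → Grows N (xs ++ ys) → Desc xs → Desc xs' := by
  induction ys with
  | nil => intro N xs ws xs' h _ hd; rw [h.nil_right.2]; exact hd
  | cons y ys ih =>
    intro N xs ws xs' h hN hd
    obtain ⟨z, zs, m, rfl, hr, hg⟩ := h.uncons
    obtain ⟨h1, h2⟩ := Grid.grows_uncons hr hN
    exact ih hg h2 (hr.desc_col h1 hd)

theorem Grid.asc {ys : List Box} : ∀ {N : Set Box} {xs ws xs' : List Box},
    Grid BoxMove xs ys ws xs' → Grows N (xs ++ ys) → Asc xs →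
      (∀ c ∈ ys, dg c ≠ 0) → Asc xs' := by
  induction ys with
  | nil => intro N xs ws xs' h _ hd _; rw [h.nil_right.2]; exact hd
  | cons y ys ih =>
    intro N xs ws xs' h hN hd hpos
    obtain ⟨z, zs, m, rfl, hr, hg⟩ := h.uncons
    obtain ⟨h1, h2⟩ := Grid.grows_uncons hr hN
    exact ih hg h2 (hr.asc_col h1 hd (Or.inr (hpos y (by simp))))
      (fun c hc => hpos c (by simp [hc]))

/-- Ascents are preserved if the moving boxes start off the main diagonal. -/
theorem Grid.asc_of_pos {ys : List Box} : ∀ {N : Set Box} {xs ws xs' : List Box},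
    Grid BoxMove xs ys ws xs' → Grows N (xs ++ ys) → Asc xs → (∀ c ∈ xs, 0 < dg c) →
      ys.Pairwise (fun c c' => ¬ (dg c = 0 ∧ dg c' = 0)) → Asc xs' := by
  induction ys with
  | nil => intro N xs ws xs' h _ hd _ _; rw [h.nil_right.2]; exact hd
  | cons y ys ih =>
    intro N xs ws xs' h hN hd hpos hys
    obtain ⟨z, zs, m, rfl, hr, hg⟩ := h.uncons
    obtain ⟨h1, h2⟩ := Grid.grows_uncons hr hN
    have h3 := hr.asc_col h1 hd (Or.inl hpos)
    rw [List.pairwise_cons] at hys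
    -- As long as no `y` on the main diagonal has been met, the moving boxes stay off it. Once one
    -- has been met, no later `y` lies on the diagonal, and the other criterion takes over.
    by_cases hy : dg y = 0
    · exact hg.asc h2 h3 (fun c hc h0 => hys.1 c hc ⟨hy, h0⟩)
    · refine ih hg h2 h3 (fun c hc => ?_) hys.2
      have hc0 : c.1 ≤ c.2 := h2.le (by simp [hc])
      rcases hr.mem_of_mem' (Or.inl hc) with hc | rfl
      · exact hpos c hc
      · unfold dg at hy ⊢; omega


/-! ### Fillings given by lists of labelled boxes -/

/-- The filling with the listed entries. -/
def fill {V : Type*} : List (Box × V) → Box → Option V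
  | [] => fun _ => none
  | (c, v) :: W => Function.update (fill W) c (some v)

section fill
variable {V : Type*}

theorem fill_eq_some_iff {W : List (Box × V)} (h : (W.map Prod.fst).Nodup) {c : Box} {v : V} :
    fill W c = some v ↔ (c, v) ∈ W := by
  induction W with
  | nil => simp [fill]
  | cons e W ih =>
    obtain ⟨d, u⟩ := e
    simp only [List.map_cons, List.nodup_cons] at h
    by_cases hcd : c = d
    · subst hcd
      have : (c, v) ∉ W := fun h' => h.1 (List.mem_map.2 ⟨_, h', rfl⟩)
      simp [fill, this, eq_comm]
    · simp [fill, hcd, ih h.2]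

theorem fill_eq_none_iff {W : List (Box × V)} {c : Box} :
    fill W c = none ↔ c ∉ W.map Prod.fst := by
  induction W with
  | nil => simp [fill]
  | cons e W ih =>
    obtain ⟨d, u⟩ := e
    by_cases hcd : c = d
    · subst hcd; simp [fill]
    · rw [fill, Function.update_of_ne hcd, ih]; simp [hcd]

theorem fill_perm {W W' : List (Box × V)} (h : (W.map Prod.fst).Nodup) (hp : W.Perm W') :
    fill W = fill W' := by
  have h' : (W'.map Prod.fst).Nodup := (hp.map Prod.fst).nodup_iff.1 h
  funext c
  apply Option.ext
  intro v
  rw [fill_eq_some_iff h, fill_eq_some_iff h', hp.mem_iff]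

/-- A switch relabels boxes in their places, so its effect on the filling is a change of labels in
the list. -/
theorem update_fill {P Q : List (Box × V)} {x : Box} {u v : V}
    (h : ((P ++ (x, v) :: Q).map Prod.fst).Nodup) :
    Function.update (fill (P ++ (x, v) :: Q)) x (some u) = fill (P ++ (x, u) :: Q) := by
  induction P with
  | nil => simp [fill]
  | cons e P ih =>
    obtain ⟨d, w⟩ := e
    simp only [List.cons_append, List.map_cons, List.nodup_cons] at h
    have hd : x ≠ d := by
      rintro rfl; exact h.1 (by simp)
    simp only [List.cons_append, fill]
    rw [Function.update_comm (Ne.symm hd), ih h.2]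

theorem update_fill₂ {P Q : List (Box × V)} {x y : Box} {u v u' v' : V}
    (h : ((P ++ (x, u) :: (y, v) :: Q).map Prod.fst).Nodup) :
    Function.update (Function.update (fill (P ++ (x, u) :: (y, v) :: Q)) x (some u')) y (some v') =
      fill (P ++ (x, u') :: (y, v') :: Q) := by
  rw [update_fill h]
  have := update_fill (P := P ++ [(x, u')]) (Q := Q) (x := y) (u := v') (v := v) (by simpa using h)
  simpa using this

theorem update_fill₃ {P Q : List (Box × V)} {x y z : Box} {u v w u' v' w' : V}
    (h : ((P ++ (x, u) :: (y, v) :: (z, w) :: Q).map Prod.fst).Nodup) :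
    Function.update (Function.update (Function.update
        (fill (P ++ (x, u) :: (y, v) :: (z, w) :: Q)) x (some u')) y (some v')) z (some w') =
      fill (P ++ (x, u') :: (y, v') :: (z, w') :: Q) := by
  rw [update_fill₂ h]
  have := update_fill (P := P ++ [(x, u'), (y, v')]) (Q := Q) (x := z) (u := w') (v := w)
    (by simpa using h)
  simpa using this

end fill

/-! ### Determinism of the switching process -/

/-- The precedence among the rules is encoded in their negative side conditions, so two rules that
fit the same box cannot give different results. -/
theorem Switch.unique {a b : ℕ} {U V V' : PairFilling} {c : Box} (h : Switch a b U c V)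
    (h' : Switch a b U c V') : V = V' := by
  cases h <;> cases h' <;> simp_all [IsBBox, IsABox]

/-- A step of the process that is the only possible one. -/
def DStep (a b : ℕ) (U V : PairFilling) : Prop := Step a b U V ∧ ∀ V', Step a b U V' → V' = V

theorem dstep_of_switch {a b : ℕ} {U V : PairFilling} {x : Box}
    (hx : ∀ c, IsNextBox a b U c ↔ c = x) (h : Switch a b U x V) : DStep a b U V := by
  refine ⟨⟨x, (hx x).2 rfl, h⟩, ?_⟩
  rintro V' ⟨c, hc, hV'⟩
  obtain rfl := (hx c).1 hc
  exact hV'.unique h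

theorem FullySwitched.not_step {a b : ℕ} {U V : PairFilling} (h : FullySwitched a b U) :
    ¬ Step a b U V := by
  rintro ⟨c, ⟨hc, -⟩ | ⟨-, hc, -⟩, -⟩
  · exact h _ _ hc
  · exact h _ _ hc

/-- One sequence of forced steps that ends in a fully switched filling settles both existence and
uniqueness: any other run must follow it, and can stop neither earlier nor later. -/
theorem runPair_iff {a b : ℕ} {U V : PairFilling} (h : Relation.ReflTransGen (DStep a b) U V)
    (hV : FullySwitched a b V) (V' : PairFilling) : RunPair a b U V' ↔ V' = V := by
  constructor
  · rintro ⟨h', hV'⟩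
    induction h using Relation.ReflTransGen.head_induction_on with
    | refl =>
      rcases Relation.ReflTransGen.cases_head h' with rfl | ⟨c, hc, -⟩
      · rfl
      · exact absurd hc hV.not_step
    | head hs _ ih =>
      rcases Relation.ReflTransGen.cases_head h' with rfl | ⟨c, hc, h'⟩
      · exact absurd hs.1 hV'.not_step
      · rw [hs.2 c hc] at h'
        exact ih h'
  · rintro rfl
    exact ⟨Relation.ReflTransGen.mono (fun _ _ h => And.left h) _ _ h, hV⟩

/-- The box contents of tagged letters. -/
abbrev Content := Letter ⊕ Letter

/-- A filling in the course of the process: the `a`-box `x` is moving, the listed boxes `W`,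
then `x`, then the `b`-boxes `post`, then the boxes `R` can be added to an ideal in this order,
all `b`-boxes to be passed by the `a`-boxes in `W` and by `x` come before `R`, and `x` is the
next box to be switched. -/
structure Moving (a b : ℕ) (N : Set Box) (W : List (Box × Content)) (x : Box) (p : Bool)
    (post R : List (Box × Content)) : Prop where
  grows : Grows N ((W ++ (x, Sum.inl ⟨a, p⟩) :: (post ++ R)).map Prod.fst)
  unprimed : ∀ c, (c, Sum.inl ⟨a, false⟩) ∈ W → p = false ∧ c.2 < x.2
  primed : ∀ c, (c, Sum.inl ⟨a, true⟩) ∈ W → p = true → c.1 < x.1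
  post_snd : ∀ e ∈ post, ∃ q, e.2 = Sum.inr ⟨b, q⟩
  rest : ∀ e ∈ R, ∀ q, e.2 ≠ Sum.inr ⟨b, q⟩

section Moving
variable {a b : ℕ} {N : Set Box} {W : List (Box × Content)} {x : Box} {p : Bool}
  {post R : List (Box × Content)}

theorem Moving.nodup (h : Moving a b N W x p post R) :
    ((W ++ (x, Sum.inl ⟨a, p⟩) :: (post ++ R)).map Prod.fst).Nodup := h.grows.nodup

theorem Moving.fill_self (h : Moving a b N W x p post R) :
    fill (W ++ (x, Sum.inl ⟨a, p⟩) :: (post ++ R)) x = fstL a p :=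
  (fill_eq_some_iff h.nodup).2 (by simp)

/-- A box that is later than an entry `c'` is not weakly northwest of it. -/
theorem grows_labelled_not_le {V : Type*} {W W' : List (Box × V)} {e e' : Box × V}
    (h : Grows N ((W ++ e :: W').map Prod.fst)) (he : e' ∈ W') :
    ¬ (e'.1.1 ≤ e.1.1 ∧ e'.1.2 ≤ e.1.2) := by
  have h' := h.pairwise
  rw [List.map_append, List.map_cons, List.pairwise_append] at h'
  exact (List.pairwise_cons.1 h'.2.1).1 _ (List.mem_map.2 ⟨e', he, rfl⟩)

theorem grows_labelled_not_le' {V : Type*} {W W' : List (Box × V)} {e e' : Box × V}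
    (h : Grows N ((W ++ e :: W').map Prod.fst)) (he : e' ∈ W) :
    ¬ (e.1.1 ≤ e'.1.1 ∧ e.1.2 ≤ e'.1.2) := by
  have h' := h.pairwise
  rw [List.map_append, List.map_cons, List.pairwise_append] at h'
  exact h'.2.2 _ (List.mem_map.2 ⟨e', he, rfl⟩) _ (by simp)

theorem pairwise_of_mem_append {α : Type*} {S : α → α → Prop} {L L' : List α} {u v : α}
    (h : (L ++ L').Pairwise S) (hu : u ∈ L) (hv : v ∈ L') : S u v :=
  (List.pairwise_append.1 h).2.2 u hu v hv

/-- An `a`-box of `R` is not switchable, since a neighbor to its south or east would come after it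
in the chain, while all `b`-boxes come before `R`. An `a`-box of `W` with the label of `x` lies
strictly west of `x` (unprimed) or strictly north of it (primed), and one with the other label must
be primed while `x` is unprimed. So the choice rule selects `x`. -/
theorem Moving.isNextBox (h : Moving a b N W x p post R)
    (hs : Switchable a b (fill (W ++ (x, Sum.inl ⟨a, p⟩) :: (post ++ R))) p x) (c : Box) :
    IsNextBox a b (fill (W ++ (x, Sum.inl ⟨a, p⟩) :: (post ++ R))) c ↔ c = x := by
  have hnd := h.nodup
  have hR : ∀ p' z, (z, Sum.inl ⟨a, p'⟩) ∈ R →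
      ¬ Switchable a b (fill (W ++ (x, Sum.inl ⟨a, p⟩) :: (post ++ R))) p' z := by
    intro p' z hz hsw
    have key : ∀ z' q, (z', Sum.inr ⟨b, q⟩) ∈ (W ++ (x, Sum.inl ⟨a, p⟩) :: (post ++ R)) →
        z.1 ≤ z'.1 → z.2 ≤ z'.2 → False := by
      intro z' q hz' h1 h2
      -- Every `b`-box precedes `R` in the chain.
      have hz'' : z' ∈ ((W ++ (x, Sum.inl ⟨a, p⟩) :: post).map Prod.fst) := by
        rw [show W ++ (x, Sum.inl ⟨a, p⟩) :: (post ++ R) = (W ++ (x, Sum.inl ⟨a, p⟩) :: post) ++ R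
          by simp, List.mem_append] at hz'
        rcases hz' with hz' | hz'
        · exact List.mem_map.2 ⟨_, hz', rfl⟩
        · exact absurd rfl (h.rest _ hz' q)
      have hp := h.grows.pairwise
      rw [show W ++ (x, Sum.inl ⟨a, p⟩) :: (post ++ R) = (W ++ (x, Sum.inl ⟨a, p⟩) :: post) ++ R
          by simp, List.map_append] at hp
      exact pairwise_of_mem_append hp hz'' (List.mem_map.2 ⟨_, hz, rfl⟩) ⟨h1, h2⟩
    rcases hsw.2 with ⟨q, hq⟩ | ⟨q, hq⟩
    · exact key _ q ((fill_eq_some_iff hnd).1 hq) (by simp) le_rfl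
    · exact key _ q ((fill_eq_some_iff hnd).1 hq) le_rfl (by simp)
  have hall : ∀ p' z,
      Switchable a b (fill (W ++ (x, Sum.inl ⟨a, p⟩) :: (post ++ R))) p' z →
        (z = x ∧ p' = p) ∨ (z, Sum.inl ⟨a, p'⟩) ∈ W := by
    intro p' z hsw
    have := (fill_eq_some_iff hnd).1 hsw.1
    rw [List.mem_append, List.mem_cons, List.mem_append] at this
    rcases this with hz | hz | hz | hz
    · exact Or.inr hz
    · simp only [Prod.mk.injEq, Sum.inl.injEq, Letter.mk.injEq, true_and] at hz
      exact Or.inl hz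
    · obtain ⟨q, hq⟩ := h.post_snd _ hz
      simp at hq
    · exact absurd hsw (hR _ _ hz)
  cases p with
  | false =>
    constructor
    · rintro (⟨hc, hmax⟩ | ⟨hno, -⟩)
      · rcases hall _ _ hc with hc' | hc'
        · exact hc'.1
        · have := (h.unprimed _ hc').2
          have := hmax _ hs
          omega
      · exact absurd hs (hno _)
    · rintro rfl
      refine Or.inl ⟨hs, fun d hd => ?_⟩
      rcases hall _ _ hd with ⟨rfl, -⟩ | hd'
      · exact le_rfl
      · exact (h.unprimed _ hd').2.le
  | true =>
    have hno : ∀ d, ¬ Switchable a b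
        (fill (W ++ (x, Sum.inl ⟨a, true⟩) :: (post ++ R))) false d := by
      intro d hd
      rcases hall _ _ hd with ⟨-, h'⟩ | hd'
      · simp at h'
      · simpa using (h.unprimed _ hd').1
    constructor
    · rintro (⟨hc, -⟩ | ⟨-, hc, hmax⟩)
      · exact absurd hc (hno _)
      · rcases hall _ _ hc with hc' | hc'
        · exact hc'.1
        · have := h.primed _ hc' rfl
          have := hmax _ hs
          omega
    · rintro rfl
      refine Or.inr ⟨hno, hs, fun d hd => ?_⟩
      rcases hall _ _ hd with ⟨rfl, -⟩ | hd'
      · exact le_rfl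
      · exact (h.primed _ hd' rfl).le

/-- A neighbor of the moving box that is a `b`-box belongs to `post`. -/
theorem Moving.mem_post (h : Moving a b N W x p post R) {c : Box} {q : Bool}
    (hc : fill (W ++ (x, Sum.inl ⟨a, p⟩) :: (post ++ R)) c = sndL b q)
    (h1 : x.1 ≤ c.1) (h2 : x.2 ≤ c.2) : (c, Sum.inr ⟨b, q⟩) ∈ post := by
  have := (fill_eq_some_iff h.nodup).1 hc
  rw [List.mem_append, List.mem_cons, List.mem_append] at this
  rcases this with hz | hz | hz | hz
  · exact absurd ⟨h1, h2⟩ (grows_labelled_not_le' h.grows hz)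
  · simp at hz
  · exact hz
  · exact absurd rfl (h.rest _ hz q)

theorem Moving.fill_post (h : Moving a b N W x p post R) {c : Box} {v : Content}
    (hc : (c, v) ∈ post) : fill (W ++ (x, Sum.inl ⟨a, p⟩) :: (post ++ R)) c = some v :=
  (fill_eq_some_iff h.nodup).2 (by simp [hc])

/-- The moving box and a `b`-box that is not a neighbor commute. -/
theorem Moving.commute {y : Box} {q : Bool}
    (h : Moving a b N W x p ((y, Sum.inr ⟨b, q⟩) :: post) R) (ha : ¬ Adj x y) :
    Moving a b N (W ++ [(y, Sum.inr ⟨b, q⟩)]) x p post R ∧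
      fill (W ++ (x, Sum.inl ⟨a, p⟩) :: ((y, Sum.inr ⟨b, q⟩) :: post ++ R)) =
        fill (W ++ [(y, Sum.inr ⟨b, q⟩)] ++ (x, Sum.inl ⟨a, p⟩) :: (post ++ R)) := by
  constructor
  · constructor
    · have := h.grows
      simp only [List.map_append, List.map_cons, List.cons_append,
        List.append_assoc, List.nil_append] at this ⊢
      rw [grows_append] at this ⊢
      exact ⟨this.1, this.2.swap ha⟩
    · intro c hc; exact h.unprimed c (by simpa using hc)
    · intro c hc; exact h.primed c (by simpa using hc)
    · intro e he; exact h.post_snd e (by simp [he])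
    · exact h.rest
  · refine fill_perm h.nodup ?_
    rw [List.append_assoc]
    exact List.Perm.append_left _ (List.Perm.swap _ _ _)

theorem Moving.adj_iff {y : Box} {v : Content} (h : Moving a b N W x p ((y, v) :: post) R) :
    Adj x y ↔ y = (x.1, x.2 + 1) ∨ y = (x.1 + 1, x.2) := by
  have := h.grows
  simp only [List.map_append, List.map_cons, List.cons_append] at this
  exact (grows_append.1 this).2.adj_iff

theorem Moving.le (h : Moving a b N W x p post R) : x.1 ≤ x.2 := h.grows.le (by simp)

theorem Moving.le_of_mem (h : Moving a b N W x p post R) {e : Box × Content} (he : e ∈ post) :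
    e.1.1 ≤ e.1.2 :=
  h.grows.le (by
    simp only [List.map_append, List.map_cons, List.mem_append, List.mem_cons]
    exact Or.inr (Or.inr (Or.inl (List.mem_map.2 ⟨e, he, rfl⟩))))

theorem Moving.advance {y : Box} {q : Bool}
    (h : Moving a b N W x p ((y, Sum.inr ⟨b, q⟩) :: post) R) (ha : Adj x y) :
    Moving a b N (W ++ [(x, Sum.inr ⟨b, q⟩)]) y p post R := by
  have hxy : x.1 ≤ y.1 ∧ x.2 ≤ y.2 := by
    rcases h.adj_iff.1 ha with rfl | rfl <;> simp
  constructor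
  · simpa using h.grows
  · intro c hc
    have := h.unprimed c (by simpa using hc)
    exact ⟨this.1, this.2.trans_le hxy.2⟩
  · intro c hc hp
    exact (h.primed c (by simpa using hc) hp).trans_le hxy.1
  · intro e he; exact h.post_snd e (by simp [he])
  · exact h.rest

/-- The entries are sorted as in a strip: primed letters on descending diagonals, followed by
unprimed letters on ascending diagonals. -/
def StripSorted (b : ℕ) (post : List (Box × Content)) : Prop :=
  post.Pairwise fun e f =>
    (e.2 = Sum.inr ⟨b, false⟩ → f.2 = Sum.inr ⟨b, false⟩ ∧ dg e.1 < dg f.1) ∧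
    (e.2 = Sum.inr ⟨b, true⟩ → f.2 = Sum.inr ⟨b, true⟩ → dg f.1 < dg e.1)

/-- The exchange of the moving box with a neighbor away from the main diagonal. -/
theorem Moving.step {y : Box} {q : Bool}
    (h : Moving a b N W x p ((y, Sum.inr ⟨b, q⟩) :: post) R)
    (hsort : StripSorted b ((y, Sum.inr ⟨b, q⟩) :: post)) (ha : Adj x y)
    (hx : x.1 = x.2 → q = false)
    (hy : y.1 = y.2 → p = false ∧ ∀ p', ((x.1, x.1), Sum.inl ⟨a, p'⟩) ∉ W) :
    DStep a b (fill (W ++ (x, Sum.inl ⟨a, p⟩) :: ((y, Sum.inr ⟨b, q⟩) :: post ++ R)))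
      (fill (W ++ [(x, Sum.inr ⟨b, q⟩)] ++ (y, Sum.inl ⟨a, p⟩) :: (post ++ R))) := by
  have hfx := h.fill_self
  have hfy := h.fill_post (c := y) (v := Sum.inr ⟨b, q⟩) (by simp)
  have hnext := h.isNextBox ⟨hfx, by
    rcases h.adj_iff.1 ha with h' | h'
    · exact Or.inr ⟨q, by rw [← h']; exact hfy⟩
    · exact Or.inl ⟨q, by rw [← h']; exact hfy⟩⟩
  have hV : fill (W ++ [(x, Sum.inr ⟨b, q⟩)] ++ (y, Sum.inl ⟨a, p⟩) :: (post ++ R)) =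
      Function.update (Function.update (fill (W ++ (x, Sum.inl ⟨a, p⟩) ::
        ((y, Sum.inr ⟨b, q⟩) :: post ++ R))) x (sndL b q)) y (fstL a p) := by
    rw [List.cons_append, update_fill₂ (by simpa using h.nodup)]; simp
  rw [hV]
  refine dstep_of_switch hnext ?_
  have hmem : ∀ c q', fill (W ++ (x, Sum.inl ⟨a, p⟩) :: ((y, Sum.inr ⟨b, q⟩) :: post ++ R)) c =
      sndL b q' → x.1 ≤ c.1 → x.2 ≤ c.2 → c ≠ y → (c, Sum.inr ⟨b, q'⟩) ∈ post := by
    intro c q' hc h1 h2 hne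
    have := h.mem_post hc h1 h2
    simpa [hne] using this
  have hs := (List.pairwise_cons.1 hsort).1
  have hxle := h.le
  have hyle : y.1 ≤ y.2 := h.le_of_mem (e := (y, Sum.inr ⟨b, q⟩)) (by simp)
  generalize hU : fill (W ++ (x, Sum.inl ⟨a, p⟩) :: ((y, Sum.inr ⟨b, q⟩) :: post ++ R)) = U at *
  obtain ⟨i, j⟩ := x
  rcases h.adj_iff.1 ha with rfl | rfl
  · by_cases hS : IsBBox b U (i + 1, j)
    · obtain ⟨q', hq'⟩ := hS
      have hm := hmem _ _ hq' (by simp) (by simp) (by simp [Prod.ext_iff])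
      -- The south neighbor comes later in the strip and lies on a smaller diagonal, which is
      -- impossible after an unprimed letter. So (S5) applies.
      have hq : q = true := by
        by_contra hq
        have := ((hs _ hm).1 (by simpa using hq)).2
        unfold dg at this; simp at this; omega
      subst hq
      exact Switch.s5 i j p q' hfx hfy hq'
    · exact Switch.s1 i j p q hfx hfy hS (fun h' => by simp_all) (fun h' => by simp_all)
  · have h1 : ¬ (i + 1 = j ∧ p = false ∧ IsABox a U (i, i)) := by
      rintro ⟨rfl, -, p', hp'⟩
      have hm := (fill_eq_some_iff h.nodup).1 (hU ▸ hp')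
      rw [List.mem_append] at hm
      rcases hm with hm | hm
      · exact (hy rfl).2 p' hm
      · rcases List.mem_cons.1 hm with hm | hm
        · simp [Prod.ext_iff] at hm
        · exact grows_labelled_not_le h.grows hm ⟨by simp, by simp⟩
    have h2 : ¬ (i + 1 = j ∧ p = true ∧ q = false) := by
      rintro ⟨rfl, hp, -⟩
      have := (hy rfl).1
      simp_all
    by_cases hE : IsBBox b U (i, j + 1)
    · obtain ⟨q', hq'⟩ := hE
      have hm := hmem _ _ hq' (by simp) (by simp) (by simp [Prod.ext_iff])
      -- The east neighbor comes later and lies on a larger diagonal than the south one, so it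
      -- cannot be primed in a sorted strip. So (S6) or (S2) is the relevant rule.
      have hq : q' = false := by
        by_contra hq0
        obtain rfl : q' = true := by simpa using hq0
        cases q
        · have := ((hs _ hm).1 rfl).1
          simp at this
        · have := (hs _ hm).2 rfl rfl
          unfold dg at this; simp at this; omega
      subst hq
      exact Switch.s6 i j p q hfx hq' hfy h1 h2
    · exact Switch.s2 i j p q hfx hfy hE h1 h2

/-- The moving box passes `b`-boxes with the same label. -/
theorem Moving.steps {x' : Box} {L L' : List Box} (hr : Row BoxMove x L L' x') (q : Bool) :
    ∀ {W : List (Box × Content)}, Moving a b N W x p (L.map (·, Sum.inr ⟨b, q⟩) ++ post) R →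
    StripSorted b (L.map (·, Sum.inr ⟨b, q⟩) ++ post) → (∀ y ∈ L, 0 < dg y) →
    (q = true → 0 < dg x ∨ ∀ y ∈ L, ¬ Adj x y) →
    Moving a b N (W ++ L'.map (·, Sum.inr ⟨b, q⟩)) x' p post R ∧
    Relation.ReflTransGen (DStep a b)
      (fill (W ++ (x, Sum.inl ⟨a, p⟩) :: (L.map (·, Sum.inr ⟨b, q⟩) ++ post ++ R)))
      (fill (W ++ L'.map (·, Sum.inr ⟨b, q⟩) ++ (x', Sum.inl ⟨a, p⟩) :: (post ++ R))) := by
  induction hr with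
  | nil x => intro W h _ _ _; simpa using ⟨h, Relation.ReflTransGen.refl⟩
  | @cons x y y' x₁ L L' x' m _ ih =>
    intro W h hsort hpos hq
    have hsort' := (List.pairwise_cons.1 hsort).2
    have hpos' : ∀ c ∈ L, 0 < dg c := fun c hc => hpos c (by simp [hc])
    have hy0 := hpos y (by simp)
    rcases m with ⟨ha, rfl, rfl⟩ | ⟨ha, rfl, rfl⟩
    · have hx0 : q = true → 0 < dg y' := by
        intro hq'
        rcases hq hq' with h' | h'
        · exact h'
        · exact absurd ha (h' _ (by simp))
      have hs := h.step hsort ha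
        -- Before a primed `b` is exchanged with `x`, `x` must be off the main diagonal; otherwise
        -- (S1') or (S3) would fit.
        (fun hx => by
          by_contra hq'
          have := hx0 (by simpa using hq')
          unfold dg at this; omega)
        (fun hy => by unfold dg at hy0; omega)
      have h1 := ih (h.advance ha) hsort' hpos' (fun _ => Or.inl hy0)
      refine ⟨by simpa using h1.1, ?_⟩
      refine Relation.ReflTransGen.head hs ?_
      simpa using h1.2
    · have hc : Moving a b N W x₁ p ((y', Sum.inr ⟨b, q⟩) ::
        (L.map (·, Sum.inr ⟨b, q⟩) ++ post)) R := h
      have hm := (hc.commute ha).1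
      have hf := (hc.commute ha).2
      have h1 := ih hm hsort' hpos' (fun hq' => (hq hq').imp id fun h' c hc => h' c (by simp [hc]))
      refine ⟨by simpa using h1.1, ?_⟩
      refine Eq.subst (motive := fun U => Relation.ReflTransGen (DStep a b) U _) hf.symm ?_
      have h2 := h1.2
      simp only [List.append_assoc] at h2 ⊢
      simpa using h2

end Moving


/-! ### Strips and the passage of a box through a strip -/

/-- The boxes of a single letter in a tableau, in the order of the standardization: the boxes of
the primed letter, followed by the boxes of the unprimed letter. -/
abbrev Strip := List Box × List Box

def Strip.boxes (B : Strip) : List Box := B.1 ++ B.2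

/-- The labelled boxes of a strip. -/
def Strip.lab {V : Type*} (f : Bool → V) (B : Strip) : List (Box × V) :=
  B.1.map (·, f true) ++ B.2.map (·, f false)

structure Strip.Valid (B : Strip) : Prop where
  desc : Desc B.1
  pos : ∀ c ∈ B.1, 0 < dg c
  asc : Asc B.2
  nonneg : ∀ c ∈ B.2, 0 ≤ dg c

@[simp] theorem Strip.map_fst_lab {V : Type*} (f : Bool → V) (B : Strip) :
    (B.lab f).map Prod.fst = B.boxes := by
  simp [Strip.lab, Strip.boxes, Function.comp_def]

/-- The box `x` passes through a strip: `keep` if no label changes, `enter` if `x` reaches the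
main diagonal and leaves its prime behind, `leave` if `x` leaves its place on the main diagonal
to a box that loses its prime. -/
inductive Pass : Box → Strip → Strip → Box → Prop
  | keep {x D D' x₁ E E' x'} : (0 < dg x ∨ ∀ y ∈ D, ¬ Adj x y) → Row BoxMove x D D' x₁ →
      Row BoxMove x₁ E E' x' → Pass x (D, E) (D', E') x'
  | enter {x D D' x₁ y E E' x'} : 0 < dg x → Row BoxMove x D D' x₁ → Adj x₁ y → dg y = 0 →
      Row BoxMove y E E' x' → Pass x (D, y :: E) (D' ++ [x₁], E') x'
  | leave {x D y E E' x'} : dg x = 0 → (∀ c ∈ D, ¬ Adj x c) → Adj x y →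
      Row BoxMove y E E' x' → Pass x (D ++ [y], E) (D, x :: E') x'

/-- Moving the border between the primed and the unprimed part does not affect the boxes: all three
kinds of passage are the same row of local moves. -/
theorem Pass.row {x x' : Box} {B B' : Strip} (h : Pass x B B' x') :
    Row BoxMove x B.boxes B'.boxes x' := by
  cases h with
  | keep _ h1 h2 => exact h1.append h2
  | enter _ h1 ha _ h2 =>
    have := h1.append (Row.cons (BoxMove.adj ha) h2)
    simpa [Strip.boxes] using this
  | leave _ h1 ha h2 =>
    have := (row_of_not_adj h1).append (Row.cons (BoxMove.adj ha) h2)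
    simpa [Strip.boxes] using this

/-- Several boxes pass through a strip, the last one first. -/
inductive Passes : List Box → Strip → Strip → List Box → Prop
  | nil (B) : Passes [] B B []
  | cons {x xs B B₁ B₂ xs' x'} : Passes xs B B₁ xs' → Pass x B₁ B₂ x' →
      Passes (x :: xs) B B₂ (x' :: xs')

theorem Passes.append {xs₁ xs₂ xs₁' xs₂' : List Box} {B B₁ B₂ : Strip}
    (h₂ : Passes xs₂ B B₁ xs₂') (h₁ : Passes xs₁ B₁ B₂ xs₁') :
    Passes (xs₁ ++ xs₂) B B₂ (xs₁' ++ xs₂') := by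
  induction h₁ with
  | nil => exact h₂
  | cons _ hp ih => exact Passes.cons (ih h₂) hp

theorem Passes.single {x x' : Box} {B B' : Strip} (h : Pass x B B' x') :
    Passes [x] B B' [x'] := Passes.cons (Passes.nil _) h

theorem Passes.grid {xs xs' : List Box} {B B' : Strip} (h : Passes xs B B' xs') :
    Grid BoxMove xs B.boxes B'.boxes xs' := by
  induction h with
  | nil => exact Grid.nil _
  | cons _ hp ih => exact Grid.cons ih hp.row

theorem Row.pos {x x' : Box} {L L' : List Box} (hr : Row BoxMove x L L' x') (hx : 0 < dg x)
    (hL : ∀ c ∈ L, 0 < dg c) : (∀ c ∈ L', 0 < dg c) ∧ 0 < dg x' := by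
  constructor
  · intro c hc
    rcases hr.mem_of_mem (Or.inl hc) with h | rfl
    · exact hL c h
    · exact hx
  · rcases hr.mem_of_mem (Or.inr rfl) with h | rfl
    · exact hL _ h
    · exact hx

theorem dg_nonneg {c : Box} (h : c.1 ≤ c.2) : 0 ≤ dg c := by unfold dg; omega

theorem dg_eq_zero {c : Box} : dg c = 0 ↔ c.1 = c.2 := by unfold dg; omega

theorem Row.unique_of_not_adj {x x' : Box} {L L' : List Box} (hr : Row BoxMove x L L' x')
    (h : ∀ y ∈ L, ¬ Adj x y) : L' = L ∧ x' = x :=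
  Row.unique BoxMove.unique hr (row_of_not_adj h)

theorem desc_append_singleton {L : List Box} {c : Box} :
    Desc (L ++ [c]) ↔ Desc L ∧ ∀ d ∈ L, dg c < dg d := by
  simp [Desc, List.pairwise_append]

theorem asc_append_singleton {L : List Box} {c : Box} :
    Asc (L ++ [c]) ↔ Asc L ∧ ∀ d ∈ L, dg d < dg c := by
  simp [Asc, List.pairwise_append]

theorem asc_cons {L : List Box} {c : Box} : Asc (c :: L) ↔ (∀ d ∈ L, dg c < dg d) ∧ Asc L := by
  simp [Asc]

/-- An ascending list that can be added after `c` and does not reach lower diagonals than `c`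
has only larger diagonals. -/
theorem Asc.cons_of_grows {N : Set Box} {c : Box} {L Q : List Box} (h : Asc L)
    (hN : Grows N (c :: L ++ Q)) (hc : ∀ d ∈ L, dg c ≤ dg d) : Asc (c :: L) := by
  cases L with
  | nil => simp [Asc]
  | cons d L =>
    exact asc_cons_cons.2 ⟨lt_of_le_of_ne (hc d (by simp)) hN.dg_ne, h⟩

theorem Desc.append_of_grows {N : Set Box} {c : Box} {L Q : List Box} (h : Desc L)
    (hN : Grows N (L ++ c :: Q)) (hc : ∀ d ∈ L, dg c ≤ dg d) : Desc (L ++ [c]) := by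
  rw [desc_append_singleton]
  refine ⟨h, ?_⟩
  rcases List.eq_nil_or_concat' L with rfl | ⟨L, e, rfl⟩
  · simp
  · rw [desc_append_singleton] at h
    have he : dg c < dg e := by
      refine lt_of_le_of_ne (hc e (by simp)) ?_
      rw [List.append_assoc, grows_append] at hN
      exact hN.2.dg_ne.symm
    intro d hd
    rcases List.mem_append.1 hd with hd | hd
    · exact he.trans (h.2 d hd)
    · simp only [List.mem_singleton] at hd; subst hd; exact he

/-- For `keep` this is the preservation of descents and ascents. For `enter` the new last primed box
`x₁` is on diagonal 1, the smallest one allowed there; for `leave` the new first unprimed box `x` is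
on diagonal 0. In both cases a weak inequality suffices, since consecutive boxes of a chain never
share a diagonal. -/
theorem Pass.valid {N : Set Box} {x x' : Box} {B B' : Strip} (h : Pass x B B' x')
    (hN : Grows N (x :: B.boxes)) (hB : B.Valid) : B'.Valid := by
  have hN' : Grows N (B'.boxes ++ [x']) := Grows.row (Q := []) h.row (by simpa using hN)
  have hx := hN.le (c := x) (by simp)
  cases h with
  | @keep D D' x₁ E E' _ h0 h1 h2 =>
    have hD : Grows N (x :: D) := by
      have : Grows N ((x :: D) ++ E) := hN
      exact (grows_append.1 this).1
    have hE : Grows (extend N D') (x₁ :: E) := by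
      have := Grows.row (Q := E) h1 hN
      exact (grows_append.1 this).2
    refine ⟨h1.desc hD hB.desc hB.pos, ?_, h2.asc hE hB.asc, ?_⟩
    · rcases h0 with h0 | h0
      · exact (h1.pos h0 hB.pos).1
      · rw [(h1.unique_of_not_adj h0).1]; exact hB.pos
    · intro c hc
      exact dg_nonneg (hN'.le (by simp [Strip.boxes, hc]))
  | @enter D D' x₁ y E E' _ h0 h1 ha hy h2 =>
    have hD : Grows N (x :: D) := by
      have : Grows N ((x :: D) ++ y :: E) := hN
      exact (grows_append.1 this).1
    have hp := h1.pos h0 hB.pos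
    have hE : Grows (extend N D') (x₁ :: y :: E) := by
      have := Grows.row (Q := y :: E) h1 hN
      exact (grows_append.1 this).2
    have hd := h1.desc hD hB.desc hB.pos
    have hx1 : dg x₁ = 1 := by unfold Adj at ha; omega
    refine ⟨?_, ?_, h2.asc hE.2.2 (asc_cons.1 hB.asc).2, ?_⟩
    · refine hd.append_of_grows (N := N) (Q := E' ++ [x'])
        (by simpa [Strip.boxes] using hN') fun d hd => ?_
      have := hp.1 d hd; omega
    · intro c hc
      rcases List.mem_append.1 hc with hc | hc
      · exact hp.1 c hc
      · simp only [List.mem_singleton] at hc; subst hc; omega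
    · intro c hc
      exact dg_nonneg (hN'.le (by simp [Strip.boxes, hc]))
  | @leave D y E E' _ h0 h1 ha h2 =>
    have hE : Grows (extend N D) (x :: y :: E) := by
      have := Grows.row (Q := y :: E) (row_of_not_adj h1) (by simpa [Strip.boxes] using hN)
      exact (grows_append.1 this).2
    refine ⟨(desc_append_singleton.1 hB.desc).1, fun c hc => hB.pos c (by simp [hc]), ?_, ?_⟩
    · have := h2.asc hE.2.2 hB.asc
      refine this.cons_of_grows (N := extend N D) (Q := [x']) ?_ fun d hd => ?_
      · rw [Strip.boxes, List.append_assoc, grows_append] at hN'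
        exact hN'.2
      · rw [h0]
        exact dg_nonneg (hN'.le (by simp [Strip.boxes, hd]))
    · intro c hc
      exact dg_nonneg (hN'.le (by simp [Strip.boxes] at hc ⊢; tauto))

/-- No box of an ascending list moves next to the main diagonal box `y` just added south of its
neighbor. -/
theorem not_adj_of_diag {N : Set Box} {x y : Box} {E Q : List Box}
    (h : Grows N (x :: y :: E ++ Q)) (hxy : y = (x.1 + 1, x.2)) (hy : dg y = 0) (hE : Asc E)
    (hpos : ∀ c ∈ E, 0 < dg c) : ∀ c ∈ E, ¬ Adj y c := by
  intro c hc ha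
  cases E with
  | nil => simp at hc
  | cons d E =>
    -- A box adjacent to `y` is on diagonal 1, and in an ascending list of positive diagonals only
    -- the first box can be.
    have hcd : c = d := by
      rcases List.mem_cons.1 hc with rfl | hc
      · rfl
      · have := (asc_cons.1 hE).1 c hc
        have := hpos d (by simp)
        unfold Adj at ha; omega
    subst hcd
    have hpc := hpos c (by simp)
    rcases (h.2.2.adj_iff).1 ha with rfl | rfl
    · subst hxy
      -- The east neighbor of `y` needs the east neighbor of `x` to be present already, but `x` has
      -- only just been added.
      have := Grows.mem_of_le (P := [x, (x.1 + 1, x.2)]) (Q := E ++ Q) (c := (x.1, x.2 + 1))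
        (by simpa using h) (by unfold dg at hy; simp at hy ⊢; omega) (by simp) (by simp)
        (by simp [Prod.ext_iff])
      rcases this with h' | h'
      · exact h.2.1 (h.1.2 _ h' x (h.le (by simp)) le_rfl (by simp))
      · simp [Prod.ext_iff] at h'
    · unfold dg at hpc hy; simp at hpc; omega

/-! ### The switches at the main diagonal -/

section Moving
variable {a b : ℕ} {N : Set Box} {W : List (Box × Content)} {x : Box} {p : Bool}
  {post R : List (Box × Content)}

/-- The labels of the letters of the first tableau. -/
abbrev labA (a : ℕ) (p : Bool) : Content := Sum.inl ⟨a, p⟩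

/-- The labels of the letters of the second tableau. -/
abbrev labB (b : ℕ) (q : Bool) : Content := Sum.inr ⟨b, q⟩

theorem stripSorted_lab {B : Strip} (h : B.Valid) (b : ℕ) : StripSorted b (B.lab (labB b)) := by
  unfold StripSorted Strip.lab
  rw [List.pairwise_append]
  refine ⟨?_, ?_, ?_⟩
  · rw [List.pairwise_map]
    exact h.desc.imp fun h => by simp [h]
  · rw [List.pairwise_map]
    exact h.asc.imp fun h => by simp [h]
  · intro e he f hf
    obtain ⟨c, -, rfl⟩ := List.mem_map.1 he
    obtain ⟨d, -, rfl⟩ := List.mem_map.1 hf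
    simp

theorem stripSorted_unprimed {E : List Box} (h : Asc E) (b : ℕ) :
    StripSorted b (E.map (·, labB b false)) := by
  have := stripSorted_lab (B := ([], E.filter fun c => 0 ≤ dg c))
    ⟨List.Pairwise.nil, by simp, h.filter _, by simp⟩ b
  unfold StripSorted
  rw [List.pairwise_map]
  exact h.imp fun h => by simp [h]

/-- Through the unprimed boxes away from the main diagonal. -/
theorem Moving.unprimed_steps {E : List Box}
    (h : Moving a b N W x p (E.map (·, labB b false)) R) (hE : Asc E)
    (hpos : ∀ c ∈ E, 0 < dg c) :
    ∃ E' x', Row BoxMove x E E' x' ∧ Relation.ReflTransGen (DStep a b)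
      (fill (W ++ (x, labA a p) :: (E.map (·, labB b false) ++ R)))
      (fill (W ++ E'.map (·, labB b false) ++ (x', labA a p) :: R)) := by
  obtain ⟨E', x', hr⟩ := exists_row x E
  have := Moving.steps (post := []) hr false (by simpa using h)
    (by simpa using stripSorted_unprimed hE b) hpos (by simp)
  exact ⟨E', x', hr, by simpa using this.2⟩

/-- Through the primed boxes, if the moving box is not next to them on the main diagonal. -/
theorem Moving.primed_steps {B : Strip} (h : Moving a b N W x p (B.lab (labB b)) R)
    (hB : B.Valid) (hx : 0 < dg x ∨ ∀ y ∈ B.1, ¬ Adj x y) :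
    ∃ D' x', Row BoxMove x B.1 D' x' ∧
      Moving a b N (W ++ D'.map (·, labB b true)) x' p (B.2.map (·, labB b false)) R ∧
      Relation.ReflTransGen (DStep a b)
      (fill (W ++ (x, labA a p) :: (B.lab (labB b) ++ R)))
      (fill (W ++ D'.map (·, labB b true) ++
        (x', labA a p) :: (B.2.map (·, labB b false) ++ R))) := by
  obtain ⟨D', x', hr⟩ := exists_row x B.1
  have := Moving.steps hr true h (stripSorted_lab hB b) hB.pos (fun _ => hx)
  exact ⟨D', x', hr, this⟩

theorem Moving.diag_neighbor {y : Box} {v : Content} (h : Moving a b N W x p ((y, v) :: post) R)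
    (ha : Adj x y) (hy : dg y = 0) : y = (x.1 + 1, x.2) ∧ x.1 + 1 = x.2 := by
  have hx := h.le
  rcases h.adj_iff.1 ha with rfl | rfl
  · unfold dg at hy; simp at hy; omega
  · refine ⟨rfl, ?_⟩
    unfold dg at hy; simp at hy; omega

/-- (S2') and (S6'). -/
theorem Moving.enter {y : Box} {E : List Box}
    (h : Moving a b N W x true ((y, labB b false) :: E.map (·, labB b false)) R)
    (ha : Adj x y) (hy : dg y = 0) :
    Moving a b N (W ++ [(x, labB b true)]) y false (E.map (·, labB b false)) R ∧
    DStep a b (fill (W ++ (x, labA a true) :: ((y, labB b false) :: E.map (·, labB b false) ++ R)))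
      (fill (W ++ [(x, labB b true)] ++ (y, labA a false) :: (E.map (·, labB b false) ++ R))) := by
  constructor
  · have h' := h.advance ha
    refine ⟨by simpa using h'.grows, fun c hc => ?_, fun c hc hp => by simp at hp, h'.post_snd,
      h'.rest⟩
    have := (h.unprimed c (by simpa using hc)).1
    simp at this
  obtain ⟨hyx, hx⟩ := h.diag_neighbor ha hy
  have hfx := h.fill_self
  have hfy := h.fill_post (c := y) (v := labB b false) (by simp)
  have hnext := h.isNextBox ⟨hfx, Or.inl ⟨false, by rw [← hyx]; exact hfy⟩⟩
  have hV : fill (W ++ [(x, labB b true)] ++ (y, labA a false) :: (E.map (·, labB b false) ++ R)) =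
      Function.update (Function.update (fill (W ++ (x, labA a true) ::
        ((y, labB b false) :: E.map (·, labB b false) ++ R))) x (sndL b true)) y
          (fstL a false) := by
    rw [List.cons_append, update_fill₂ (by simpa using h.nodup)]; simp
  rw [hV]
  refine dstep_of_switch hnext ?_
  have hmem : ∀ c q', fill (W ++ (x, labA a true) ::
      ((y, labB b false) :: E.map (·, labB b false) ++ R)) c =
      sndL b q' → x.1 ≤ c.1 → x.2 ≤ c.2 → q' = false := by
    intro c q' hc h1 h2
    have := h.mem_post hc h1 h2
    simp at this; tauto
  generalize hU : fill (W ++ (x, labA a true) ::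
    ((y, labB b false) :: E.map (·, labB b false) ++ R)) = U at *
  obtain ⟨i, j⟩ := x
  simp only at hx hyx
  subst hx hyx
  by_cases hE : IsBBox b U (i, i + 2)
  · obtain ⟨q', hq'⟩ := hE
    obtain rfl := hmem _ _ hq' (by simp) (by simp)
    exact Switch.s6' i hfx hq' hfy
  · exact Switch.s2' i hfx hfy hE

/-- (S1'). -/
theorem Moving.leave {y : Box} {E : List Box}
    (h : Moving a b N W x false ((y, labB b true) :: E.map (·, labB b false)) R)
    (hW : ∀ c, (c, labA a false) ∉ W)
    (ha : Adj x y) (hx : dg x = 0) (hE : ∀ c ∈ E, dg c ≠ 0) :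
    Moving a b N (W ++ [(x, labB b false)]) y true (E.map (·, labB b false)) R ∧
    DStep a b (fill (W ++ (x, labA a false) :: ((y, labB b true) :: E.map (·, labB b false) ++ R)))
      (fill (W ++ [(x, labB b false)] ++ (y, labA a true) :: (E.map (·, labB b false) ++ R))) := by
  have hy : y = (x.1, x.2 + 1) := by
    rcases h.adj_iff.1 ha with h' | rfl
    · exact h'
    · have := h.le_of_mem (e := ((x.1 + 1, x.2), labB b true)) (by simp)
      unfold dg at hx; simp at this; omega
  constructor
  · have h' := h.advance ha
    refine ⟨by simpa using h'.grows, fun c hc => ?_, fun c hc _ => ?_, h'.post_snd, h'.rest⟩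
    · exact absurd (by simpa using hc) (hW c)
    · have hc' : (c, labA a true) ∈ W := by simpa using hc
      have h1 := grows_labelled_not_le' h.grows hc'
      have h2 : c.1 ≤ c.2 := h.grows.le (by
        simp only [List.map_append, List.mem_append]
        exact Or.inl (List.mem_map.2 ⟨_, hc', rfl⟩))
      have h3 := h.le
      rw [hy]
      unfold dg at hx; simp only at h1 ⊢; omega
  have hfx := h.fill_self
  have hfy := h.fill_post (c := y) (v := labB b true) (by simp)
  have hnext := h.isNextBox ⟨hfx, Or.inr ⟨true, by rw [← hy]; exact hfy⟩⟩
  have hV : fill (W ++ [(x, labB b false)] ++ (y, labA a true) :: (E.map (·, labB b false) ++ R)) =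
      Function.update (Function.update (fill (W ++ (x, labA a false) ::
        ((y, labB b true) :: E.map (·, labB b false) ++ R))) x (sndL b false)) y
          (fstL a true) := by
    rw [List.cons_append, update_fill₂ (by simpa using h.nodup)]; simp
  rw [hV]
  refine dstep_of_switch hnext ?_
  have hmem : ∀ c q', fill (W ++ (x, labA a false) ::
      ((y, labB b true) :: E.map (·, labB b false) ++ R)) c =
      sndL b q' → x.1 ≤ c.1 → x.2 ≤ c.2 → c ≠ y → c ∈ E := by
    intro c q' hc h1 h2 hne
    have := h.mem_post hc h1 h2
    simp [hne] at this
    obtain ⟨_, _, h1, h2, -⟩ := this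
    exact h2 ▸ h1
  have hle : ∀ c q', fill (W ++ (x, labA a false) ::
      ((y, labB b true) :: E.map (·, labB b false) ++ R)) c = sndL b q' → c.1 ≤ c.2 := by
    intro c q' hc
    exact h.grows.le (List.mem_map.2 ⟨_, (fill_eq_some_iff h.nodup).1 hc, rfl⟩)
  generalize hU : fill (W ++ (x, labA a false) ::
    ((y, labB b true) :: E.map (·, labB b false) ++ R)) = U at *
  obtain ⟨i, j⟩ := x
  obtain rfl : i = j := by unfold dg at hx; simp at hx; omega
  subst hy
  refine Switch.s1' i hfx hfy ?_ ?_
  · rintro ⟨q', hq'⟩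
    have := hle _ _ hq'
    simp at this
  · rintro ⟨q', hq'⟩
    refine hE _ (hmem _ _ hq' (by simp) (by simp) (by simp [Prod.ext_iff])) ?_
    unfold dg; simp

/-- (S3). -/
theorem Moving.leave' {y z : Box} {E : List Box}
    (h : Moving a b N W x false
      ((y, labB b true) :: (z, labB b false) :: E.map (·, labB b false)) R)
    (ha : Adj x y) (hx : dg x = 0) (hz : dg z = 0) :
    Adj y z ∧ z = (y.1 + 1, y.2) ∧
    Moving a b N (W ++ [(x, labB b false), (y, labB b false)]) z false
      (E.map (·, labB b false)) R ∧
    DStep a b (fill (W ++ (x, labA a false) ::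
        ((y, labB b true) :: (z, labB b false) :: E.map (·, labB b false) ++ R)))
      (fill (W ++ [(x, labB b false), (y, labB b false)] ++
        (z, labA a false) :: (E.map (·, labB b false) ++ R))) := by
  have hy : y = (x.1, x.2 + 1) := by
    rcases h.adj_iff.1 ha with h' | rfl
    · exact h'
    · have := h.le_of_mem (e := ((x.1 + 1, x.2), labB b true)) (by simp)
      unfold dg at hx; simp at this; omega
  have hyz : Adj y z := by
    unfold Adj; rw [hz, hy]; unfold dg at hx ⊢; push_cast; omega
  have h1 := h.advance ha
  have hz' : z = (y.1 + 1, y.2) := (h1.diag_neighbor hyz hz).1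
  refine ⟨hyz, hz', ?_, ?_⟩
  · have h2 : Moving a b N (W ++ [(x, labB b true)] ++ [(y, labB b false)]) z false
        (E.map (·, labB b false)) R := h1.advance hyz
    refine ⟨by simpa using h2.grows, fun c hc => ?_, fun c hc hp => by simp at hp, h2.post_snd,
      h2.rest⟩
    exact h2.unprimed c (by simpa using hc)
  have hfx := h.fill_self
  have hfy := h.fill_post (c := y) (v := labB b true) (by simp)
  have hfz := h.fill_post (c := z) (v := labB b false) (by simp)
  have hnext := h.isNextBox ⟨hfx, Or.inr ⟨true, by rw [← hy]; exact hfy⟩⟩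
  have hV : fill (W ++ [(x, labB b false), (y, labB b false)] ++
        (z, labA a false) :: (E.map (·, labB b false) ++ R)) =
      Function.update (Function.update (Function.update (fill (W ++ (x, labA a false) ::
        ((y, labB b true) :: (z, labB b false) :: E.map (·, labB b false) ++ R))) x
          (sndL b false)) y (sndL b false)) z (fstL a false) := by
    rw [List.cons_append, List.cons_append, update_fill₃ (by simpa using h.nodup)]; simp
  rw [hV]
  refine dstep_of_switch hnext ?_
  have hle : ∀ c q', fill (W ++ (x, labA a false) ::
      ((y, labB b true) :: (z, labB b false) :: E.map (·, labB b false) ++ R)) c = sndL b q' →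
        c.1 ≤ c.2 := by
    intro c q' hc
    exact h.grows.le (List.mem_map.2 ⟨_, (fill_eq_some_iff h.nodup).1 hc, rfl⟩)
  generalize hU : fill (W ++ (x, labA a false) ::
    ((y, labB b true) :: (z, labB b false) :: E.map (·, labB b false) ++ R)) = U at *
  obtain ⟨i, j⟩ := x
  obtain rfl : i = j := by unfold dg at hx; simp at hx; omega
  subst hy
  subst hz'
  refine Switch.s3 i false false hfx hfy hfz ?_
  rintro ⟨q', hq'⟩
  have := hle _ _ hq'
  simp at this

/-- (S4) and (S7). -/
theorem Moving.double {u y : Box} {D E : List Box}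
    (h : Moving a b N (W ++ (u, labA a false) :: D.map (·, labB b true)) x false
      ((y, labB b false) :: E.map (·, labB b false)) R)
    (hW : ∀ c, (c, labA a false) ∉ W) (ha : Adj x y) (hy : dg y = 0) (hu : u = (x.1, x.1))
    (hE : ∀ c ∈ E, ¬ Adj y c) :
    (∀ c ∈ D, ¬ Adj u c) ∧ Adj u x ∧
    Moving a b N (W ++ D.map (·, labB b true) ++ [(u, labB b false)]) x true
      (E.map (·, labB b false)) ((y, labA a false) :: R) ∧
    DStep a b (fill (W ++ (u, labA a false) :: D.map (·, labB b true) ++ (x, labA a false) ::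
        ((y, labB b false) :: E.map (·, labB b false) ++ R)))
      (fill (W ++ D.map (·, labB b true) ++ [(u, labB b false)] ++
        (x, labA a true) :: (E.map (·, labB b false) ++ (y, labA a false) :: R))) := by
  obtain ⟨hyx, hx⟩ := h.diag_neighbor ha hy
  have hux : Adj u x := by unfold Adj dg; rw [hu]; simp; omega
  have hg := h.grows
  -- A box of `D` on diagonal 1 would come after `u` and before `x = (u.1, u.1 + 1)`; no such place
  -- exists.
  have hD : ∀ c ∈ D, ¬ Adj u c := by
    intro c hc hac
    simp only [List.map_append, List.map_cons, List.append_assoc, List.cons_append, List.map_map,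
      Function.comp_def, List.map_id'] at hg
    have hg' := (grows_append.1 hg).2
    obtain ⟨D₁, D₂, rfl⟩ := List.append_of_mem hc
    have hp := hg'.pairwise
    have h1 : ¬ (c.1 ≤ u.1 ∧ c.2 ≤ u.2) := (List.pairwise_cons.1 hp).1 c (by simp)
    have h2 : ¬ (x.1 ≤ c.1 ∧ x.2 ≤ c.2) := by
      have := (List.pairwise_cons.1 hp).2
      rw [List.append_assoc, List.pairwise_append] at this
      exact (List.pairwise_cons.1 this.2.1).1 x (by simp)
    have h3 : c.1 ≤ c.2 := hg'.le (by simp)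
    subst hu
    unfold Adj dg at hac
    simp only at hac h1
    omega
  -- The rule performs two passages at once: `x` moves to the place `y`, then `u` moves to the place
  -- of `x`. In the chain, `u` is first carried behind `D` and `y` behind `E`, which is possible as
  -- no box of `D` is next to `u` and none of `E` is next to `y`. What moves on from the place `x`,
  -- now with a prime, is the former `u`.
  have hcom : Grows N ((W ++ D.map (·, labB b true) ++ (u, labB b false) :: (x, labA a true) ::
      (E.map (·, labB b false) ++ (y, labA a false) :: R)).map Prod.fst) := by
    simp only [List.map_append, List.map_cons, List.append_assoc, List.cons_append, List.map_map,
      Function.comp_def, List.map_id'] at hg ⊢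
    rw [grows_append] at hg ⊢
    refine ⟨hg.1, ?_⟩
    have h1 := Grows.row (row_of_not_adj hD) hg.2
    rw [grows_append] at h1 ⊢
    refine ⟨h1.1, h1.2.1, h1.2.2.1, h1.2.2.2.1, h1.2.2.2.2.1, ?_⟩
    exact Grows.row (row_of_not_adj hE) h1.2.2.2.2.2
  refine ⟨hD, hux, ⟨by simpa using hcom, fun c hc => ?_, fun c hc _ => ?_, ?_, ?_⟩, ?_⟩
  · exact absurd (by simpa using hc) (hW c)
  · have hc' : (c, labA a true) ∈ W := by simpa using hc
    have hg1 : Grows N ((W ++ (u, labA a false) :: (D.map (·, labB b true) ++ (x, labA a false) ::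
      ((y, labB b false) :: E.map (·, labB b false) ++ R))).map Prod.fst) := by
      simpa using h.grows
    have h1 := grows_labelled_not_le' hg1 hc'
    have h2 : c.1 ≤ c.2 := h.grows.le (by
      simp only [List.map_append, List.mem_append]
      exact Or.inl (Or.inl (List.mem_map.2 ⟨_, hc', rfl⟩)))
    subst hu
    simp only at h1 ⊢; omega
  · intro e he
    obtain ⟨c, -, rfl⟩ := List.mem_map.1 he
    exact ⟨_, rfl⟩
  · intro e he q
    rcases List.mem_cons.1 he with rfl | he
    · simp
    · exact h.rest e he q
  have hfx := h.fill_self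
  have hfy := h.fill_post (c := y) (v := labB b false) (by simp)
  have hfu : fill (W ++ (u, labA a false) :: D.map (·, labB b true) ++ (x, labA a false) ::
        ((y, labB b false) :: E.map (·, labB b false) ++ R)) u = fstL a false :=
    (fill_eq_some_iff h.nodup).2 (by simp)
  have hnext := h.isNextBox ⟨hfx, Or.inl ⟨false, by rw [← hyx]; exact hfy⟩⟩
  have hV : fill (W ++ D.map (·, labB b true) ++ [(u, labB b false)] ++
        (x, labA a true) :: (E.map (·, labB b false) ++ (y, labA a false) :: R)) =
      Function.update (Function.update (Function.update (fill (W ++ (u, labA a false) ::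
        D.map (·, labB b true) ++ (x, labA a false) ::
        ((y, labB b false) :: E.map (·, labB b false) ++ R))) u
          (sndL b false)) x (fstL a true)) y (fstL a false) := by
    -- Bringing the three places involved next to each other leaves the filling unchanged.
    have hperm : (W ++ (u, labA a false) :: D.map (·, labB b true) ++ (x, labA a false) ::
        ((y, labB b false) :: E.map (·, labB b false) ++ R)).Perm
        ((W ++ D.map (·, labB b true)) ++ (u, labA a false) :: (x, labA a false) ::
        (y, labB b false) :: (E.map (·, labB b false) ++ R)) := by
      rw [List.append_assoc, List.append_assoc]
      refine List.Perm.append_left _ ?_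
      exact List.perm_middle.symm
    rw [fill_perm h.nodup hperm, update_fill₃
      ((hperm.map Prod.fst).nodup_iff.1 h.nodup)]
    refine fill_perm (by simpa using hcom.nodup) ?_
    rw [List.append_assoc _ [_]]
    refine List.Perm.append_left _ ?_
    refine List.Perm.cons _ (List.Perm.cons _ ?_)
    exact List.perm_middle
  rw [hV]
  refine dstep_of_switch hnext ?_
  have hmem : ∀ c q', fill (W ++ (u, labA a false) :: D.map (·, labB b true) ++
      (x, labA a false) :: ((y, labB b false) :: E.map (·, labB b false) ++ R)) c =
      sndL b q' → x.1 ≤ c.1 → x.2 ≤ c.2 → q' = false := by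
    intro c q' hc h1 h2
    have := h.mem_post hc h1 h2
    simp at this; tauto
  generalize hU : fill (W ++ (u, labA a false) :: D.map (·, labB b true) ++ (x, labA a false) ::
        ((y, labB b false) :: E.map (·, labB b false) ++ R)) = U at *
  obtain ⟨i, j⟩ := x
  simp only at hx hyx hu
  subst hx hyx hu
  by_cases hEE : IsBBox b U (i, i + 2)
  · obtain ⟨q', hq'⟩ := hEE
    obtain rfl := hmem _ _ hq' (by simp) (by simp)
    exact Switch.s7 i false false hfu hfx hq' hfy
  · exact Switch.s4 i false false hfu hfx hfy hEE

end Moving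

/-! ### The process on a pair of letters -/

theorem Row.le {x x' : Box} {L L' : List Box} (hr : Row BoxMove x L L' x') :
    ∀ {N : Set Box}, Grows N (x :: L) → x.1 ≤ x'.1 ∧ x.2 ≤ x'.2 := by
  induction hr with
  | nil => intro N _; exact ⟨le_rfl, le_rfl⟩
  | @cons x y y' x₁ L L' x' m _ ih =>
    intro N h
    have h' := ih (h.move m).2.2
    rcases m with ⟨ha, rfl, rfl⟩ | ⟨ha, rfl, rfl⟩
    · rcases h.adj_iff.1 ha with rfl | rfl
      · exact ⟨h'.1, le_trans (Nat.le_succ _) h'.2⟩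
      · exact ⟨le_trans (Nat.le_succ _) h'.1, h'.2⟩
    · exact h'

theorem Strip.Valid.le_one {B : Strip} (h : B.Valid) :
    B.boxes.Pairwise fun c c' => ¬ (dg c = 0 ∧ dg c' = 0) := by
  unfold Strip.boxes
  rw [List.pairwise_append]
  refine ⟨h.desc.imp fun h' => by omega, h.asc.imp fun h' => by omega, fun c hc d _ hcd => ?_⟩
  have := h.pos c hc
  omega

/-- The unprimed boxes of a strip lie away from the main diagonal, except possibly for the
first one. -/
theorem Strip.Valid.cases {B : Strip} (h : B.Valid) : (∀ c ∈ B.2, 0 < dg c) ∨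
    ∃ y E, B.2 = y :: E ∧ dg y = 0 ∧ ∀ c ∈ E, 0 < dg c := by
  rcases hB : B.2 with _ | ⟨y, E⟩
  · simp
  · have h1 := h.asc
    have h2 := h.nonneg
    rw [hB] at h1 h2
    rw [asc_cons] at h1
    have hy := h2 y (by simp)
    rcases hy.eq_or_lt with hy | hy
    · exact Or.inr ⟨y, E, rfl, hy.symm, fun c hc => by have := h1.1 c hc; omega⟩
    · refine Or.inl fun c hc => ?_
      rcases List.mem_cons.1 hc with rfl | hc
      · exact hy
      · exact hy.trans (h1.1 c hc)

section Moving
variable {a b : ℕ} {N : Set Box} {W : List (Box × Content)} {x : Box} {p : Bool}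
  {post R : List (Box × Content)}

theorem Moving.grows' (h : Moving a b N W x p post R) :
    Grows (extend N (W.map Prod.fst)) (x :: post.map Prod.fst ++ R.map Prod.fst) := by
  have := h.grows
  rw [List.map_append, grows_append] at this
  simpa using this.2

theorem Moving.grows_strip {B : Strip} (h : Moving a b N W x p (B.lab (labB b)) R) :
    Grows (extend N (W.map Prod.fst)) (x :: B.boxes) := by
  have := h.grows'
  rw [Strip.map_fst_lab] at this
  exact (grows_append.1 this).1

/-- A primed box passes through a strip. -/
theorem Moving.pass_primed {B : Strip} (h : Moving a b N W x true (B.lab (labB b)) R)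
    (hB : B.Valid) (hx : 0 < dg x) :
    ∃ B' x', Pass x B B' x' ∧
      B'.1.length + (if dg x' ≠ 0 then 1 else 0) = B.1.length + 1 ∧
      Relation.ReflTransGen (DStep a b)
        (fill (W ++ (x, labA a true) :: (B.lab (labB b) ++ R)))
        (fill (W ++ (B'.lab (labB b) ++ (x', labA a (decide (dg x' ≠ 0))) :: R))) := by
  obtain ⟨D', x₁, hr, hm, hs⟩ := h.primed_steps hB (Or.inl hx)
  have hx₁ := (hr.pos hx hB.pos).2
  have hlen := hr.length_eq
  rcases hB.cases with hE | ⟨y, E, hBE, hy, hE⟩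
  · obtain ⟨E', x', hr', hs'⟩ := hm.unprimed_steps hB.asc hE
    have hx' := (hr'.pos hx₁ hE).2
    refine ⟨(D', E'), x', Pass.keep (Or.inl hx) hr hr', ?_, hs.trans ?_⟩
    · rw [if_pos hx'.ne']; simp [hlen]
    · have : decide (dg x' ≠ 0) = true := by simpa using hx'.ne'
      rw [this]
      simpa [Strip.lab] using hs'
  · obtain ⟨D, E₀⟩ := B
    simp only at hBE hlen hr hm hs
    subst hBE
    have hasc : Asc E := (asc_cons.1 hB.asc).2
    by_cases ha : Adj x₁ y
    · obtain ⟨hm', hs'⟩ := hm.enter ha hy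
      obtain ⟨E', x', hr', hs''⟩ := hm'.unprimed_steps hasc hE
      have hg := hm.grows'
      -- Having reached the main diagonal, the box stays there: the remaining unprimed boxes are not
      -- next to it.
      have hnadj := not_adj_of_diag (Q := R.map Prod.fst) (by simpa [Function.comp_def] using hg)
        (hm.diag_neighbor ha hy).1 hy hasc hE
      have hx' := (hr'.unique_of_not_adj hnadj).2
      refine ⟨(D' ++ [x₁], E'), x', Pass.enter hx hr ha hy hr', ?_, hs.trans ?_⟩
      · rw [hx']; simp [hy, hlen]
      · have : decide (dg x' ≠ 0) = false := by rw [hx']; simp [hy]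
        rw [this]
        refine Relation.ReflTransGen.head (by simpa using hs') ?_
        simpa [Strip.lab] using hs''
    · obtain ⟨hm', hf⟩ := Moving.commute (q := false) hm ha
      obtain ⟨E', x', hr', hs'⟩ := hm'.unprimed_steps hasc hE
      have hx' := (hr'.pos hx₁ hE).2
      refine ⟨(D', y :: E'), x', Pass.keep (Or.inl hx) hr (Row.cons (BoxMove.comm ha) hr'), ?_,
        hs.trans ?_⟩
      · rw [if_pos hx'.ne']; simp [hlen]
      · have : decide (dg x' ≠ 0) = true := by simpa using hx'.ne'
        rw [this]
        refine Eq.subst (motive := fun U => Relation.ReflTransGen (DStep a b) U _) hf.symm ?_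
        simpa [Strip.lab] using hs'

/-- An unprimed box on the main diagonal passes through a strip. -/
theorem Moving.pass_diag {B : Strip} (h : Moving a b N W x false (B.lab (labB b)) R)
    (hW : ∀ c, (c, labA a false) ∉ W) (hB : B.Valid) (hx : dg x = 0) :
    ∃ B' x' p', Pass x B B' x' ∧
      ((p' = false ∧ B'.1.length = B.1.length ∧ ∀ c ∈ B.boxes, dg c ≠ 0) ∨
        (p' = false ∧ dg x' = 0 ∧ ∃ c ∈ B.boxes, dg c = 0) ∨
        (p' = true ∧ 0 < dg x' ∧ B'.1.length + 1 = B.1.length)) ∧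
      Relation.ReflTransGen (DStep a b)
        (fill (W ++ (x, labA a false) :: (B.lab (labB b) ++ R)))
        (fill (W ++ (B'.lab (labB b) ++ (x', labA a p') :: R))) := by
  by_cases hD : ∀ y ∈ B.1, ¬ Adj x y
  · obtain ⟨D', x₁, hr, hm, hs⟩ := h.primed_steps hB (Or.inr hD)
    -- A `b`-box on the main diagonal after `x` would need the east neighbor of `x` to be present,
    -- and that box would be a primed `b` next to `x`.
    have hE : ∀ c ∈ B.2, 0 < dg c := by
      rcases hB.cases with hE | ⟨y, E, hBE, hy, hE⟩
      · exact hE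
      · exfalso
        have hg := h.grows_strip
        have hxle := hg.le (c := x) (by simp)
        have hyle := hg.le (c := y) (by simp [Strip.boxes, hBE])
        have hp := (List.pairwise_cons.1 hg.pairwise).1 y (by simp [Strip.boxes, hBE])
        have := Grows.mem_of_le (N := extend N (W.map Prod.fst)) (P := x :: B.1) (Q := E)
          (c := (x.1, x.2 + 1)) (c' := y) (by simpa [Strip.boxes, hBE] using hg)
          (by simp; omega) (by unfold dg at hx hy; simp; omega)
          (by unfold dg at hx hy; simp; omega)
          (by rintro rfl; unfold dg at hx hy; simp at hy; omega)
        rcases this with h' | h'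
        · exact hg.2.1 (hg.1.2 _ h' x hxle le_rfl (by simp))
        · rcases List.mem_cons.1 h' with h' | h'
          · simp [Prod.ext_iff] at h'
          · refine hD _ h' ?_
            unfold Adj dg; push_cast; omega
    obtain ⟨E', x', hr', hs'⟩ := hm.unprimed_steps hB.asc hE
    refine ⟨(D', E'), x', false, Pass.keep (Or.inr hD) hr hr',
      Or.inl ⟨rfl, hr.length_eq, fun c hc => ?_⟩, hs.trans ?_⟩
    · rcases List.mem_append.1 hc with hc | hc
      · exact (hB.pos c hc).ne'
      · exact (hE c hc).ne'
    · simpa [Strip.lab] using hs'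
  · push Not at hD
    obtain ⟨y, hyD, hay⟩ := hD
    obtain ⟨D, E⟩ := B
    simp only at hyD
    obtain ⟨D₀, D₁, rfl⟩ := List.append_of_mem hyD
    have hdesc := hB.desc
    have hy : dg y = 1 := by
      have := hB.pos y (by simp)
      unfold Adj at hay; omega
    simp only [Desc, List.pairwise_append, List.pairwise_cons] at hdesc
    -- The primed box next to `x` is on diagonal 1, so it is the last primed one.
    have hD₁ : D₁ = [] := by
      cases D₁ with
      | nil => rfl
      | cons d D₁ =>
        have := hdesc.2.1.1 d (by simp)
        have := hB.pos d (by simp)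
        omega
    subst hD₁
    have hD₀ : ∀ c ∈ D₀, ¬ Adj x c := by
      intro c hc ha
      have := hdesc.2.2 c hc y (by simp)
      unfold Adj at ha; omega
    have hpos₀ : ∀ c ∈ D₀, 0 < dg c := fun c hc => hB.pos c (by simp [hc])
    have h1 := Moving.steps (post := (y, labB b true) :: E.map (·, labB b false))
      (row_of_not_adj hD₀) true (by simpa [Strip.lab] using h)
      (by simpa [Strip.lab] using stripSorted_lab hB b) hpos₀ (fun _ => Or.inr hD₀)
    have hW' : ∀ c, (c, labA a false) ∉ W ++ D₀.map (·, labB b true) := by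
      intro c hc
      rcases List.mem_append.1 hc with hc | hc
      · exact hW c hc
      · simp at hc
    rcases hB.cases with hE | ⟨z, E, hBE, hz, hE⟩
    · simp only at hE
      obtain ⟨hm, hs⟩ := h1.1.leave hW' hay hx (fun c hc => (hE c hc).ne')
      obtain ⟨E', x', hr', hs'⟩ := hm.unprimed_steps hB.asc hE
      refine ⟨(D₀, x :: E'), x', true, Pass.leave hx hD₀ hay hr',
        Or.inr (Or.inr ⟨rfl, (hr'.pos (by omega) hE).2, by simp⟩), ?_⟩
      refine Relation.ReflTransGen.trans (by simpa [Strip.lab] using h1.2) ?_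
      refine Relation.ReflTransGen.head (by simpa using hs) ?_
      simpa [Strip.lab] using hs'
    · simp only at hBE
      subst hBE
      have hasc : Asc E := (asc_cons.1 hB.asc).2
      obtain ⟨hyz, hzy, hm, hs⟩ := Moving.leave' h1.1 hay hx hz
      obtain ⟨E', x', hr', hs'⟩ := hm.unprimed_steps hasc hE
      have hg := h1.1.grows'.2.2
      have hnadj := not_adj_of_diag (Q := R.map Prod.fst) (by simpa [Function.comp_def] using hg)
        hzy hz hasc hE
      have hx' := hr'.unique_of_not_adj hnadj
      refine ⟨(D₀, x :: y :: E'), x', false,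
        Pass.leave hx hD₀ hay (Row.cons (BoxMove.adj hyz) hr'),
        Or.inr (Or.inl ⟨rfl, by rw [hx'.2]; exact hz, z, by simp [Strip.boxes], hz⟩), ?_⟩
      refine Relation.ReflTransGen.trans (by simpa [Strip.lab] using h1.2) ?_
      refine Relation.ReflTransGen.head (by simpa using hs) ?_
      simpa [Strip.lab] using hs'

/-- An unprimed box away from the main diagonal passes through a strip. -/
theorem Moving.pass_unprimed {P : List (Box × Content)} {uo A : List Box} {B : Strip}
    (h : Moving a b N (P ++ ((uo ++ A).map (·, labA a false))) x false (B.lab (labB b)) R)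
    (hP : ∀ c p', (c, labA a p') ∈ P → p' = true ∧ 0 < dg c) (hB : B.Valid) (hx : 0 < dg x) (hA : Asc (A ++ [x]))
    (hA0 : ∀ c ∈ A, 0 < dg c)
    (huo : uo = [] ∨ ∃ u, uo = [u] ∧ dg u = 0) :
    (∃ B' x', Pass x B B' x' ∧ B'.1.length = B.1.length ∧ (uo ≠ [] → dg x' ≠ 0) ∧
      Relation.ReflTransGen (DStep a b)
        (fill (P ++ ((uo ++ A).map (·, labA a false)) ++
          (x, labA a false) :: (B.lab (labB b) ++ R)))
        (fill (P ++ ((uo ++ A).map (·, labA a false)) ++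
          (B'.lab (labB b) ++ (x', labA a false) :: R)))) ∨
    ∃ u u' x' B', uo = [u] ∧ A = [] ∧ Passes [u, x] B B' [u', x'] ∧ 0 < dg u' ∧
      B'.1.length = B.1.length ∧ (∃ c ∈ B.boxes, dg c = 0) ∧
      Relation.ReflTransGen (DStep a b)
        (fill (P ++ ((uo ++ A).map (·, labA a false)) ++
          (x, labA a false) :: (B.lab (labB b) ++ R)))
        (fill (P ++ (B'.lab (labB b) ++ (u', labA a true) :: (x', labA a false) :: R))) := by
  obtain ⟨D', x₁, hr, hm, hs⟩ := h.primed_steps hB (Or.inl hx)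
  have hx₁ := (hr.pos hx hB.pos).2
  have hD' := (hr.pos hx hB.pos).1
  have hlen := hr.length_eq
  rcases hB.cases with hE | ⟨y, E, hBE, hy, hE⟩
  · obtain ⟨E', x', hr', hs'⟩ := hm.unprimed_steps hB.asc hE
    refine Or.inl ⟨(D', E'), x', Pass.keep (Or.inl hx) hr hr', hlen,
      fun _ => (hr'.pos hx₁ hE).2.ne', hs.trans ?_⟩
    simpa [Strip.lab] using hs'
  · obtain ⟨D, E₀⟩ := B
    simp only at hBE hlen hr hm hs
    subst hBE
    have hasc : Asc E := (asc_cons.1 hB.asc).2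
    by_cases ha : Adj x₁ y
    swap
    · obtain ⟨hm', hf⟩ := Moving.commute (q := false) hm ha
      obtain ⟨E', x', hr', hs'⟩ := hm'.unprimed_steps hasc hE
      refine Or.inl ⟨(D', y :: E'), x', Pass.keep (Or.inl hx) hr (Row.cons (BoxMove.comm ha) hr'),
        hlen, fun _ => (hr'.pos hx₁ hE).2.ne', hs.trans ?_⟩
      refine Eq.subst (motive := fun U => Relation.ReflTransGen (DStep a b) U _) hf.symm ?_
      simpa [Strip.lab] using hs'
    · obtain ⟨hyx, hx₁d⟩ := hm.diag_neighbor ha hy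
      have hg := hm.grows'
      have hnadj := not_adj_of_diag (Q := R.map Prod.fst) (by simpa [Function.comp_def] using hg)
        hyx hy hasc hE
      rcases huo with rfl | ⟨u, rfl, hu⟩
      -- Without an unprimed `a` on the main diagonal the box northwest of `y` is no `a`-box, so the
      -- ordinary exchange takes place.
      · have hno : ∀ p', ((x₁.1, x₁.1), labA a p') ∉
            P ++ (([] ++ A).map (·, labA a false)) ++ D'.map (·, labB b true) := by
          intro p' hc
          simp only [List.mem_append, List.mem_map, List.nil_append] at hc
          rcases hc with (hc | ⟨c, hc, hc'⟩) | ⟨c, _, hc'⟩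
          · simpa [dg] using (hP _ _ hc).2
          · simp only [Prod.mk.injEq] at hc'
            have := hA0 c hc
            rw [hc'.1] at this
            simp [dg] at this
          · simp at hc'
        have hs1 := Moving.step (y := y) (q := false) hm
          (by simpa using stripSorted_unprimed hB.asc b) ha (fun _ => rfl)
          (fun _ => ⟨rfl, hno⟩)
        have hm' := Moving.advance (q := false) hm ha
        obtain ⟨E', x', hr', hs'⟩ := hm'.unprimed_steps hasc hE
        refine Or.inl ⟨(D', x₁ :: E'), x',
          Pass.keep (Or.inl hx) hr (Row.cons (BoxMove.adj ha) hr'), hlen, by simp, hs.trans ?_⟩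
        refine Relation.ReflTransGen.head hs1 ?_
        simpa [Strip.lab] using hs'
      · right
        have hgm := hm.grows
        have hgm2 : Grows (extend N (P.map Prod.fst))
            (u :: (A ++ D' ++ x₁ :: (y :: E ++ R.map Prod.fst))) := by
          simp only [List.map_append, List.append_assoc] at hgm
          have := (grows_append.1 hgm).2
          simpa [Function.comp_def] using this
        have hule := hgm2.le (c := u) (by simp)
        have hpw := (List.pairwise_cons.1 hgm2.pairwise).1
        -- The box `(x₁.1, x₁.1)` is present before `x₁ = (r, r + 1)`. It is not in the ideal below
        -- `u`, because `u` is not southeast of `y`, and it is not in `A` or `D'`, which avoid the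
        -- main diagonal. So it is `u`.
        have hux : u = (x₁.1, x₁.1) := by
          have hyu := hpw y (by simp)
          by_contra hne
          have := Grows.mem_of_le (N := extend N (P.map Prod.fst)) (P := u :: (A ++ D'))
            (Q := y :: E ++ R.map Prod.fst)
            (c := (x₁.1, x₁.1)) (c' := x₁) (by simpa using hgm2) le_rfl le_rfl (by simp; omega)
            (by rw [ne_eq, Prod.ext_iff]; simp; omega)
          rcases this with h' | h'
          · refine hgm2.2.1 (hgm2.1.2 _ h' u hule ?_ ?_) <;>
              (subst hyx; unfold dg at hu; simp at hyu ⊢; omega)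
          · rcases List.mem_cons.1 h' with h' | h'
            · exact hne h'.symm
            · have : 0 < dg ((x₁.1, x₁.1) : Box) := by
                rcases List.mem_append.1 h' with h' | h'
                · exact hA0 _ h'
                · exact hD' _ h'
              simp [dg] at this
        -- A box of `A` has a smaller diagonal than `x`, is not weakly northwest of `u`, and is not
        -- weakly southeast of `x` or of `x₁`. With `u` and `x₁` side by side there is no room for
        -- it.
        have hA' : A = [] := by
          by_contra hne
          obtain ⟨c, hc⟩ := List.exists_mem_of_ne_nil A hne
          have h1 := (asc_append_singleton.1 hA).2 c hc
          have h2 := hpw c (by simp [hc])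
          have h3 : ¬ (x₁.1 ≤ c.1 ∧ x₁.2 ≤ c.2) := by
            have := (List.pairwise_cons.1 hgm2.pairwise).2
            exact pairwise_of_mem_append this (u := c) (by simp [hc]) (by simp)
          have hcle := hgm2.le (c := c) (by simp [hc])
          have h4 := hr.le ((grows_append (L := x :: D) (L' := y :: E)).1 h.grows_strip).1
          have h5 : ¬ (x.1 ≤ c.1 ∧ x.2 ≤ c.2) :=
            grows_labelled_not_le' h.grows (e' := (c, labA a false)) (by simp [hc])
          subst hux
          unfold dg at h1
          simp only at h2
          omega
        subst hA'
        obtain ⟨hD, hux', hm', hs'⟩ := Moving.double (W := P) (u := u) (D := D') (x := x₁)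
          (y := y) (E := E) (by simpa using hm)
          (fun c hc => by simpa using (hP c _ hc).1) ha hy hux hnadj
        obtain ⟨E', u', hr', hs''⟩ := hm'.unprimed_steps hasc hE
        refine ⟨u, u', y, (D', u :: E'), rfl, rfl, ?_, (hr'.pos hx₁ hE).2, hlen,
          ⟨y, by simp [Strip.boxes], hy⟩, hs.trans ?_⟩
        -- The double switch is recorded as two ordinary passages, of `x` and then of `u`, neither
        -- of which moves the border of the strip.
        · refine Passes.cons (Passes.single (B' := (D', x₁ :: E)) (Pass.keep (Or.inl hx) hr
            (Row.cons (BoxMove.adj ha) (row_of_not_adj hnadj)))) ?_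
          exact Pass.keep (Or.inr hD) (row_of_not_adj hD) (Row.cons (BoxMove.adj hux') hr')
        · refine Relation.ReflTransGen.head (by simpa using hs') ?_
          simpa [Strip.lab] using hs''

end Moving

/-! ### The process on two strips -/

theorem Passes.grows {N : Set Box} {P Q xs xs' : List Box} {B B' : Strip}
    (h : Passes xs B B' xs') (hN : Grows N (P ++ (xs ++ (B.boxes ++ Q)))) :
    Grows N (P ++ (B'.boxes ++ (xs' ++ Q))) := by
  rw [grows_append] at hN ⊢
  exact ⟨hN.1, Grows.grid h.grid hN.2⟩

theorem Passes.valid {xs xs' : List Box} {B B' : Strip} (h : Passes xs B B' xs') :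
    ∀ {N : Set Box} {P Q : List Box}, Grows N (P ++ (xs ++ (B.boxes ++ Q))) → B.Valid →
      B'.Valid := by
  induction h with
  | nil => intro N P Q _ hB; exact hB
  | @cons x xs B B₁ B₂ xs' x' h hp ih =>
    intro N P Q hN hB
    have hN' : Grows N ((P ++ [x]) ++ (xs ++ (B.boxes ++ Q))) := by simpa using hN
    have h1 := h.grows hN'
    refine hp.valid (N := extend N P) ?_ (ih hN' hB)
    have h2 : Grows N (P ++ ((x :: B₁.boxes) ++ (xs' ++ Q))) := by simpa using h1
    exact (grows_append.1 (grows_append.1 h2).2).1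

section Moving
variable {a b : ℕ} {N : Set Box}

/-- The last box of a descending list is the southernmost, hence the first to move. Each passage
preserves the total number of primes: a moving box loses its prime exactly when it stops on the main
diagonal, and then the strip has gained one. The `countP` is the number of primes kept by the moving
boxes. -/
theorem run_primed {P : List (Box × Content)} {AD : List Box}
    (hP : ∀ c p, (c, labA a p) ∉ P) (hAD : Desc AD) (hpos : ∀ c ∈ AD, 0 < dg c) :
    ∀ {B : Strip} {R : List (Box × Content)},
    Grows N ((P ++ (AD.map (·, labA a true) ++ (B.lab (labB b) ++ R))).map Prod.fst) →
    (∀ e ∈ R, ∀ q, e.2 ≠ labB b q) → B.Valid →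
    ∃ B' xs', Passes AD B B' xs' ∧
      B'.1.length + xs'.countP (fun c => decide (dg c ≠ 0)) = B.1.length + AD.length ∧
      Relation.ReflTransGen (DStep a b)
        (fill (P ++ (AD.map (·, labA a true) ++ (B.lab (labB b) ++ R))))
        (fill (P ++ (B'.lab (labB b) ++
          (xs'.map (fun c => (c, labA a (decide (dg c ≠ 0)))) ++ R)))) := by
  induction AD using List.reverseRecOn with
  | nil =>
    intro B R _ _ _
    exact ⟨B, [], Passes.nil B, by simp, by simpa using Relation.ReflTransGen.refl⟩
  | append_singleton AD x ih =>
    intro B R h hR hB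
    have hm : Moving a b N (P ++ AD.map (·, labA a true)) x true (B.lab (labB b)) R := by
      have hg : Grows N ((P ++ AD.map (·, labA a true) ++
          (x, labA a true) :: (B.lab (labB b) ++ R)).map Prod.fst) := by simpa using h
      refine ⟨hg, fun c hc => ?_, fun c hc _ => ?_, fun e he => ?_, hR⟩
      · rcases List.mem_append.1 hc with hc | hc
        · exact absurd hc (hP c _)
        · simp at hc
      · rcases List.mem_append.1 hc with hc' | hc'
        · exact absurd hc' (hP c _)
        · have h1 := grows_labelled_not_le' hg hc
          have hc'' : c ∈ AD := by simpa using hc'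
          have h2 := (desc_append_singleton.1 hAD).2 c hc''
          unfold dg at h2
          simp only at h1
          omega
      · unfold Strip.lab at he
        rcases List.mem_append.1 he with he | he <;> obtain ⟨c, -, rfl⟩ := List.mem_map.1 he <;>
          exact ⟨_, rfl⟩
    obtain ⟨B₁, x', hp, hlen, hs⟩ := hm.pass_primed hB (hpos x (by simp))
    have hsing : Passes [x] B B₁ [x'] := Passes.single hp
    have hg : Grows N ((P.map Prod.fst ++ AD) ++ ([x] ++ (B.boxes ++ R.map Prod.fst))) := by
      simpa [Function.comp_def] using h
    obtain ⟨B', xs', hp', hlen', hs'⟩ := ih (desc_append_singleton.1 hAD).1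
      (fun c hc => hpos c (by simp [hc])) (B := B₁)
      (R := (x', labA a (decide (dg x' ≠ 0))) :: R)
      (by simpa [Function.comp_def] using hsing.grows hg)
      (fun e he q => by
        rcases List.mem_cons.1 he with rfl | he
        · simp
        · exact hR e he q) (hsing.valid hg hB)
    refine ⟨B', xs' ++ [x'], Passes.append hsing hp', ?_, ?_⟩
    · rw [List.countP_append, List.countP_singleton]
      simp only [decide_eq_true_eq, List.length_append, List.length_singleton] at hlen ⊢
      omega
    · refine Relation.ReflTransGen.trans (by simpa using hs) ?_
      simpa using hs'

/-- The list `uo` holds the unprimed `a`-box on the main diagonal, if there is one; it waits until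
`A` has passed. In the second alternative (S4) or (S7) drags it along: it continues as the primed
box `u'`, and both strips have a box on the main diagonal. -/
theorem run_unprimed {P : List (Box × Content)} {uo A : List Box}
    (hP : ∀ c p, (c, labA a p) ∈ P → p = true ∧ 0 < dg c)
    (hA : Asc (uo ++ A)) (hpos : ∀ c ∈ A, 0 < dg c) (huo : uo = [] ∨ ∃ u, uo = [u] ∧ dg u = 0) :
    ∀ {B : Strip} {R : List (Box × Content)},
    Grows N ((P ++ ((uo ++ A).map (·, labA a false) ++ (B.lab (labB b) ++ R))).map Prod.fst) →
    (∀ e ∈ R, ∀ q, e.2 ≠ labB b q) → B.Valid →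
    (∃ B' xs', Passes A B B' xs' ∧ B'.1.length = B.1.length ∧ (uo ≠ [] → ∀ c ∈ xs', dg c ≠ 0) ∧
      Relation.ReflTransGen (DStep a b)
        (fill (P ++ ((uo ++ A).map (·, labA a false) ++ (B.lab (labB b) ++ R))))
        (fill (P ++ (uo.map (·, labA a false) ++ (B'.lab (labB b) ++
          (xs'.map (·, labA a false) ++ R)))))) ∨
    ∃ u u' xs' B', uo = [u] ∧ Passes (u :: A) B B' (u' :: xs') ∧ 0 < dg u' ∧
      B'.1.length = B.1.length ∧ (∃ c ∈ B.boxes, dg c = 0) ∧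
      Relation.ReflTransGen (DStep a b)
        (fill (P ++ ((uo ++ A).map (·, labA a false) ++ (B.lab (labB b) ++ R))))
        (fill (P ++ (B'.lab (labB b) ++ ((u', labA a true) ::
          (xs'.map (·, labA a false) ++ R))))) := by
  induction A using List.reverseRecOn with
  | nil =>
    intro B R _ _ _
    exact Or.inl ⟨B, [], Passes.nil B, rfl, by simp, by simpa using Relation.ReflTransGen.refl⟩
  | append_singleton A x ih =>
    intro B R h hR hB
    have hasc : Asc (A ++ [x]) := (List.pairwise_append.1 hA).2.1
    have hasc' : Asc (uo ++ A ++ [x]) := by simpa using hA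
    have hm : Moving a b N (P ++ (uo ++ A).map (·, labA a false)) x false (B.lab (labB b)) R := by
      have hg : Grows N ((P ++ (uo ++ A).map (·, labA a false) ++
          (x, labA a false) :: (B.lab (labB b) ++ R)).map Prod.fst) := by simpa using h
      refine ⟨hg, fun c hc => ⟨rfl, ?_⟩, fun c _ hc => by simp at hc, fun e he => ?_, hR⟩
      · rcases List.mem_append.1 hc with hc' | hc'
        · exact absurd (hP c _ hc').1 (by simp)
        · have h1 := grows_labelled_not_le' hg hc
          have hc'' : c ∈ uo ++ A := by
            obtain ⟨d, hd, hd'⟩ := List.mem_map.1 hc'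
            simp only [Prod.mk.injEq, and_true] at hd'
            exact hd' ▸ hd
          have h2 := (asc_append_singleton.1 hasc').2 c hc''
          unfold dg at h2
          simp only at h1
          omega
      · unfold Strip.lab at he
        rcases List.mem_append.1 he with he | he <;> obtain ⟨c, -, rfl⟩ := List.mem_map.1 he <;>
          exact ⟨_, rfl⟩
    have hg : Grows N ((P.map Prod.fst ++ (uo ++ A)) ++ ([x] ++ (B.boxes ++ R.map Prod.fst))) := by
      simpa [Function.comp_def] using h
    rcases hm.pass_unprimed hP hB (hpos x (by simp)) hasc (fun c hc => hpos c (by simp [hc])) huo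
      with ⟨B₁, x', hp, hlen, hx', hs⟩ | ⟨u, u', x', B', rfl, rfl, hp, hu', hlen, hz, hs⟩
    · have hsing : Passes [x] B B₁ [x'] := Passes.single hp
      have hs0 : Relation.ReflTransGen (DStep a b)
          (fill (P ++ ((uo ++ (A ++ [x])).map (·, labA a false) ++ (B.lab (labB b) ++ R))))
          (fill (P ++ ((uo ++ A).map (·, labA a false) ++ (B₁.lab (labB b) ++
            ((x', labA a false) :: R))))) := by
        simpa using hs
      rcases ih (asc_append_singleton.1 hasc').1 (fun c hc => hpos c (by simp [hc]))
        (B := B₁) (R := (x', labA a false) :: R)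
        (by simpa [Function.comp_def] using hsing.grows hg)
        (fun e he q => by
          rcases List.mem_cons.1 he with rfl | he
          · simp
          · exact hR e he q) (hsing.valid hg hB) with
        ⟨B', xs', hp', hlen', hxs', hs'⟩ | ⟨u, u', xs', B', rfl, hp', hu', hlen', hz, hs'⟩
      · refine Or.inl ⟨B', xs' ++ [x'], Passes.append hsing hp', by omega, fun hu c hc => ?_, ?_⟩
        · rcases List.mem_append.1 hc with hc | hc
          · exact hxs' hu c hc
          · simp only [List.mem_singleton] at hc; subst hc; exact hx' hu
        · refine hs0.trans ?_
          simpa using hs'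
      · refine Or.inr ⟨u, u', xs' ++ [x'], B', rfl,
          by simpa using Passes.append hsing hp', hu', by omega, ?_, ?_⟩
        · obtain ⟨c, hc, hc0⟩ := hz
          rcases hp.row.mem_of_mem (Or.inl hc) with hc | rfl
          · exact ⟨c, hc, hc0⟩
          · exact absurd hc0 (hpos c (by simp)).ne'
        · refine hs0.trans ?_
          simpa using hs'
    · refine Or.inr ⟨u, u', [x'], B', rfl, by simpa using hp, hu', hlen, hz, ?_⟩
      simpa using hs

end Moving

/-! ### Boxes on the main diagonal and the relation between two strips and their exchange. -/

/-- The number of boxes on the main diagonal. -/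
def Strip.touch (B : Strip) : ℕ := B.boxes.countP fun c => decide (dg c = 0)

theorem Strip.Valid.touch_le_one {B : Strip} (h : B.Valid) : B.touch ≤ 1 := by
  have := h.le_one
  unfold Strip.touch
  generalize B.boxes = M at this ⊢
  induction M with
  | nil => simp
  | cons c L ih =>
    rw [List.pairwise_cons] at this
    by_cases hc : dg c = 0
    · have h0 : L.countP (fun c => decide (dg c = 0)) = 0 := by
        rw [List.countP_eq_zero]
        intro d hd
        have := this.1 d hd
        simpa [hc] using this
      simp [h0, hc]
    · simpa [List.countP_cons, hc] using ih this.2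

theorem Strip.touch_eq_zero {B : Strip} : B.touch = 0 ↔ ∀ c ∈ B.boxes, dg c ≠ 0 := by
  simp [Strip.touch, List.countP_eq_zero]

theorem Strip.Valid.touch_eq_one {B : Strip} (h : B.Valid) :
    B.touch = 1 ↔ ∃ c ∈ B.boxes, dg c = 0 := by
  have h1 := h.touch_le_one
  have h2 := Strip.touch_eq_zero (B := B)
  constructor
  · intro h'
    by_contra hc
    push Not at hc
    have := h2.2 hc
    omega
  · rintro ⟨c, hc, hc'⟩
    have : B.touch ≠ 0 := fun h0 => h2.1 h0 c hc hc'
    omega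

/-- The effect of the process on two strips `A` and `B`. -/
structure SwapRel (A B B' A' : Strip) : Prop where
  grid : Grid BoxMove A.boxes B.boxes B'.boxes A'.boxes
  valid₁ : A.Valid
  valid₂ : B.Valid
  valid₃ : B'.Valid
  valid₄ : A'.Valid
  sum : A.touch + B.touch ≠ 2 → A'.1.length + B'.1.length = A.1.length + B.1.length
  same : A.touch + B.touch = 0 → A'.1.length = A.1.length

theorem SwapRel.touch {A B B' A' : Strip} (h : SwapRel A B B' A') :
    B'.touch + A'.touch = A.touch + B.touch := by
  unfold Strip.touch
  rw [← List.countP_append, ← List.countP_append]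
  exact h.grid.perm.symm.countP_eq _

/-- The number of boxes on the main diagonal is the same before and after, so the conditions on
primes hold in reverse under the same case distinction. -/
theorem SwapRel.symm (A B B' A' : Strip) (h : SwapRel A B B' A') : SwapRel B' A' A B := by
  have ht := h.touch
  refine ⟨h.grid.symm BoxMove.symm, h.valid₃, h.valid₄, h.valid₁, h.valid₂, fun h2 => ?_,
    fun h0 => ?_⟩
  · have := h.sum (by omega)
    omega
  · have := h.sum (by omega)
    have := h.same (by omega)
    omega

/-- Primed boxes have positive diagonals, and a box on the main diagonal is necessarily the first
unprimed one. So a strip meeting the main diagonal can be reconstructed from its boxes. -/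
theorem Strip.Valid.takeWhile {B : Strip} (h : B.Valid) (ht : B.touch = 1) :
    B.boxes.takeWhile (fun c => decide (0 < dg c)) = B.1 := by
  obtain ⟨c, hc, hc0⟩ := h.touch_eq_one.1 ht
  unfold Strip.boxes
  rw [List.takeWhile_append_of_pos (by simpa using h.pos)]
  rcases h.cases with hE | ⟨y, E, hE, hy, -⟩
  · rcases List.mem_append.1 hc with hc | hc
    · exact absurd hc0 (h.pos c hc).ne'
    · exact absurd hc0 (hE c hc).ne'
  · rw [hE]; simp [hy]

theorem Strip.eq_of_boxes {B B' : Strip} (h : B.boxes = B'.boxes)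
    (h' : B.1.length = B'.1.length) : B = B' := by
  have := List.append_inj h h'
  exact Prod.ext this.1 this.2

/-- The grid determines the boxes; only the number of primes in each strip is in question. If both
strips meet the main diagonal, so do both outcomes, and both numbers can be read off the boxes. If
one does, one outcome does, and the other number follows from the sum. If none does, the numbers are
unchanged. -/
theorem SwapRel.unique (A B B₁ A₁ B₂ A₂ : Strip) (h₁ : SwapRel A B B₁ A₁)
    (h₂ : SwapRel A B B₂ A₂) : B₁ = B₂ ∧ A₁ = A₂ := by
  obtain ⟨hB, hA⟩ := Grid.unique BoxMove.unique h₁.grid h₂.grid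
  have htA : A₁.touch = A₂.touch := by unfold Strip.touch; rw [hA]
  have htB : B₁.touch = B₂.touch := by unfold Strip.touch; rw [hB]
  have ht := h₁.touch
  have hA1 := h₁.valid₄.touch_le_one
  have hB1 := h₁.valid₃.touch_le_one
  have h3 : A₁.touch = 1 → A₁.1.length = A₂.1.length := fun h => by
    rw [← h₁.valid₄.takeWhile h, ← h₂.valid₄.takeWhile (htA ▸ h), hA]
  have h4 : B₁.touch = 1 → B₁.1.length = B₂.1.length := fun h => by
    rw [← h₁.valid₃.takeWhile h, ← h₂.valid₃.takeWhile (htB ▸ h), hB]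
  have h5 := h₁.sum
  have h6 := h₂.sum
  have h7 := h₁.same
  have h8 := h₂.same
  have : A₁.1.length = A₂.1.length ∧ B₁.1.length = B₂.1.length := by
    by_cases h0 : A.touch + B.touch = 0
    · have := h7 h0
      have := h8 h0
      have := h5 (by omega)
      have := h6 (by omega)
      omega
    by_cases h2 : A.touch + B.touch = 2
    · exact ⟨h3 (by omega), h4 (by omega)⟩
    have h5 := h5 h2
    have h6 := h6 h2
    by_cases h' : A₁.touch = 1
    · have := h3 h'; omega
    · have := h4 (by omega); omega
  exact ⟨Strip.eq_of_boxes hB this.2, Strip.eq_of_boxes hA this.1⟩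

theorem Desc.cases {L : List Box} (h : Desc L) (h0 : ∀ c ∈ L, 0 ≤ dg c) :
    (∀ c ∈ L, 0 < dg c) ∨ ∃ L₀ z, L = L₀ ++ [z] ∧ dg z = 0 ∧ ∀ c ∈ L₀, 0 < dg c := by
  rcases List.eq_nil_or_concat' L with rfl | ⟨L, z, rfl⟩
  · simp
  · rw [desc_append_singleton] at h
    have hz := h0 z (by simp)
    have h1 : ∀ c ∈ L, 0 < dg c := fun c hc => hz.trans_lt (h.2 c hc)
    rcases hz.eq_or_lt with hz | hz
    · exact Or.inr ⟨L, z, rfl, hz.symm, h1⟩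
    · refine Or.inl fun c hc => ?_
      rcases List.mem_append.1 hc with hc | hc
      · exact h1 c hc
      · simp only [List.mem_singleton] at hc; subst hc; exact hz

/-- Boxes that started primed may end on the main diagonal, but only the last one of a descending
list; it is unprimed and becomes the first box of the unprimed part. The count and the last clause
say that this regrouping agrees with the labels left by the algorithm. -/
theorem exists_strip {N : Set Box} {xs ys : List Box} (hN : Grows N (xs ++ ys)) (hxs : Desc xs)
    (hys : Asc ys) :
    ∃ A : Strip, A.Valid ∧ A.boxes = xs ++ ys ∧
      A.1.length = xs.countP (fun c => decide (dg c ≠ 0)) ∧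
      ∀ f : Bool → Content, A.lab f = xs.map (fun c => (c, f (decide (dg c ≠ 0)))) ++
        ys.map (·, f false) := by
  have hle : ∀ c ∈ xs ++ ys, 0 ≤ dg c := fun c hc => dg_nonneg (hN.le hc)
  rcases hxs.cases (fun c hc => hle c (by simp [hc])) with h | ⟨xs, z, rfl, hz, h⟩
  · refine ⟨(xs, ys), ⟨hxs, h, hys, fun c hc => hle c (by simp [hc])⟩, rfl, ?_, fun f => ?_⟩
    · symm
      rw [List.countP_eq_length]
      intro c hc
      simpa using (h c hc).ne'
    · unfold Strip.lab
      congr 1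
      refine List.map_congr_left fun c hc => ?_
      have := (h c hc).ne'
      simp [this]
  · refine ⟨(xs, z :: ys), ⟨(desc_append_singleton.1 hxs).1, h, ?_,
      fun c hc => hle c (by simp at hc ⊢; tauto)⟩, by simp [Strip.boxes], ?_, fun f => ?_⟩
    · refine hys.cons_of_grows (N := extend N xs) (Q := []) ?_
        fun d hd => by rw [hz]; exact hle d (by simp [hd])
      have : Grows N (xs ++ (z :: ys)) := by simpa using hN
      simpa using (grows_append.1 this).2
    · rw [List.countP_append, List.countP_eq_length.2]
      · simp [hz]
      · intro c hc
        simpa using (h c hc).ne'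
    · unfold Strip.lab
      simp only [List.map_append, List.map_cons, List.map_nil, hz, ne_eq, not_true_eq_false,
        decide_false, List.append_assoc, List.cons_append, List.nil_append]
      congr 1
      refine List.map_congr_left fun c hc => ?_
      have := (h c hc).ne'
      simp [this]


/-! ### The complete process for one pair of letters. -/

section run
variable {a b : ℕ} {N : Set Box}

theorem mem_lab {V : Type*} {f : Bool → V} {B : Strip} {c : Box} {v : V} :
    (c, v) ∈ B.lab f ↔ (c ∈ B.1 ∧ f true = v) ∨ (c ∈ B.2 ∧ f false = v) := by
  unfold Strip.lab
  rw [List.mem_append]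
  refine or_congr ?_ ?_ <;> rw [List.mem_map] <;> constructor
  · rintro ⟨d, hd, h⟩; cases h; exact ⟨hd, rfl⟩
  · rintro ⟨hd, rfl⟩; exact ⟨c, hd, rfl⟩
  · rintro ⟨d, hd, h⟩; cases h; exact ⟨hd, rfl⟩
  · rintro ⟨hd, rfl⟩; exact ⟨c, hd, rfl⟩

/-- All `b`-boxes precede all `a`-boxes in the chain, so none of them is south or east of an
`a`-box. -/
theorem fullySwitched_fill {P R : List (Box × Content)} {A B : Strip}
    (h : Grows N ((P ++ (B.lab (labB b) ++ (A.lab (labA a) ++ R))).map Prod.fst))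
    (hP : ∀ c p, (c, labA a p) ∉ P) (hR : ∀ e ∈ R, ∀ q, e.2 ≠ labB b q) :
    FullySwitched a b (fill (P ++ (B.lab (labB b) ++ (A.lab (labA a) ++ R)))) := by
  rintro p c ⟨hc, hd⟩
  have hc' := (fill_eq_some_iff h.nodup).1 hc
  have hc'' : (c, labA a p) ∈ A.lab (labA a) ++ R := by
    rcases List.mem_append.1 hc' with hc' | hc'
    · exact absurd hc' (hP _ _)
    · rcases List.mem_append.1 hc' with hc' | hc'
      · simp [mem_lab] at hc'
      · exact hc'
  have key : ∀ d q, fill (P ++ (B.lab (labB b) ++ (A.lab (labA a) ++ R))) d = sndL b q →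
      c.1 ≤ d.1 → c.2 ≤ d.2 → False := by
    intro d q hd h1 h2
    have hd' := (fill_eq_some_iff h.nodup).1 hd
    rw [← List.append_assoc] at hd' h
    rcases List.mem_append.1 hd' with hd' | hd'
    · have := h.pairwise
      rw [List.map_append] at this
      exact pairwise_of_mem_append this (List.mem_map.2 ⟨_, hd', rfl⟩)
        (List.mem_map.2 ⟨_, hc'', rfl⟩) ⟨h1, h2⟩
    · rcases List.mem_append.1 hd' with hd' | hd'
      · simp [mem_lab] at hd'
      · exact hR _ hd' q rfl
  rcases hd with ⟨q, hq⟩ | ⟨q, hq⟩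
  · exact key _ q hq (by simp) le_rfl
  · exact key _ q hq le_rfl (by simp)

theorem countP_dg_ne_zero {L : List Box} (h : ∀ c ∈ L, dg c ≠ 0) :
    L.countP (fun c => decide (dg c ≠ 0)) = L.length := by
  rw [List.countP_eq_length]
  intro c hc
  simpa using h c hc

/-- The process on two strips. -/
theorem exists_run {P R : List (Box × Content)} {A B : Strip}
    (h : Grows N ((P ++ (A.lab (labA a) ++ (B.lab (labB b) ++ R))).map Prod.fst))
    (hP : ∀ c p, (c, labA a p) ∉ P) (hR : ∀ e ∈ R, ∀ q, e.2 ≠ labB b q)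
    (hA : A.Valid) (hB : B.Valid) :
    ∃ B' A', SwapRel A B B' A' ∧ Passes A.boxes B B' A'.boxes ∧
      Relation.ReflTransGen (DStep a b)
        (fill (P ++ (A.lab (labA a) ++ (B.lab (labB b) ++ R))))
        (fill (P ++ (B'.lab (labB b) ++ (A'.lab (labA a) ++ R)))) := by
  obtain ⟨AD, AE⟩ := A
  have hP' : ∀ c p, (c, labA a p) ∈ P ++ AD.map (·, labA a true) → p = true ∧ 0 < dg c := by
    intro c p hc
    rcases List.mem_append.1 hc with hc | hc
    · exact absurd hc (hP _ _)
    · obtain ⟨d, hd, hd'⟩ := List.mem_map.1 hc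
      simp only [Prod.mk.injEq, Sum.inl.injEq, Letter.mk.injEq, true_and] at hd'
      exact ⟨hd'.2.symm, hd'.1 ▸ hA.pos d hd⟩
  have hg : Grows (extend N (P.map Prod.fst)) (AD ++ (AE ++ (B.boxes ++ R.map Prod.fst))) := by
    have : Grows N (P.map Prod.fst ++ (AD ++ (AE ++ (B.boxes ++ R.map Prod.fst)))) := by
      simpa [Strip.lab, Strip.boxes, Function.comp_def] using h
    exact (grows_append.1 this).2
  have hgAE : ∀ {X}, Grows (extend N (P.map Prod.fst)) (AD ++ (X ++ (B.boxes ++ R.map Prod.fst))) →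
      Grows (extend (extend N (P.map Prod.fst)) AD) (X ++ B.boxes) := by
    intro X hX
    rw [← List.append_assoc X] at hX
    exact (grows_append.1 (grows_append.1 hX).2).1
  have hcons : ∀ {L : List Box} {p : Bool} {S : List (Box × Content)},
      (∀ e ∈ S, ∀ q, e.2 ≠ labB b q) →
      ∀ e ∈ L.map (·, labA a p) ++ S, ∀ q, e.2 ≠ labB b q := by
    intro L p S hS e he q
    rcases List.mem_append.1 he with he | he
    · obtain ⟨c, -, rfl⟩ := List.mem_map.1 he; simp
    · exact hS e he q
  -- the end of the argument, when the unprimed boxes have passed without becoming primed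
  have finish : ∀ B₂ xs₂, Passes AE B B₂ xs₂ → Asc xs₂ →
      Relation.ReflTransGen (DStep a b)
        (fill (P ++ (Strip.lab (labA a) (AD, AE) ++ (B.lab (labB b) ++ R))))
        (fill (P ++ (AD.map (·, labA a true) ++ (B₂.lab (labB b) ++
          (xs₂.map (·, labA a false) ++ R))))) →
      (Strip.touch (AD, AE) + B.touch ≠ 2 → B₂.1.length = B.1.length) →
      ∃ B' A', SwapRel (AD, AE) B B' A' ∧ Passes (Strip.boxes (AD, AE)) B B' A'.boxes ∧
      Relation.ReflTransGen (DStep a b)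
        (fill (P ++ (Strip.lab (labA a) (AD, AE) ++ (B.lab (labB b) ++ R))))
        (fill (P ++ (B'.lab (labB b) ++ (A'.lab (labA a) ++ R)))) := by
    intro B₂ xs₂ hp₂ hasc hs₂ hlen₂
    have hg₂ := hp₂.grows hg
    have hB₂ := hp₂.valid hg hB
    obtain ⟨B₃, xs₃, hp₃, hlen₃, hs₃⟩ := run_primed (N := N) (b := b) (AD := AD) hP hA.desc hA.pos (B := B₂)
      (R := xs₂.map (·, labA a false) ++ R)
      (by
        have : Grows N (P.map Prod.fst ++ (AD ++ (B₂.boxes ++ (xs₂ ++ R.map Prod.fst)))) :=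
          grows_append.2 ⟨(grows_append.1 (by rw [List.map_append] at h; exact h)).1, hg₂⟩
        simpa [Function.comp_def] using this)
      (hcons hR) hB₂
    have hg₃ := hp₃.grows (P := []) hg₂
    have hB₃ := hp₃.valid (P := []) hg₂ hB₂
    -- Descents are preserved without any condition on the main diagonal.
    have hdesc : Desc xs₃ := by
      have h1 : Grows (extend N (P.map Prod.fst)) ((AD ++ B₂.boxes) ++ (xs₂ ++ R.map Prod.fst)) := by
        simpa using hg₂
      exact Grid.desc hp₃.grid (grows_append.1 h1).1 hA.desc
    have hgA : Grows (extend (extend N (P.map Prod.fst)) B₃.boxes) (xs₃ ++ xs₂) := by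
      have h1 := ((grows_append (L := B₃.boxes)).1 hg₃).2
      rw [← List.append_assoc] at h1
      exact (grows_append.1 h1).1
    obtain ⟨A', hA', hbox, hlenA, hlab⟩ := exists_strip hgA hdesc hasc
    have hp : Passes (Strip.boxes (AD, AE)) B B₃ A'.boxes := by
      rw [hbox]; exact Passes.append hp₂ hp₃
    refine ⟨B₃, A', ⟨hp.grid, hA, hB, hB₃, hA', fun h2 => ?_, fun h0 => ?_⟩, hp, hs₂.trans ?_⟩
    · have := hlen₂ h2
      simp only
      omega
    · have ht : A'.touch = 0 := by
        have : B₃.touch + A'.touch = Strip.touch (AD, AE) + B.touch := by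
          unfold Strip.touch
          rw [← List.countP_append, ← List.countP_append]
          exact hp.grid.perm.symm.countP_eq _
        omega
      rw [Strip.touch_eq_zero, hbox] at ht
      rw [hlenA, countP_dg_ne_zero fun c hc => ht c (by simp [hc])]
      exact hp₃.grid.length_eq.2
    · rw [hlab]
      simpa using hs₃
  -- the end of the argument, when the box on the main diagonal has become primed
  have finish' : ∀ u A₁ B₂ u' xs₂, AE = u :: A₁ → Passes AE B B₂ (u' :: xs₂) → Asc xs₂ →
      0 < dg u' →
      Relation.ReflTransGen (DStep a b)
        (fill (P ++ (Strip.lab (labA a) (AD, AE) ++ (B.lab (labB b) ++ R))))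
        (fill (P ++ (AD.map (·, labA a true) ++ (B₂.lab (labB b) ++
          ((u', labA a true) :: (xs₂.map (·, labA a false) ++ R)))))) →
      Strip.touch (AD, AE) = 1 →
      (Strip.touch (AD, AE) + B.touch ≠ 2 → B₂.1.length + 1 = B.1.length) →
      ∃ B' A', SwapRel (AD, AE) B B' A' ∧ Passes (Strip.boxes (AD, AE)) B B' A'.boxes ∧
      Relation.ReflTransGen (DStep a b)
        (fill (P ++ (Strip.lab (labA a) (AD, AE) ++ (B.lab (labB b) ++ R))))
        (fill (P ++ (B'.lab (labB b) ++ (A'.lab (labA a) ++ R)))) := by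
    rintro u A₁ B₂ u' xs₂ rfl hp₂ hasc hu' hs₂ htouch hlen₂
    have hg₂ := hp₂.grows hg
    have hB₂ := hp₂.valid hg hB
    obtain ⟨B₃, xs₃, hp₃, hlen₃, hs₃⟩ := run_primed (N := N) (b := b) (AD := AD) hP hA.desc hA.pos (B := B₂)
      (R := (u', labA a true) :: (xs₂.map (·, labA a false) ++ R))
      (by
        have : Grows N (P.map Prod.fst ++ (AD ++ (B₂.boxes ++ (u' :: xs₂ ++ R.map Prod.fst)))) :=
          grows_append.2 ⟨(grows_append.1 (by rw [List.map_append] at h; exact h)).1, hg₂⟩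
        simpa [Function.comp_def] using this)
      (by
        intro e he q
        rcases List.mem_cons.1 he with rfl | he
        · simp
        · exact hcons hR e he q) hB₂
    have hg₃ := hp₃.grows (P := []) hg₂
    have hB₃ := hp₃.valid (P := []) hg₂ hB₂
    have hp : Passes (Strip.boxes (AD, u :: A₁)) B B₃ (xs₃ ++ u' :: xs₂) :=
      Passes.append hp₂ hp₃
    have hle : ∀ c ∈ xs₃ ++ u' :: xs₂, 0 ≤ dg c := by
      intro c hc
      refine dg_nonneg (hg₃.le ?_)
      simp only [List.nil_append, List.mem_append]
      simp only [List.mem_append] at hc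
      tauto
    have hdesc : Desc (xs₃ ++ [u']) := by
      have h1 := hp.grid
      -- The box `u` on the main diagonal continues the descending list of primed boxes, and
      -- descents survive the grid. So its new place `u'` fits at the end of the primed part.
      have h2 : Grid BoxMove ((AD ++ [u]) ++ A₁) B.boxes B₃.boxes ((xs₃ ++ [u']) ++ xs₂) := by
        simpa [Strip.boxes] using h1
      obtain ⟨ws₁, ws₂, zs, hw, hg1, hg2⟩ := Grid.split h2
      have hl1 := hg2.length_eq.2
      have hl2 := hp₃.grid.length_eq.2
      have hw' := (List.append_inj hw (by simp only [List.length_append, List.length_singleton] at hl1 ⊢; omega)).1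
      rw [hw']
      refine Grid.desc hg2 (N := extend N (P.map Prod.fst)) ?_ ?_
      · have h3 : Grows (extend N (P.map Prod.fst)) ((AD ++ [u]) ++ (A₁ ++ (B.boxes ++ R.map Prod.fst))) := by
          simpa using hg
        have h4 := (grows_append.1 h3)
        have h5 := Grows.grid hg1 h4.2
        have h6 := grows_append.2 ⟨h4.1, h5⟩
        rw [← List.append_assoc] at h6
        exact (grows_append.1 h6).1
      · have hut : dg u = 0 := by
          obtain ⟨c, hc, hc0⟩ := hA.touch_eq_one.1 htouch
          have hu0 := hA.nonneg u (by simp)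
          rcases List.mem_append.1 hc with hc | hc
          · exact absurd hc0 (hA.pos c hc).ne'
          · rcases List.mem_cons.1 hc with rfl | hc
            · exact hc0
            · have := (asc_cons.1 hA.asc).1 c hc
              omega
        rw [desc_append_singleton]
        exact ⟨hA.desc, fun d hd => by rw [hut]; exact hA.pos d hd⟩
    have hpos₃ : ∀ c ∈ xs₃, 0 < dg c := fun c hc =>
      hu'.trans ((desc_append_singleton.1 hdesc).2 c hc)
    have hpos₃' : ∀ c ∈ xs₃ ++ [u'], 0 < dg c := by
      intro c hc
      rcases List.mem_append.1 hc with hc | hc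
      · exact hpos₃ c hc
      · simp only [List.mem_singleton] at hc; subst hc; exact hu'
    have hA' : Strip.Valid (xs₃ ++ [u'], xs₂) :=
      ⟨hdesc, hpos₃', hasc, fun c hc => hle c (by simp [hc])⟩
    have hbox : Strip.boxes (xs₃ ++ [u'], xs₂) = xs₃ ++ u' :: xs₂ := by simp [Strip.boxes]
    rw [countP_dg_ne_zero fun c hc => (hpos₃ c hc).ne'] at hlen₃
    refine ⟨B₃, (xs₃ ++ [u'], xs₂), ⟨by rw [hbox]; exact hp.grid, hA, hB, hB₃, hA',
      fun h2 => ?_, fun h0 => ?_⟩, by rw [hbox]; exact hp, hs₂.trans ?_⟩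
    · have := hlen₂ h2
      simp only [List.length_append, List.length_singleton]
      omega
    · omega
    · refine hs₃.trans ?_
      have : xs₃.map (fun c => (c, labA a (decide (dg c ≠ 0)))) = xs₃.map (·, labA a true) := by
        refine List.map_congr_left fun c hc => ?_
        have := (hpos₃ c hc).ne'
        simp [this]
      rw [this]
      simpa [Strip.lab] using Relation.ReflTransGen.refl
  rcases hA.cases with hE | ⟨u, A₁, hAE, hu, hE⟩
  · simp only at hE
    have hno := run_unprimed (N := N) (b := b) (uo := []) (A := AE) hP' (by simpa using hA.asc) hE
      (Or.inl rfl) (B := B) (R := R) (by simpa [Strip.lab] using h) hR hB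
    rcases hno with ⟨B₁, xs₁, hp, hlen, -, hs⟩ | ⟨u, _, _, _, hu, _⟩
    · refine finish B₁ xs₁ hp ?_ (by simpa [Strip.lab] using hs) fun _ => hlen
      exact Grid.asc_of_pos hp.grid (hgAE hg) hA.asc hE hB.le_one
    · simp at hu
  · simp only at hAE
    subst hAE
    have hasc₁ : Asc A₁ := (asc_cons.1 hA.asc).2
    have htA : Strip.touch (AD, u :: A₁) = 1 :=
      hA.touch_eq_one.2 ⟨u, by simp [Strip.boxes], hu⟩
    have hg₁ : Grows (extend N (P.map Prod.fst))
        ((AD ++ [u]) ++ (A₁ ++ (B.boxes ++ R.map Prod.fst))) := by simpa using hg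
    have hgA₁ : Grows (extend (extend N (P.map Prod.fst)) (AD ++ [u])) (A₁ ++ B.boxes) := by
      have := (grows_append.1 hg₁).2
      rw [← List.append_assoc] at this
      exact (grows_append.1 this).1
    have hno := run_unprimed (N := N) (b := b) (uo := [u]) (A := A₁) hP' (by simpa using hA.asc) hE
      (Or.inr ⟨u, rfl, hu⟩) (B := B) (R := R) (by simpa [Strip.lab] using h) hR hB
    rcases hno with ⟨B₁, xs₁, hp, hlen, hxs₁, hs⟩ | ⟨v, u', xs₁, B₁, hv, hp, hu', hlen, hz, hs⟩
    · have hxs₁ := hxs₁ (by simp)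
      have hascx : Asc xs₁ := Grid.asc_of_pos hp.grid hgA₁ hasc₁ hE hB.le_one
      have hgb := hp.grows hg₁
      have hB₁ := hp.valid hg₁ hB
      -- Neither `A₁` nor its final places meet the main diagonal, so the strip `B` has kept its box
      -- there, if it had one.
      have htouch : B₁.touch = B.touch := by
        have := hp.grid.perm.countP_eq fun c => decide (dg c = 0)
        rw [List.countP_append, List.countP_append] at this
        have h1 : A₁.countP (fun c => decide (dg c = 0)) = 0 := by
          rw [List.countP_eq_zero]; intro c hc; simpa using (hE c hc).ne'
        have h2 : xs₁.countP (fun c => decide (dg c = 0)) = 0 := by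
          rw [List.countP_eq_zero]; intro c hc; simpa using hxs₁ c hc
        unfold Strip.touch
        omega
      have hm : Moving a b N (P ++ AD.map (·, labA a true)) u false (B₁.lab (labB b))
          (xs₁.map (·, labA a false) ++ R) := by
        refine ⟨?_, fun c hc => ?_, fun c _ hc => by simp at hc, fun e he => ?_, hcons hR⟩
        · have : Grows N (P.map Prod.fst ++ ((AD ++ [u]) ++ (B₁.boxes ++ (xs₁ ++ R.map Prod.fst)))) :=
            grows_append.2 ⟨(grows_append.1 (by rw [List.map_append] at h; exact h)).1, hgb⟩
          simpa [Function.comp_def] using this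
        · exact absurd (hP' c _ hc).1 (by simp)
        · unfold Strip.lab at he
          rcases List.mem_append.1 he with he | he <;> obtain ⟨c, -, rfl⟩ := List.mem_map.1 he <;>
            exact ⟨_, rfl⟩
      obtain ⟨B₂, u', p', hpu, hcase, hs'⟩ :=
        hm.pass_diag (fun c hc => by simpa using (hP' c _ hc).1) hB₁ hu
      have hp₂ : Passes (u :: A₁) B B₂ (u' :: xs₁) := Passes.cons hp hpu
      have hs₂ : Relation.ReflTransGen (DStep a b)
          (fill (P ++ (Strip.lab (labA a) (AD, u :: A₁) ++ (B.lab (labB b) ++ R))))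
          (fill (P ++ (AD.map (·, labA a true) ++ (B₂.lab (labB b) ++
            ((u', labA a p') :: (xs₁.map (·, labA a false) ++ R)))))) := by
        have hs₁ : Relation.ReflTransGen (DStep a b)
            (fill (P ++ (Strip.lab (labA a) (AD, u :: A₁) ++ (B.lab (labB b) ++ R))))
            (fill (P ++ (AD.map (·, labA a true) ++ ((u, labA a false) ::
              (B₁.lab (labB b) ++ (xs₁.map (·, labA a false) ++ R)))))) := by
          simpa [Strip.lab] using hs
        exact hs₁.trans (by simpa using hs')
      -- If no `b`-box meets the main diagonal, ascents are preserved by the whole grid. If `u`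
      -- stops on the main diagonal, it comes before all later boxes in any case. If it receives a
      -- prime, it joins the primed part.
      rcases hcase with ⟨rfl, hlen', hc⟩ | ⟨rfl, hu', hc⟩ | ⟨rfl, hu', hlen'⟩
      · refine finish B₂ (u' :: xs₁) hp₂ ?_ (by simpa using hs₂) fun _ => by omega
        refine Grid.asc hp₂.grid (hgAE hg) hA.asc ?_
        rw [← Strip.touch_eq_zero, ← htouch, Strip.touch_eq_zero]
        exact hc
      · have htB : B.touch = 1 := by rw [← htouch]; exact hB₁.touch_eq_one.2 hc
        refine finish B₂ (u' :: xs₁) hp₂ ?_ (by simpa using hs₂) fun h2 => absurd (by omega) h2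
        have hgc := hp₂.grows hg
        have h1 : Grows (extend (extend N (P.map Prod.fst)) (AD ++ B₂.boxes))
            ((u' :: xs₁) ++ R.map Prod.fst) := by
          rw [← List.append_assoc] at hgc
          exact (grows_append.1 hgc).2
        exact hascx.cons_of_grows h1 fun d hd => by
          rw [hu']; exact dg_nonneg (h1.le (by simp [hd]))
      · exact finish' u A₁ B₂ u' xs₁ rfl hp₂ hascx hu' hs₂ htA fun _ => by omega
    · obtain rfl : u = v := by simpa using hv
      -- Only the boxes after `u` need to stay ascending; they start off the main diagonal.
      have hsplit : Asc xs₁ := by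
        cases hp with
        | cons h1 _ => exact Grid.asc_of_pos h1.grid hgA₁ hasc₁ hE hB.le_one
      refine finish' u A₁ B₁ u' xs₁ rfl hp hsplit hu' ?_ htA fun h2 => ?_
      · simpa [Strip.lab] using hs
      · exact absurd (by rw [htA, hB.touch_eq_one.2 hz]) h2

theorem runPair_fill {P R : List (Box × Content)} {A B : Strip}
    (h : Grows N ((P ++ (A.lab (labA a) ++ (B.lab (labB b) ++ R))).map Prod.fst))
    (hP : ∀ c p, (c, labA a p) ∉ P) (hR : ∀ e ∈ R, ∀ q, e.2 ≠ labB b q)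
    (hA : A.Valid) (hB : B.Valid) :
    ∃ B' A', SwapRel A B B' A' ∧ Passes A.boxes B B' A'.boxes ∧
      Grows N ((P ++ (B'.lab (labB b) ++ (A'.lab (labA a) ++ R))).map Prod.fst) ∧
      ∀ V, RunPair a b (fill (P ++ (A.lab (labA a) ++ (B.lab (labB b) ++ R)))) V ↔
        V = fill (P ++ (B'.lab (labB b) ++ (A'.lab (labA a) ++ R))) := by
  obtain ⟨B', A', hsw, hp, hs⟩ := exists_run h hP hR hA hB
  have hg : Grows N ((P ++ (B'.lab (labB b) ++ (A'.lab (labA a) ++ R))).map Prod.fst) := by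
    have : Grows N (P.map Prod.fst ++ (A.boxes ++ (B.boxes ++ R.map Prod.fst))) := by
      simpa using h
    simpa using hp.grows this
  exact ⟨B', A', hsw, hp, hg, fun V => runPair_iff hs (fullySwitched_fill hg hP hR) V⟩

end run

theorem Row.mono {α β : Type*} {R R' : α → β → β → α → Prop}
    (h : ∀ x y y' x', R x y y' x' → R' x y y' x') {x x' : α} {ys ys' : List β}
    (hr : Row R x ys ys' x') : Row R' x ys ys' x' := by
  induction hr with
  | nil => exact Row.nil _
  | cons m _ ih => exact Row.cons (h _ _ _ _ m) ih

theorem Grid.mono {α β : Type*} {R R' : α → β → β → α → Prop}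
    (h : ∀ x y y' x', R x y y' x' → R' x y y' x') {xs xs' : List α} {ys ys' : List β}
    (hg : Grid R xs ys ys' xs') : Grid R' xs ys ys' xs' := by
  induction hg with
  | nil => exact Grid.nil _
  | cons _ hr ih => exact Grid.cons ih (hr.mono h)

/-! ### Lists of strips -/

/-- A letter together with the strip of its boxes. -/
abbrev NStrip := ℕ × Strip

/-- The labelled boxes of a list of strips. -/
def labs {V : Type*} (tag : Letter → V) (L : List NStrip) : List (Box × V) :=
  L.flatMap fun e => e.2.lab fun p => tag ⟨e.1, p⟩

section labs
variable {V : Type*} {tag : Letter → V}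

@[simp] theorem labs_nil : labs tag [] = [] := rfl

@[simp] theorem labs_cons (e : NStrip) (L : List NStrip) :
    labs tag (e :: L) = (e.2.lab fun p => tag ⟨e.1, p⟩) ++ labs tag L := rfl

@[simp] theorem labs_append (L L' : List NStrip) :
    labs tag (L ++ L') = labs tag L ++ labs tag L' := by
  simp [labs]

theorem mem_labs {L : List NStrip} {c : Box} {v : V} : (c, v) ∈ labs tag L ↔
    ∃ e ∈ L, (c ∈ e.2.1 ∧ tag ⟨e.1, true⟩ = v) ∨ (c ∈ e.2.2 ∧ tag ⟨e.1, false⟩ = v) := by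
  simp only [labs, List.mem_flatMap, mem_lab]

theorem map_fst_labs (L : List NStrip) :
    (labs tag L).map Prod.fst = L.flatMap fun e => e.2.boxes := by
  simp [labs, List.map_flatMap]

end labs

/-- The process on two strips, with their letters. -/
def NSwap (x y y' x' : NStrip) : Prop := x'.1 = x.1 ∧ y'.1 = y.1 ∧ SwapRel x.2 y.2 y'.2 x'.2

theorem NSwap.symm (x y y' x' : NStrip) (h : NSwap x y y' x') : NSwap y' x' x y :=
  ⟨h.2.1.symm, h.1.symm, SwapRel.symm _ _ _ _ h.2.2⟩

theorem NSwap.unique (x y y₁ x₁ y₂ x₂ : NStrip) (h₁ : NSwap x y y₁ x₁) (h₂ : NSwap x y y₂ x₂) :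
    y₁ = y₂ ∧ x₁ = x₂ := by
  have := SwapRel.unique _ _ _ _ _ _ h₁.2.2 h₂.2.2
  exact ⟨Prod.ext (h₁.2.1.trans h₂.2.1.symm) this.1, Prod.ext (h₁.1.trans h₂.1.symm) this.2⟩

/-- The process on two strips, with the way in which the boxes pass. -/
def NPass (x y y' x' : NStrip) : Prop :=
  NSwap x y y' x' ∧ Passes x.2.boxes y.2 y'.2 x'.2.boxes

/-- The letter and the number of its boxes. -/
def NStrip.size (e : NStrip) : ℕ × ℕ := (e.1, e.2.boxes.length)

theorem NSwap.size {x y y' x' : NStrip} (h : NSwap x y y' x') :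
    y'.size = y.size ∧ x'.size = x.size := by
  have := h.2.2.grid.length_eq
  exact ⟨Prod.ext h.2.1 this.1, Prod.ext h.1 this.2⟩

theorem Row.size {x x' : NStrip} {ys ys' : List NStrip} (h : Row NSwap x ys ys' x') :
    ys'.map NStrip.size = ys.map NStrip.size ∧ x'.size = x.size := by
  induction h with
  | nil => exact ⟨rfl, rfl⟩
  | cons m _ ih => exact ⟨by simp [ih.1, m.size.1], by rw [ih.2, m.size.2]⟩

theorem Grid.size {xs xs' ys ys' : List NStrip} (h : Grid NSwap xs ys ys' xs') :
    ys'.map NStrip.size = ys.map NStrip.size ∧ xs'.map NStrip.size = xs.map NStrip.size := by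
  induction h with
  | nil => exact ⟨rfl, rfl⟩
  | cons _ hr ih =>
    have := hr.size
    exact ⟨by rw [this.1, ih.1], by simp [ih.2, this.2]⟩

theorem map_fst_of_size {L L' : List NStrip} (h : L'.map NStrip.size = L.map NStrip.size) :
    L'.map Prod.fst = L.map Prod.fst := by
  have := congrArg (List.map Prod.fst) h
  simpa [NStrip.size, Function.comp_def] using this

theorem RunAll.append_iff {l l' : List (ℕ × ℕ)} {U W : PairFilling} :
    RunAll (l ++ l') U W ↔ ∃ V, RunAll l U V ∧ RunAll l' V W := by
  induction l generalizing U with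
  | nil =>
    constructor
    · intro h; exact ⟨U, RunAll.nil U, h⟩
    · rintro ⟨V, h, h'⟩; cases h; exact h'
  | cons e l ih =>
    obtain ⟨a, b⟩ := e
    constructor
    · intro h
      cases h with
      | cons _ _ _ _ V _ h1 h2 =>
        obtain ⟨V', h3, h4⟩ := ih.1 h2
        exact ⟨V', RunAll.cons _ _ _ _ _ _ h1 h3, h4⟩
    · rintro ⟨V, h, h'⟩
      cases h with
      | cons _ _ _ _ V' _ h1 h2 => exact RunAll.cons _ _ _ _ _ _ h1 (ih.2 ⟨V, h2, h'⟩)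

theorem runAll_cons_iff {a b : ℕ} {l : List (ℕ × ℕ)} {U W : PairFilling} :
    RunAll ((a, b) :: l) U W ↔ ∃ V, RunPair a b U V ∧ RunAll l V W := by
  constructor
  · intro h
    cases h with
    | cons _ _ _ _ V _ h1 h2 => exact ⟨V, h1, h2⟩
  · rintro ⟨V, h1, h2⟩
    exact RunAll.cons _ _ _ _ _ _ h1 h2

theorem runAll_nil_iff {U W : PairFilling} : RunAll [] U W ↔ W = U := by
  constructor
  · intro h; cases h; rfl
  · rintro rfl; exact RunAll.nil _

/-- The boxes of one letter of the first tableau pass through the second tableau. -/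
theorem runAll_row {N : Set Box} {R : List (Box × Content)}
    {Bs : List NStrip} (hB : ∀ e ∈ Bs, e.2.Valid) (hnd : (Bs.map Prod.fst).Nodup)
    (hR : ∀ e ∈ R, ∀ b q, e.2 ≠ labB b q) :
    ∀ {x : NStrip} {P : List (Box × Content)}, x.2.Valid →
    Grows N ((P ++ (x.2.lab (labA x.1) ++ (labs Sum.inr Bs ++ R))).map Prod.fst) →
    (∀ c p, (c, labA x.1 p) ∉ P) →
    ∃ Bs' x', Row NPass x Bs Bs' x' ∧ x'.2.Valid ∧ (∀ e ∈ Bs', e.2.Valid) ∧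
      Grows N ((P ++ (labs Sum.inr Bs' ++ (x'.2.lab (labA x'.1) ++ R))).map Prod.fst) ∧
      ∀ V, RunAll (Bs.map fun e => (x.1, e.1))
        (fill (P ++ (x.2.lab (labA x.1) ++ (labs Sum.inr Bs ++ R)))) V ↔
        V = fill (P ++ (labs Sum.inr Bs' ++ (x'.2.lab (labA x'.1) ++ R))) := by
  induction Bs with
  | nil =>
    intro x P hx h _
    exact ⟨[], x, Row.nil x, hx, by simp, by simpa using h, fun V => by
      simpa using runAll_nil_iff⟩
  | cons y Bs ih =>
    intro x P hx h hP
    simp only [List.map_cons, List.nodup_cons] at hnd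
    -- Letters are distinct, so no box of the current letter `y.1` occurs among the remaining
    -- strips.
    have hR' : ∀ e ∈ labs Sum.inr Bs ++ R, ∀ q, e.2 ≠ labB y.1 q := by
      rintro ⟨c, v⟩ he q rfl
      rcases List.mem_append.1 he with he | he
      · obtain ⟨e, he, h'⟩ := mem_labs.1 he
        refine hnd.1 (List.mem_map.2 ⟨e, he, ?_⟩)
        simp at h'
        tauto
      · exact hR _ he _ q rfl
    obtain ⟨B', A', hsw, hp, hg, hrun⟩ := runPair_fill (a := x.1) (b := y.1) (A := x.2) (B := y.2)
      (R := labs Sum.inr Bs ++ R) (by simpa using h) hP hR' hx (hB y (by simp))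
    obtain ⟨Bs', x', hr, hx', hBs', hg', hrun'⟩ := ih (fun e he => hB e (by simp [he])) hnd.2
      (x := (x.1, A')) (P := P ++ B'.lab (labB y.1)) hsw.valid₄ (by simpa using hg)
      (fun c p hc => by
        rcases List.mem_append.1 hc with hc | hc
        · exact hP c p hc
        · simp [mem_lab] at hc)
    refine ⟨(y.1, B') :: Bs', x', Row.cons (x₁ := (x.1, A')) ⟨⟨rfl, rfl, hsw⟩, hp⟩ hr, hx', ?_, by simpa using hg',
      fun V => ?_⟩
    · intro e he
      rcases List.mem_cons.1 he with rfl | he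
      · exact hsw.valid₃
      · exact hBs' e he
    · rw [List.map_cons, runAll_cons_iff]
      have h1 : ∀ V, RunPair x.1 y.1
          (fill (P ++ (x.2.lab (labA x.1) ++ (labs Sum.inr (y :: Bs) ++ R)))) V ↔
          V = fill (P ++ (B'.lab (labB y.1) ++ (A'.lab (labA x.1) ++ (labs Sum.inr Bs ++ R)))) := by
        simpa using hrun
      simp only [h1, exists_eq_left]
      simpa using hrun' V

/-- The schedule for two lists of strips. -/
def pairs (As Bs : List NStrip) : List (ℕ × ℕ) :=
  As.reverse.flatMap fun e => Bs.map fun f => (e.1, f.1)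

/-- The process on two lists of strips. -/
theorem runAll_grid {N : Set Box} {As : List NStrip} (hA : ∀ e ∈ As, e.2.Valid)
    (hndA : (As.map Prod.fst).Nodup) :
    ∀ {Bs : List NStrip} {R : List (Box × Content)}, (∀ e ∈ Bs, e.2.Valid) →
    (Bs.map Prod.fst).Nodup → (∀ e ∈ R, ∀ b q, e.2 ≠ labB b q) →
    Grows N ((labs Sum.inl As ++ (labs Sum.inr Bs ++ R)).map Prod.fst) →
    ∃ Bs' As', Grid NPass As Bs Bs' As' ∧ (∀ e ∈ Bs', e.2.Valid) ∧ (∀ e ∈ As', e.2.Valid) ∧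
      Grows N ((labs Sum.inr Bs' ++ (labs Sum.inl As' ++ R)).map Prod.fst) ∧
      ∀ V, RunAll (pairs As Bs) (fill (labs Sum.inl As ++ (labs Sum.inr Bs ++ R))) V ↔
        V = fill (labs Sum.inr Bs' ++ (labs Sum.inl As' ++ R)) := by
  induction As using List.reverseRecOn with
  | nil =>
    intro Bs R hB _ _ h
    exact ⟨Bs, [], Grid.nil _, hB, by simp, by simpa using h, fun V => by
      simpa [pairs] using runAll_nil_iff⟩
  | append_singleton As x ih =>
    intro Bs R hB hndB hR h
    rw [List.map_append, List.nodup_append] at hndA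
    obtain ⟨Bs₁, x', hr, hx', hBs₁, hg₁, hrun₁⟩ := runAll_row (x := x) (P := labs Sum.inl As)
      hB hndB hR (hA x (by simp)) (by simpa using h)
      (fun c p hc => by
        obtain ⟨e, he, h'⟩ := mem_labs.1 hc
        refine hndA.2.2 e.1 (List.mem_map.2 ⟨e, he, rfl⟩) x.1 (by simp) ?_
        simp at h'
        tauto)
    have hsize := (hr.mono fun _ _ _ _ h => h.1).size
    have hfst := map_fst_of_size hsize.1
    obtain ⟨Bs', As', hgr, hB', hA', hg', hrun'⟩ := ih (fun e he => hA e (by simp [he])) hndA.1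
      (Bs := Bs₁) (R := x'.2.lab (labA x'.1) ++ R) hBs₁ (by rw [hfst]; exact hndB)
      (by
        rintro ⟨c, v⟩ he b q rfl
        rcases List.mem_append.1 he with he | he
        · simp [mem_lab] at he
        · exact hR _ he b q rfl) (by simpa using hg₁)
    refine ⟨Bs', As' ++ [x'], Grid.append (Grid.cons (Grid.nil _) hr) hgr, hB', ?_,
      by simpa using hg', fun V => ?_⟩
    · intro e he
      rcases List.mem_append.1 he with he | he
      · exact hA' e he
      · simp only [List.mem_singleton] at he; subst he; exact hx'
    · have hpairs : pairs (As ++ [x]) Bs = (Bs.map fun f => (x.1, f.1)) ++ pairs As Bs₁ := by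
        have : ∀ a : ℕ, (Bs.map fun f => (a, f.1)) = Bs₁.map fun f => (a, f.1) := by
          intro a
          have := congrArg (List.map fun b => (a, b)) hfst
          simpa [Function.comp_def] using this.symm
        simp [pairs, this]
      rw [hpairs, RunAll.append_iff]
      have h1 : ∀ V, RunAll (Bs.map fun e => (x.1, e.1))
          (fill (labs Sum.inl (As ++ [x]) ++ (labs Sum.inr Bs ++ R))) V ↔
          V = fill (labs Sum.inl As ++ (labs Sum.inr Bs₁ ++ (x'.2.lab (labA x'.1) ++ R))) := by
        simpa using hrun₁
      simp only [h1, exists_eq_left]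
      simpa using hrun' V


/-! ### Tableaux as lists of strips -/

theorem isIdeal_shiftedShape (lam : StrictPartition) : IsIdeal (shiftedShape lam) := by
  -- Each row of a strict partition is shorter than the row above it by at least one, until the rows
  -- are empty; this makes the shifted shape closed to the northwest.
  have hanti : ∀ i d, lam.row (i + d) = 0 ∨ lam.row (i + d) + d ≤ lam.row i := by
    intro i d
    induction d with
    | zero => simp
    | succ d ih =>
      have := lam.strict (i + d)
      rw [← Nat.add_assoc]
      omega
  refine ⟨fun c hc => hc.1, fun c hc c' h h1 h2 => ⟨h, ?_⟩⟩
  obtain ⟨d, hd⟩ := Nat.exists_eq_add_of_le h1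
  have := hanti c'.1 d
  have h3 : c.1 ≤ c.2 := hc.1
  have h4 : c.2 < lam.row c.1 + c.1 := hc.2
  rw [hd] at h3 h4
  omega

theorem finite_shiftedShape (lam : StrictPartition) : (shiftedShape lam).Finite := by
  have hanti : ∀ i, lam.row i = 0 ∨ lam.row i + i ≤ lam.row 0 := by
    intro i
    induction i with
    | zero => simp
    | succ i ih =>
      have := lam.strict i
      omega
  refine ((Set.finite_Iio (lam.row 0)).prod (Set.finite_Iio (lam.row 0))).subset ?_
  rintro ⟨i, j⟩ ⟨h1, h2⟩
  have := hanti i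
  simp only [Set.mem_prod, Set.mem_Iio] at h1 h2 ⊢
  omega

theorem exists_strictPartition {X : Set Box} (hX : IsIdeal X) (hfin : X.Finite) :
    ∃ lam : StrictPartition, shiftedShape lam = X := by
  classical
  have hex : ∀ i, ∃ r, (i, i + r) ∉ X := by
    intro i
    by_contra! h
    exact Set.infinite_range_of_injective (f := fun r : ℕ => ((i, i + r) : Box))
      (fun r s h => by simpa using h) (hfin.subset (by rintro _ ⟨r, rfl⟩; exact h r))
  have hrow : ∀ i j, (i, j) ∈ X ↔ i ≤ j ∧ j < Nat.find (hex i) + i := by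
    intro i j
    constructor
    · intro h
      have hij : i ≤ j := hX.1 _ h
      refine ⟨hij, ?_⟩
      by_contra hc
      refine Nat.find_spec (hex i) (hX.2 _ h _ (by simp) le_rfl ?_)
      simp only
      omega
    · rintro ⟨h1, h2⟩
      have := Nat.find_min (hex i) (m := j - i) (by omega)
      simpa [Nat.add_sub_cancel' h1] using this
  refine ⟨⟨fun i => Nat.find (hex i), fun i => ?_⟩, ?_⟩
  · by_contra! h
    have h1 : (i + 1, i + Nat.find (hex (i + 1))) ∈ X := (hrow _ _).2 (by omega)
    have h2 := hX.2 _ h1 (i, i + Nat.find (hex (i + 1))) (by simp) (by simp) (by simp)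
    have := ((hrow _ _).1 h2).2
    omega
  · ext ⟨i, j⟩
    exact (hrow i j).symm

theorem contained_of_subset {mu lam : StrictPartition} (h : shiftedShape mu ⊆ shiftedShape lam) :
    mu.Contained lam := by
  intro i
  by_contra! hc
  have := h (show (i, lam.row i + i) ∈ shiftedShape mu from ⟨by simp, by simpa using hc⟩)
  have := this.2
  simp at this

theorem subset_of_contained {mu lam : StrictPartition} (h : mu.Contained lam) :
    shiftedShape mu ⊆ shiftedShape lam := by
  rintro ⟨i, j⟩ ⟨h1, h2⟩
  exact ⟨h1, lt_of_lt_of_le h2 (Nat.add_le_add_right (h i) i)⟩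

/-- If the first and the last set are ideals and no box of the list is northwest of an earlier one,
then all intermediate sets are ideals. -/
theorem grows_of {L : List Box} : ∀ {N : Set Box}, IsIdeal N → L.Nodup → (∀ c ∈ L, c ∉ N) →
    IsIdeal (extend N L) → (L.Pairwise fun c c' => ¬ (c'.1 ≤ c.1 ∧ c'.2 ≤ c.2)) → Grows N L := by
  induction L with
  | nil => intro N hN _ _ _ _; exact hN
  | cons c L ih =>
    intro N hN hnd hdis hex hpw
    rw [List.pairwise_cons] at hpw
    rw [List.nodup_cons] at hnd
    refine ⟨hN, hdis c (by simp), ih ⟨?_, ?_⟩ hnd.2 ?_ ?_ hpw.2⟩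
    · rintro d (rfl | hd)
      · exact hex.1 d (Or.inr (by simp))
      · exact hN.1 d hd
    · rintro d (rfl | hd) e he h1 h2
      · rcases hex.2 d (Or.inr (by simp)) e he h1 h2 with h | h
        · exact Or.inr h
        · rcases List.mem_cons.1 h with rfl | h
          · exact Or.inl rfl
          · exact absurd ⟨h1, h2⟩ (hpw.1 e h)
      · exact Or.inr (hN.2 d hd e he h1 h2)
    · rintro d hd (rfl | hd')
      · exact hnd.1 hd
      · exact hdis d (by simp [hd]) hd'
    · rwa [← extend_cons]

theorem pairwise_or {α : Type*} {S : α → α → Prop} {L : List α} (h : L.Pairwise S) {u v : α}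
    (hu : u ∈ L) (hv : v ∈ L) : u = v ∨ S u v ∨ S v u := by
  induction L with
  | nil => simp at hu
  | cons w L ih =>
    rw [List.pairwise_cons] at h
    rcases List.mem_cons.1 hu with rfl | hu' <;> rcases List.mem_cons.1 hv with rfl | hv'
    · exact Or.inl rfl
    · exact Or.inr (Or.inl (h.1 v hv'))
    · exact Or.inr (Or.inr (h.1 u hu'))
    · exact ih h.2 hu' hv'

/-! ### The standardization order and semistandard tableaux. -/

/-- The entries of a tableau in the order of the standardization. -/
def StdLt (e f : Box × Letter) : Prop :=
  e.2 ≤ f.2 ∧ (e.2 = f.2 → (e.2.primed = true → dg f.1 < dg e.1) ∧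
    (e.2.primed = false → dg e.1 < dg f.1))

theorem Strip.Valid.pairwise_lab {B : Strip} (h : B.Valid) (k : ℕ) :
    (B.lab fun p => (⟨k, p⟩ : Letter)).Pairwise StdLt := by
  unfold Strip.lab
  rw [List.pairwise_append, List.pairwise_map, List.pairwise_map]
  refine ⟨h.desc.imp fun h' => ⟨Or.inr ⟨rfl, Or.inl rfl⟩, fun _ => ⟨fun _ => h', by simp⟩⟩,
    h.asc.imp fun h' => ⟨Or.inr ⟨rfl, Or.inr rfl⟩, fun _ => ⟨by simp, fun _ => h'⟩⟩, ?_⟩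
  intro e he f hf
  obtain ⟨c, -, rfl⟩ := List.mem_map.1 he
  obtain ⟨d, -, rfl⟩ := List.mem_map.1 hf
  exact ⟨Or.inr ⟨rfl, Or.inl rfl⟩, fun h => by simp at h⟩

theorem pairwise_labs {L : List NStrip} (hL : (L.map Prod.fst).Pairwise (· < ·))
    (hv : ∀ e ∈ L, e.2.Valid) : (labs id L).Pairwise StdLt := by
  rw [List.pairwise_map] at hL
  unfold labs
  rw [List.pairwise_flatMap]
  refine ⟨fun e he => (hv e he).pairwise_lab e.1, hL.imp ?_⟩
  intro e f hef u hu v hv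
  obtain ⟨c, u⟩ := u
  obtain ⟨d, v⟩ := v
  rw [mem_lab] at hu hv
  have h1 : u.val = e.1 := by rcases hu with ⟨-, rfl⟩ | ⟨-, rfl⟩ <;> rfl
  have h2 : v.val = f.1 := by rcases hv with ⟨-, rfl⟩ | ⟨-, rfl⟩ <;> rfl
  refine ⟨Or.inl (by simp only; omega), fun h => ?_⟩
  simp only at h
  subst h
  omega

theorem shape_fill (L : List (Box × Letter)) : Filling.shape (fill L) = {c | c ∈ L.map Prod.fst} := by
  ext c
  simp only [Filling.shape, Set.mem_ofPred_eq, ne_eq, fill_eq_none_iff, not_not]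

/-- The filling defined by a growing list of strips is a semistandard tableau. -/
theorem isSSYT_fill {nu mu : StrictPartition} {L : List NStrip}
    (hg : Grows (shiftedShape nu) ((labs id L).map Prod.fst))
    (hmu : shiftedShape mu = extend (shiftedShape nu) ((labs id L).map Prod.fst))
    (hL : (L.map Prod.fst).Pairwise (· < ·)) (hpos : ∀ e ∈ L, 1 ≤ e.1)
    (hv : ∀ e ∈ L, e.2.Valid) :
    IsSSYT (fill (labs id L)) ∧ Filling.shape (fill (labs id L)) = skewShape mu nu ∧
      nu.Contained mu := by
  have hsub : shiftedShape nu ⊆ shiftedShape mu := by rw [hmu]; exact Set.subset_union_left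
  have hshape : Filling.shape (fill (labs id L)) = skewShape mu nu := by
    rw [shape_fill, skewShape, hmu]
    ext c
    constructor
    · exact fun hc => ⟨Or.inr hc, hg.not_mem hc⟩
    · rintro ⟨hc | hc, hc'⟩
      · exact absurd hc hc'
      · exact hc
  have hpw := pairwise_labs hL hv
  have hor : ∀ {c d : Box} {x y : Letter}, fill (labs id L) c = some x →
      fill (labs id L) d = some y → c.1 ≤ d.1 → c.2 ≤ d.2 → c = d ∨ StdLt (c, x) (d, y) := by
    intro c d x y hc hd h1 h2
    rw [fill_eq_some_iff hg.nodup] at hc hd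
    -- Of two boxes in the same row or column, the northwestern one comes first in the chain, hence
    -- also in the standardization order; all tableau conditions follow from this.
    have hpw' := List.pairwise_and_iff.2 ⟨hpw, List.pairwise_map.1 hg.pairwise⟩
    rcases pairwise_or hpw' hc hd with h | h | h
    · exact Or.inl (Prod.ext_iff.1 h).1
    · exact Or.inr h.1
    · exact absurd ⟨h1, h2⟩ h.2
  refine ⟨⟨⟨⟨mu, nu, contained_of_subset hsub, hshape⟩, ?_, ?_, ?_, ?_, ?_⟩, ?_⟩, hshape,
    contained_of_subset hsub⟩
  · intro c x hc
    rw [fill_eq_some_iff hg.nodup] at hc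
    obtain ⟨e, he, ⟨-, rfl⟩ | ⟨-, rfl⟩⟩ := mem_labs.1 hc <;> exact hpos e he
  · intro i j j' x y hj h1 h2
    rcases hor h1 h2 le_rfl hj with h | h
    · obtain rfl : j = j' := by simpa using h
      obtain rfl : x = y := by rw [h1] at h2; simpa using h2
      exact Or.inr ⟨rfl, by cases x.primed <;> simp⟩
    · exact h.1
  · intro i i' j x y hi h1 h2
    rcases hor h1 h2 hi le_rfl with h | h
    · obtain rfl : i = i' := by simpa using h
      obtain rfl : x = y := by rw [h1] at h2; simpa using h2
      exact Or.inr ⟨rfl, by cases x.primed <;> simp⟩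
    · exact h.1
  · intro i i' j k h1 h2
    wlog hi : i ≤ i' generalizing i i'
    · exact (this i' i h2 h1 (by omega)).symm
    rcases hor h1 h2 hi le_rfl with h | h
    · simpa using h
    · have := (h.2 rfl).2 rfl
      unfold dg at this; simp only at this; omega
  · intro i j j' k h1 h2
    wlog hj : j ≤ j' generalizing j j'
    · exact (this j' j h2 h1 (by omega)).symm
    rcases hor h1 h2 le_rfl hj with h | h
    · simpa using h
    · have := (h.2 rfl).1 rfl
      unfold dg at this; simp only at this; omega
  · intro i x hx
    rw [fill_eq_some_iff hg.nodup] at hx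
    obtain ⟨e, he, ⟨hc, rfl⟩ | ⟨-, rfl⟩⟩ := mem_labs.1 hx
    · have := (hv e he).pos _ hc
      simp [dg] at this
    · rfl

theorem letter_le_antisymm {x y : Letter} (h1 : x ≤ y) (h2 : y ≤ x) : x = y := by
  have h1' : x.val < y.val ∨ (x.val = y.val ∧ (x.primed = true ∨ y.primed = false)) := h1
  have h2' : y.val < x.val ∨ (y.val = x.val ∧ (y.primed = true ∨ x.primed = false)) := h2
  ext
  · omega
  · cases hx : x.primed <;> cases hy : y.primed <;> simp_all <;> omega

/-- The boxes with a given letter on their diagonals determine their order. -/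
theorem IsSSYT.corner {T : Filling} (hT : IsSSYT T) {c d : Box} {x y : Letter} (hc : T c = some x)
    (hd : T d = some y) (h1 : c.1 ≤ d.1) (h2 : c.2 ≤ d.2) :
    ∃ z, T (c.1, d.2) = some z ∧ x ≤ z ∧ z ≤ y := by
  obtain ⟨lam, mu, hcon, hsh⟩ := hT.shape_eq
  have hc' : c ∈ T.shape := by simp [Filling.shape, hc]
  have hd' : d ∈ T.shape := by simp [Filling.shape, hd]
  rw [hsh] at hc' hd'
  have hle : c.1 ≤ c.2 := hc'.1.1
  have hmem : (c.1, d.2) ∈ T.shape := by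
    rw [hsh]
    refine ⟨(isIdeal_shiftedShape lam).2 _ hd'.1 _ (hle.trans h2) h1 le_rfl, fun hmu => hc'.2 ?_⟩
    exact (isIdeal_shiftedShape mu).2 _ hmu _ hle le_rfl h2
  obtain ⟨z, hz⟩ := Option.ne_none_iff_exists'.1 hmem
  exact ⟨z, hz, hT.row_weak _ _ _ _ _ h2 hc hz, hT.col_weak _ _ _ _ _ h1 hz hd⟩

/-- If the later box were northwest of the earlier one, the corner between them would force equal
letters. Then the two boxes are in one row (unprimed) or one column (primed), and the order of the
diagonals is contradicted. -/
theorem IsSSYT.stdLt_not_le {T : Filling} (hT : IsSSYT T) {c d : Box} {x y : Letter}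
    (hc : T c = some x) (hd : T d = some y) (h : StdLt (c, x) (d, y)) :
    ¬ (d.1 ≤ c.1 ∧ d.2 ≤ c.2) := by
  rintro ⟨h1, h2⟩
  obtain ⟨z, hz, hyz, hzx⟩ := hT.corner hd hc h1 h2
  have hyx : y ≤ x := by
    have h1' : y.val < z.val ∨ (y.val = z.val ∧ (y.primed = true ∨ z.primed = false)) := hyz
    have h2' : z.val < x.val ∨ (z.val = x.val ∧ (z.primed = true ∨ x.primed = false)) := hzx
    show y.val < x.val ∨ (y.val = x.val ∧ (y.primed = true ∨ x.primed = false))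
    rcases h1' with h1' | ⟨h1', h1''⟩ <;> rcases h2' with h2' | ⟨h2', h2''⟩
    · omega
    · omega
    · omega
    · refine Or.inr ⟨by omega, ?_⟩
      rcases h1'' with h | h
      · exact Or.inl h
      · rcases h2'' with h' | h'
        · simp [h] at h'
        · exact Or.inr h'
  obtain rfl := letter_le_antisymm h.1 hyx
  obtain rfl := letter_le_antisymm hyz hzx
  obtain ⟨k, p⟩ := x
  have := h.2 rfl
  cases p
  · have h3 := hT.col_unprimed _ _ _ _ hz hc
    have := this.2 rfl
    unfold dg at this; simp only at this; omega
  · have h3 := hT.row_primed _ _ _ _ hd hz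
    have := this.1 rfl
    unfold dg at this; simp only at this; omega

/-- Two equal letters on one diagonal would repeat at the corner between them, against the column
rule for unprimed and the row rule for primed letters. -/
theorem IsSSYT.dg_injOn {T : Filling} (hT : IsSSYT T) {c d : Box} {x : Letter}
    (hc : T c = some x) (hd : T d = some x) (h : dg c = dg d) : c = d := by
  wlog h1 : c.1 ≤ d.1 generalizing c d
  · exact (this hd hc h.symm (by omega)).symm
  have h2 : c.2 ≤ d.2 := by unfold dg at h; omega
  obtain ⟨z, hz, hyz, hzx⟩ := hT.corner hc hd h1 h2
  obtain rfl := letter_le_antisymm hyz hzx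
  obtain ⟨k, p⟩ := x
  cases p
  · have h3 := hT.col_unprimed _ _ _ _ hz hd
    unfold dg at h
    exact Prod.ext (by simpa using h3) (by omega)
  · have h3 := hT.row_primed _ _ _ _ hc hz
    unfold dg at h
    exact Prod.ext (by omega) h3

theorem exists_sorted {X : Set Box} (hX : X.Finite) (hinj : ∀ c ∈ X, ∀ d ∈ X, dg c = dg d → c = d) :
    ∃ L : List Box, Asc L ∧ ∀ c, c ∈ L ↔ c ∈ X := by
  classical
  let f := fun c d : Box => decide (dg c ≤ dg d)
  refine ⟨hX.toFinset.toList.mergeSort f, ?_, fun c => by simp⟩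
  have h1 : (hX.toFinset.toList.mergeSort f).Pairwise fun c d => f c d :=
    List.pairwise_mergeSort (fun a b c h1 h2 => by simp [f] at *; omega)
      (fun a b => by simp [f]; omega) _
  have h2 : (hX.toFinset.toList.mergeSort f).Nodup :=
    (List.mergeSort_perm _ _).nodup_iff.2 (Finset.nodup_toList _)
  refine (List.pairwise_and_iff.2 ⟨h1, h2⟩).imp_of_mem ?_
  rintro c d hc hd ⟨h, hne⟩
  simp only [List.mem_mergeSort, Finset.mem_toList, Set.Finite.mem_toFinset] at hc hd
  have : dg c ≤ dg d := by simpa [f] using h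
  exact lt_of_le_of_ne this fun h => hne (hinj c hc d hd h)

theorem IsSSYT.exists_strip {T : Filling} (hT : IsSSYT T) (hfin : T.shape.Finite) (k : ℕ) :
    ∃ B : Strip, B.Valid ∧ (∀ c, c ∈ B.1 ↔ T c = some ⟨k, true⟩) ∧
      ∀ c, c ∈ B.2 ↔ T c = some ⟨k, false⟩ := by
  have hf : ∀ x, {c | T c = some x}.Finite := fun x =>
    hfin.subset fun c hc => by simp only [Set.mem_ofPred_eq] at hc; simp [Filling.shape, hc]
  obtain ⟨D, hD, hD'⟩ := exists_sorted (hf ⟨k, true⟩) fun c hc d hd h => hT.dg_injOn hc hd h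
  obtain ⟨E, hE, hE'⟩ := exists_sorted (hf ⟨k, false⟩) fun c hc d hd h => hT.dg_injOn hc hd h
  have hle : ∀ c x, T c = some x → c.1 ≤ c.2 := by
    intro c x hc
    obtain ⟨lam, mu, -, hsh⟩ := hT.shape_eq
    have hc' : c ∈ T.shape := by simp [Filling.shape, hc]
    rw [hsh] at hc'
    exact hc'.1.1
  refine ⟨(D.reverse, E), ⟨?_, ?_, hE, ?_⟩, fun c => by simp [hD'], fun c => by simp [hE']⟩
  · simpa [Desc, Asc, List.pairwise_reverse] using hD
  · intro c hc
    have hc' : T c = some ⟨k, true⟩ := by simpa [hD'] using hc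
    have h1 := dg_nonneg (hle _ _ hc')
    refine lt_of_le_of_ne h1 fun h0 => ?_
    have h2 : c.1 = c.2 := dg_eq_zero.1 h0.symm
    have : c = (c.1, c.1) := Prod.ext rfl h2.symm
    rw [this] at hc'
    simpa using hT.diag_unprimed _ _ hc'
  · intro c hc
    exact dg_nonneg (hle _ _ ((hE' c).1 hc))

theorem IsSSYT.finite_shape {T : Filling} (hT : IsSSYT T) : T.shape.Finite := by
  obtain ⟨lam, mu, -, hsh⟩ := hT.shape_eq
  rw [hsh]
  exact (finite_shiftedShape lam).subset Set.sdiff_subset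

theorem IsSSYT.finite_entries {T : Filling} (hT : IsSSYT T) :
    {k | ∃ c p, T c = some ⟨k, p⟩}.Finite := by
  refine (hT.finite_shape.image fun c => ((T c).map Letter.val).getD 0).subset ?_
  rintro k ⟨c, p, hc⟩
  exact ⟨c, by simp [Filling.shape, hc], by simp [hc]⟩

/-- A semistandard tableau is given by a growing list of strips. -/
theorem IsSSYT.exists_labs {T : Filling} (hT : IsSSYT T) {mu nu : StrictPartition}
    (hcon : nu.Contained mu) (hsh : T.shape = skewShape mu nu) :
    ∃ L : List NStrip, L.map Prod.fst = (List.range T.maxEntry).map (· + 1) ∧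
      (∀ e ∈ L, e.2.Valid) ∧ Grows (shiftedShape nu) ((labs id L).map Prod.fst) ∧
      shiftedShape mu = extend (shiftedShape nu) ((labs id L).map Prod.fst) ∧
      T = fill (labs id L) := by
  choose B hB hB1 hB2 using hT.exists_strip hT.finite_shape
  -- Every letter up to the largest is listed, possibly with an empty strip, so that the list
  -- matches the schedule.
  let L : List NStrip := (List.range T.maxEntry).map fun k => (k + 1, B (k + 1))
  have hfst : L.map Prod.fst = (List.range T.maxEntry).map (· + 1) := by
    simp [L, Function.comp_def]
  have hv : ∀ e ∈ L, e.2.Valid := by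
    intro e he
    obtain ⟨k, -, rfl⟩ := List.mem_map.1 he
    exact hB _
  have hmem : ∀ c x, (c, x) ∈ labs id L ↔ T c = some x := by
    intro c x
    rw [mem_labs]
    constructor
    · rintro ⟨e, he, h⟩
      obtain ⟨k, -, rfl⟩ := List.mem_map.1 he
      rcases h with ⟨h, rfl⟩ | ⟨h, rfl⟩
      · exact (hB1 _ c).1 h
      · exact (hB2 _ c).1 h
    · intro h
      obtain ⟨k, p⟩ := x
      have hk1 : 1 ≤ k := hT.val_pos _ _ h
      have hk2 : k ≤ T.maxEntry := le_csSup hT.finite_entries.bddAbove ⟨c, p, h⟩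
      refine ⟨(k, B k), List.mem_map.2 ⟨k - 1, List.mem_range.2 (by omega), ?_⟩, ?_⟩
      · rw [Nat.sub_add_cancel hk1]
      · cases p
        · exact Or.inr ⟨(hB2 k c).2 h, rfl⟩
        · exact Or.inl ⟨(hB1 k c).2 h, rfl⟩
  have hpwL : (L.map Prod.fst).Pairwise (· < ·) := by
    rw [hfst, List.pairwise_map]
    exact List.pairwise_lt_range.imp fun h => by omega
  have hpw := pairwise_labs hpwL hv
  have hpw' : ((labs id L).map Prod.fst).Pairwise fun c c' => ¬ (c'.1 ≤ c.1 ∧ c'.2 ≤ c.2) := by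
    rw [List.pairwise_map]
    refine hpw.imp_of_mem ?_
    rintro ⟨c, x⟩ ⟨d, y⟩ hc hd h
    exact hT.stdLt_not_le ((hmem c x).1 hc) ((hmem d y).1 hd) h
  have hmemfst : ∀ c, c ∈ (labs id L).map Prod.fst ↔ c ∈ T.shape := by
    intro c
    rw [List.mem_map]
    constructor
    · rintro ⟨⟨c, x⟩, h, rfl⟩
      simp [Filling.shape, (hmem c x).1 h]
    · intro h
      obtain ⟨x, hx⟩ := Option.ne_none_iff_exists'.1 h
      exact ⟨(c, x), (hmem c x).2 hx, rfl⟩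
  have hext : shiftedShape mu = extend (shiftedShape nu) ((labs id L).map Prod.fst) := by
    ext c
    rw [mem_extend, hmemfst, hsh]
    have := @subset_of_contained _ _ hcon c
    unfold skewShape
    rw [Set.mem_sdiff]
    tauto
  have hg : Grows (shiftedShape nu) ((labs id L).map Prod.fst) := by
    refine grows_of (isIdeal_shiftedShape nu) ?_ ?_ (hext ▸ isIdeal_shiftedShape mu) hpw'
    · exact hpw'.imp fun h h' => h (by subst h'; simp)
    · intro c hc
      rw [hmemfst, hsh] at hc
      exact hc.2
  refine ⟨L, hfst, hv, hg, hext, ?_⟩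
  funext c
  apply Option.ext
  intro x
  rw [fill_eq_some_iff hg.nodup, hmem]


/-! ### The lattice property as the result of a scan -/

/-- The effect of the letters `k'`, `k`, `(k + 1)'`, `k + 1`, coded as `1`, `2`, `3`, `4`, on the
pair (gain of height, needed height) of a word and its hat. -/
def scanStep : ℕ → ℕ × ℕ → ℕ × ℕ
  | 1, s => (s.1 + 1, s.2)
  | 2, s => if s.1 = 0 ∨ s.2 = 0 then (s.1 + 1, s.2) else (s.1, s.2 - 1)
  | 3, s => if s.1 = 0 ∨ s.2 = 0 then (s.1, s.2 + 1) else (s.1 - 1, s.2)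
  | 4, s => (s.1, s.2 + 1)
  | _, s => s

/-- Columns run from left to right, the reverse of the reading order: the pair for a word is built
up by putting letters in front. -/
def scan (g : ℕ → ℕ) : ℕ → ℕ × ℕ → ℕ × ℕ
  | 0, s => s
  | n + 1, s => scanStep (g n) (scan g n s)

/-- The rows `a + m - 1, …, a`. -/
def scanRows (f : ℕ → ℕ → ℕ) (n a : ℕ) : ℕ → ℕ × ℕ → ℕ × ℕ
  | 0, s => s
  | m + 1, s => scanRows f n a m (scan (f (a + m)) n s)

section scan
variable {g g' : ℕ → ℕ} {f f' : ℕ → ℕ → ℕ} {n m p x y : ℕ} {s : ℕ × ℕ}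

theorem scanStep_zero : scanStep 0 s = s := rfl
theorem scanStep_one : scanStep 1 (x, y) = (x + 1, y) := rfl
theorem scanStep_four : scanStep 4 (x, y) = (x, y + 1) := rfl

theorem scanStep_two : scanStep 2 (x, y) =
    if x = 0 ∨ y = 0 then (x + 1, y) else (x, y - 1) := rfl

theorem scanStep_three : scanStep 3 (x, y) =
    if x = 0 ∨ y = 0 then (x, y + 1) else (x - 1, y) := rfl

theorem scan_congr (h : ∀ j < n, g j = g' j) : scan g n s = scan g' n s := by
  induction n with
  | zero => rfl
  | succ n ih => rw [scan, scan, ih fun j hj => h j (by omega), h n (by omega)]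

theorem scan_add : scan g (m + p) s = scan (fun j => g (m + j)) p (scan g m s) := by
  induction p with
  | zero => rfl
  | succ p ih => rw [← Nat.add_assoc, scan, ih, scan]

theorem scan_of_zero (h : ∀ j < n, g j = 0) : scan g n s = s := by
  induction n with
  | zero => rfl
  | succ n ih => rw [scan, ih fun j hj => h j (by omega), h n (by omega), scanStep_zero]

theorem scan_one_add : scan g (1 + p) s = scan (fun j => g (1 + j)) p (scanStep (g 0) s) :=
  scan_add

theorem scanRows_congr (h : ∀ r, ∀ j < n, f r j = f' r j) {a : ℕ} :
    scanRows f n a m s = scanRows f' n a m s := by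
  induction m generalizing s with
  | zero => rfl
  | succ m ih => rw [scanRows, scanRows, ih, scan_congr (h (a + m))]

theorem scanRows_congr_of_mem {a : ℕ} (h : ∀ r, a ≤ r → ∀ j < n, f r j = f' r j) :
    scanRows f n a m s = scanRows f' n a m s := by
  induction m generalizing s with
  | zero => rfl
  | succ m ih => rw [scanRows, scanRows, ih, scan_congr (h (a + m) (by omega))]

theorem scanRows_congr_lt {a : ℕ} (h : ∀ r < a + m, ∀ j < n, f r j = f' r j) :
    scanRows f n a m s = scanRows f' n a m s := by
  induction m generalizing s with
  | zero => rfl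
  | succ m ih =>
    rw [scanRows, scanRows, ih fun r hr => h r (by omega), scan_congr (h (a + m) (by omega))]

theorem scanRows_add {a : ℕ} :
    scanRows f n a (m + p) s = scanRows f n a m (scanRows f n (a + m) p s) := by
  induction p generalizing s with
  | zero => rfl
  | succ p ih => rw [← Nat.add_assoc, scanRows, ih, scanRows, Nat.add_assoc]

/-- Equality of the scans of two fillings that differ only in the rows `i` and `i + 1`. -/
theorem scanRows_eq_of_two {i : ℕ} (hi : i + 1 < n)
    (h : ∀ r, r ≠ i → r ≠ i + 1 → ∀ j < n, f r j = f' r j)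
    (h2 : ∀ s, s = scanRows f n (i + 2) (n - (i + 2)) (0, 0) →
      scan (f i) n (scan (f (i + 1)) n s) = scan (f' i) n (scan (f' (i + 1)) n s)) :
    scanRows f n 0 n (0, 0) = scanRows f' n 0 n (0, 0) := by
  have key : ∀ f : ℕ → ℕ → ℕ, scanRows f n 0 n (0, 0) = scanRows f n 0 i
      (scan (f i) n (scan (f (i + 1)) n (scanRows f n (i + 2) (n - (i + 2)) (0, 0)))) := by
    intro f
    conv_lhs => rw [show scanRows f n 0 n (0, 0) = scanRows f n 0 (i + (2 + (n - (i + 2)))) (0, 0)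
      by congr 1; omega]
    rw [scanRows_add, scanRows_add]
    simp [scanRows]
  rw [key f, key f', h2 _ rfl,
    scanRows_congr_of_mem (a := i + 2) (f := f) (f' := f')
      fun r hr => h r (by omega) (by omega),
    scanRows_congr_lt (a := 0) (m := i) (f := f) (f' := f') fun r hr => h r (by omega) (by omega)]

theorem scanRows_eq_of_one {i : ℕ} (hi : i < n)
    (h : ∀ r, r ≠ i → ∀ j < n, f r j = f' r j)
    (h2 : ∀ s, s = scanRows f n (i + 1) (n - (i + 1)) (0, 0) →
      scan (f i) n s = scan (f' i) n s) :
    scanRows f n 0 n (0, 0) = scanRows f' n 0 n (0, 0) := by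
  have key : ∀ f : ℕ → ℕ → ℕ, scanRows f n 0 n (0, 0) = scanRows f n 0 i
      (scan (f i) n (scanRows f n (i + 1) (n - (i + 1)) (0, 0))) := by
    intro f
    conv_lhs => rw [show scanRows f n 0 n (0, 0) = scanRows f n 0 (i + (1 + (n - (i + 1)))) (0, 0)
      by congr 1; omega]
    rw [scanRows_add, scanRows_add]
    simp [scanRows]
  rw [key f, key f', h2 _ rfl,
    scanRows_congr_of_mem (a := i + 1) (f := f) (f' := f') fun r hr => h r (by omega),
    scanRows_congr_lt (a := 0) (m := i) (f := f) (f' := f') fun r hr => h r (by omega)]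

theorem scan_fst_zero (h : ∀ j < n, g j ≠ 1 ∧ g j ≠ 2) (hs : s.1 = 0) : (scan g n s).1 = 0 := by
  induction n with
  | zero => exact hs
  | succ n ih =>
    have ih := ih fun j hj => h j (by omega)
    have hn := h n (by omega)
    rw [scan]
    generalize scan g n s = t at ih
    obtain ⟨x, y⟩ := t
    simp only at ih
    subst ih
    unfold scanStep
    split <;> simp_all

theorem scanRows_fst_zero {a : ℕ} (h : ∀ r, a ≤ r → ∀ j < n, f r j ≠ 1 ∧ f r j ≠ 2)
    (hs : s.1 = 0) : (scanRows f n a m s).1 = 0 := by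
  induction m generalizing s with
  | zero => exact hs
  | succ m ih => exact ih (scan_fst_zero (h _ (by omega)) hs)

theorem scanRows_of_zero {a : ℕ} (h : ∀ r, a ≤ r → ∀ j < n, f r j = 0) :
    scanRows f n a m s = s := by
  induction m generalizing s with
  | zero => rfl
  | succ m ih => rw [scanRows, scan_of_zero (h _ (by omega)), ih]

/-! ### Two adjacent rows: states that become equal in the upper row. -/

/-- A row `(k + 1)' (k + 1) ⋯ (k + 1)` or `(k + 1) ⋯ (k + 1)` of length `m`. -/
structure SecondRow (u : ℕ → ℕ) (m : ℕ) : Prop where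
  zero : ∀ j, m ≤ j → u j = 0
  head : 0 < m → u 0 = 3 ∨ u 0 = 4
  tail : ∀ j, j < m → j ≠ 0 → u j = 4

/-- A row whose first `m` entries are `k ⋯ k k` or `k ⋯ k (k + 1)'`. -/
structure FirstRow (v : ℕ → ℕ) (m : ℕ) : Prop where
  mid : ∀ j, j + 1 < m → v j = 2
  last : ∀ j, j + 1 = m → v j = 2 ∨ v j = 3

theorem SecondRow.scan {u : ℕ → ℕ} (h : SecondRow u m) (hm : m ≤ p) : ShiftedTableau.scan u p s =
    if m = 0 then s else ((scanStep (u 0) s).1, (scanStep (u 0) s).2 + (m - 1)) := by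
  have h1 : ShiftedTableau.scan u p s = ShiftedTableau.scan u m s := by
    obtain ⟨d, rfl⟩ := Nat.exists_eq_add_of_le hm
    rw [scan_add, scan_of_zero fun j _ => h.zero _ (by omega)]
  rw [h1]
  clear h1 hm
  have : ∀ q, q ≤ m → ShiftedTableau.scan u q s =
    if q = 0 then s else ((scanStep (u 0) s).1, (scanStep (u 0) s).2 + (q - 1)) := by
    intro q
    induction q with
    | zero => intro _; rfl
    | succ q ih =>
      intro hq
      rw [ShiftedTableau.scan, ih (by omega)]
      by_cases h0 : q = 0
      · subst h0; simp
      · rw [if_neg h0, h.tail q (by omega) h0, scanStep_four, if_neg (by omega)]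
        congr 1
        omega
  exact this m le_rfl

/-- Two states that are merged by the row above a row `2 ⋯ 2`. -/
theorem FirstRow.merge (hx : 0 < x) :
    ∀ {m p : ℕ} {v : ℕ → ℕ}, FirstRow v (m + 1) → m + 1 ≤ p →
      ShiftedTableau.scan v p (x + 1, m + 1) = ShiftedTableau.scan v p (x, m) := by
  intro m
  induction m with
  | zero =>
    intro p v h hp
    obtain ⟨d, rfl⟩ := Nat.exists_eq_add_of_le hp
    rw [Nat.zero_add, scan_one_add, scan_one_add]
    rcases h.last 0 (by omega) with h' | h'
    · rw [h', scanStep_two, scanStep_two, if_neg (by omega), if_pos (by omega)]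
    · rw [h', scanStep_three, scanStep_three, if_neg (by omega), if_pos (by omega)]
      rfl
  | succ m ih =>
    intro p v h hp
    obtain ⟨d, rfl⟩ := Nat.exists_eq_add_of_le (show 1 ≤ p by omega)
    rw [scan_one_add, scan_one_add, h.mid 0 (by omega), scanStep_two, scanStep_two,
      if_neg (by omega), if_neg (by omega)]
    exact ih (p := d) ⟨fun j hj => h.mid _ (by omega), fun j hj => h.last _ (by omega)⟩ (by omega)

/-- A single letter `k` or `(k + 1)'` already merges the states: on `(0, y)` it acts by adding to
the gain or to the need, on `(1, y + 1)` by cancelling. -/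
theorem FirstRow.merge_zero {v : ℕ → ℕ} (h : FirstRow v m) (hm : 0 < m) (hp : m ≤ p) :
    ShiftedTableau.scan v p (1, y + 1) = ShiftedTableau.scan v p (0, y) := by
  obtain ⟨d, rfl⟩ := Nat.exists_eq_add_of_le (show 1 ≤ p by omega)
  rw [scan_one_add, scan_one_add]
  have : v 0 = 2 ∨ v 0 = 3 := by
    by_cases h1 : m = 1
    · exact h.last 0 (by omega)
    · exact Or.inl (h.mid 0 (by omega))
  rcases this with h' | h' <;> rw [h']
  · simp [scanStep_two]
  · simp [scanStep_three]

theorem FirstRow.merge' {v : ℕ → ℕ} (h : FirstRow v m) (hp : m ≤ p) (hm : 0 < m) (hx : 0 < x) :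
    ShiftedTableau.scan v p (x + 1, m) = ShiftedTableau.scan v p (x, m - 1) := by
  obtain ⟨m, rfl⟩ := Nat.exists_eq_succ_of_ne_zero hm.ne'
  exact FirstRow.merge hx h hp

/-- A letter `k'` moves up. -/
theorem slide_one {u v : ℕ → ℕ} (hu : SecondRow u m) (hv : FirstRow v m) (hp : m ≤ p) :
    scan v p (scan u p (scanStep 1 s)) = scan v p (scanStep 1 (scan u p s)) := by
  obtain ⟨x, y⟩ := s
  rw [hu.scan hp, hu.scan hp]
  by_cases hm : m = 0
  · simp [hm]
  rw [if_neg hm, if_neg hm]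
  rcases hu.head (by omega) with h | h
  · rw [h]
    -- The two orders can differ only when `k'` makes the gain positive just before `(k + 1)'` is
    -- read; the resulting states `(1, y + 1)` and `(0, y)` are merged in the upper row.
    by_cases h0 : y = 0
    · simp [scanStep_one, scanStep_three, h0]
    · by_cases hx : x = 0
      · subst hx
        simp only [scanStep_one, scanStep_three, h0, or_false, Nat.zero_add, one_ne_zero, if_false,
          if_true]
        rw [show y + 1 + (m - 1) = (y + (m - 1)) + 1 by omega]
        exact (hv.merge_zero (by omega) hp).symm
      · simp only [scanStep_one, scanStep_three, h0, hx, or_false, if_false, Nat.add_eq_zero_iff,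
          one_ne_zero, and_false]
        congr 2
        omega
  · rw [h]
    simp [scanStep_one, scanStep_four]

/-- A letter `k` moves up, with no letter to the left of its new place. -/
theorem slide_two {u v : ℕ → ℕ} (hu : SecondRow u m) (hv : FirstRow v m) (hp : m ≤ p) :
    scan v p (scan u p (scanStep 2 s)) = scan v p (scanStep 2 (scan u p s)) := by
  obtain ⟨x, y⟩ := s
  rw [hu.scan hp, hu.scan hp]
  by_cases hm : m = 0
  · simp [hm]
  rw [if_neg hm, if_neg hm]
  rcases hu.head (by omega) with h | h <;> rw [h]
  · rcases Nat.eq_zero_or_pos x with rfl | hx <;> rcases Nat.eq_zero_or_pos y with rfl | hy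
    · simp [scanStep_two, scanStep_three]
    · simp only [scanStep_two, scanStep_three, true_or, if_true, Nat.zero_add, one_ne_zero,
        hy.ne', or_self, if_false, Nat.sub_self]
      rw [show y + 1 + (m - 1) = (y + (m - 1)) + 1 by omega]
      exact (hv.merge_zero (by omega) hp).symm
    · have := hv.merge' hp (by omega) hx
      simp only [scanStep_two, scanStep_three, or_true, if_true, hx.ne', false_or]
      rw [show 0 + 1 + (m - 1) = m by omega, if_neg (by omega)]
      exact this
    · simp only [scanStep_two, scanStep_three, hx.ne', hy.ne', or_self, if_false, false_or]
      rcases Nat.eq_or_lt_of_le (show 1 ≤ y from hy) with rfl | hy1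
      · rcases Nat.eq_or_lt_of_le (show 1 ≤ x from hx) with rfl | hx1
        · simp
        · rw [if_pos (by omega), if_neg (by simp; omega)]
          have := hv.merge' hp (by omega) (x := x - 1) (by omega)
          rw [show x - 1 + 1 = x by omega] at this
          simp only
          rw [show 1 - 1 + 1 + (m - 1) = m by omega, this]
      · rcases Nat.eq_or_lt_of_le (show 1 ≤ x from hx) with rfl | hx1
        · rw [if_neg (by omega), if_pos (by simp)]
          simp only [Nat.sub_self, Nat.zero_add]
          rw [show y + (m - 1) = (y - 1 + (m - 1)) + 1 by omega]
          exact (hv.merge_zero (by omega) hp).symm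
        · rw [if_neg (by omega), if_neg (by simp; omega)]
          congr 2
          simp only
          omega
  · rcases Nat.eq_zero_or_pos x with rfl | hx
    · simp [scanStep_two, scanStep_four]
    · rcases Nat.eq_zero_or_pos y with rfl | hy
      · have := hv.merge' hp (by omega) hx
        simp only [scanStep_two, scanStep_four, or_true, if_true, hx.ne', false_or]
        rw [show 0 + 1 + (m - 1) = m by omega, if_neg (by omega)]
        exact this
      · simp only [scanStep_two, scanStep_four, hx.ne', hy.ne', or_self, if_false, false_or]
        rw [if_neg (by omega)]
        congr 2
        omega

/-- A letter `k` moves up, with a letter `k'` to the left of its new place. -/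
theorem slide_two' {u v : ℕ → ℕ} (hu : SecondRow u m) (hv : FirstRow v m) (hp : m ≤ p)
    (hs : 0 < s.1) :
    scan v p (scanStep 1 (scan u p (scanStep 2 s))) =
      scan v p (scanStep 2 (scanStep 1 (scan u p s))) := by
  obtain ⟨x, y⟩ := s
  simp only at hs
  rw [hu.scan hp, hu.scan hp]
  by_cases hm : m = 0
  · rw [if_pos hm, if_pos hm]
    rcases Nat.eq_zero_or_pos y with rfl | hy
    · simp [scanStep_one, scanStep_two]
    · simp [scanStep_one, scanStep_two, hs.ne', hy.ne']
  rw [if_neg hm, if_neg hm]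
  rcases hu.head (by omega) with h | h <;> rw [h]
  · rcases Nat.eq_zero_or_pos y with rfl | hy
    · simp only [scanStep_one, scanStep_two, scanStep_three, or_true, if_true, Nat.zero_add]
      rw [if_neg (by omega), show 1 + (m - 1) = m by omega]
      exact hv.merge' hp (by omega) (by omega)
    · simp only [scanStep_one, scanStep_two, scanStep_three, hs.ne', hy.ne', or_self, if_false,
        false_or]
      rw [if_neg (c := x - 1 + 1 = 0 ∨ y + (m - 1) = 0) (by omega)]
      rcases Nat.eq_or_lt_of_le (show 1 ≤ y from hy) with rfl | hy1
      · rw [if_pos (by omega)]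
        simp only
        rw [show 1 - 1 + 1 + (m - 1) = m by omega, show x - 1 + 1 = x by omega]
        exact hv.merge' hp (by omega) hs
      · rw [if_neg (by omega)]
        congr 2
        simp only
        omega
  · rcases Nat.eq_zero_or_pos y with rfl | hy
    · simp only [scanStep_one, scanStep_two, scanStep_four, or_true, if_true, Nat.zero_add]
      rw [if_neg (by omega), show 1 + (m - 1) = m by omega]
      exact hv.merge' hp (by omega) (by omega)
    · simp only [scanStep_one, scanStep_two, scanStep_four, hs.ne', hy.ne', or_self, if_false]
      rw [if_neg (by omega)]
      congr 2
      omega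

/-- A letter `k + 1` commutes with the letters to the left of its new place. -/
theorem scan_four {v : ℕ → ℕ}
    (h : ∀ j < m, v j = 0 ∨ v j = 1 ∨ ((v j = 2 ∨ v j = 3) ∧
      ((scan v j s).1 = 0 ∨ (scan v j s).2 ≠ 0))) :
    scan v m (scanStep 4 s) = scanStep 4 (scan v m s) := by
  induction m with
  | zero => rfl
  | succ m ih =>
    rw [scan, scan, ih fun j hj => h j (by omega)]
    have hm := h m (by omega)
    generalize scan v m s = t at hm
    obtain ⟨x, y⟩ := t
    rcases hm with hm | hm | ⟨hm | hm, hxy⟩ <;> rw [hm]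
    · rfl
    · rfl
    · simp only at hxy
      by_cases hx : x = 0
      · simp [scanStep_two, scanStep_four, hx]
      · have hy : y ≠ 0 := by omega
        simp only [scanStep_two, scanStep_four, hx, hy, or_self, if_false, Nat.add_eq_zero_iff,
          one_ne_zero, and_false]
        congr 1
        omega
    · simp only at hxy
      by_cases hx : x = 0
      · simp [scanStep_three, scanStep_four, hx]
      · have hy : y ≠ 0 := by omega
        simp [scanStep_three, scanStep_four, hx, hy]

/-- The need drops by at most one per letter, and only at a letter `k`. -/
theorem scanStep_snd_le (a : ℕ) : s.2 ≤ (scanStep a s).2 + 1 ∧ (a ≠ 2 → s.2 ≤ (scanStep a s).2) := by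
  obtain ⟨x, y⟩ := s
  unfold scanStep
  split <;> (try split_ifs) <;> simp <;> omega

end scan

/-! ### A letter moves to the hole north of it -/

/-- The letter `u` in the box `(a, b)` comes before the letter `v` in the box `(a', b')`. -/
def StdOrd (u a b v a' b' : ℕ) : Prop :=
  u ≤ v ∧ (u = v → ((u = 1 ∨ u = 3) → b' + a < b + a') ∧ ((u = 2 ∨ u = 4) → b + a' < b' + a))

/-- A filling with coded letters and a hole `(i, c)` above a letter. -/
structure Slide (f : ℕ → ℕ → ℕ) (i c n : ℕ) : Prop where
  hole : f i c = 0
  south : f (i + 1) c ≠ 0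
  le_four : ∀ a b, f a b ≤ 4
  le : ∀ a b, f a b ≠ 0 → a ≤ b
  bound : ∀ a b, f a b ≠ 0 → b < n
  diag : ∀ a b, f a b = 1 ∨ f a b = 3 → a < b
  lt : ∀ a b a' b', f a b ≠ 0 → f a' b' ≠ 0 → a ≤ a' → b ≤ b' → a < a' ∨ b < b' →
    StdOrd (f a b) a b (f a' b') a' b'
  after : ∀ a b, f a b ≠ 0 → i ≤ a → c ≤ b → (a = i ∨ c < b) →
    StdOrd (f (i + 1) c) (i + 1) c (f a b) a b
  before : ∀ a b, f a b ≠ 0 → a ≤ i → b ≤ c → StdOrd (f a b) a b (f (i + 1) c) (i + 1) c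
  convex : ∀ a b a' b' g h, f a b ≠ 0 ∨ (a = i ∧ b = c) → f a' b' ≠ 0 ∨ (a' = i ∧ b' = c) →
    a ≤ g → g ≤ a' → b ≤ h → h ≤ b' → g ≤ h → f g h ≠ 0 ∨ (g = i ∧ h = c)

namespace Slide
variable {f f' : ℕ → ℕ → ℕ} {i c n : ℕ}

theorem row (h : Slide f i c n) {a b b' : ℕ} (h1 : f a b ≠ 0) (h2 : f a b' ≠ 0) (hb : b < b') :
    f a b ≤ f a b' ∧ (f a b = f a b' → f a b ≠ 1 ∧ f a b ≠ 3) := by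
  have := h.lt a b a b' h1 h2 le_rfl hb.le (Or.inr hb)
  unfold StdOrd at this
  omega

theorem col (h : Slide f i c n) {a a' b : ℕ} (h1 : f a b ≠ 0) (h2 : f a' b ≠ 0) (ha : a < a') :
    f a b ≤ f a' b ∧ (f a b = f a' b → f a b ≠ 2 ∧ f a b ≠ 4) := by
  have := h.lt a b a' b h1 h2 ha.le le_rfl (Or.inl ha)
  unfold StdOrd at this
  omega

theorem succ_le (h : Slide f i c n) : i + 1 ≤ c := h.le _ _ h.south

theorem lt_n (h : Slide f i c n) : c < n := h.bound _ _ h.south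

/-- The letter above a letter to the east of the moving letter. -/
theorem above (h : Slide f i c n) {j : ℕ} (hj : c < j) (h1 : f (i + 1) j ≠ 0) :
    f i j ≠ 0 ∧ f i j ≤ f (i + 1) j ∧ (f i j = f (i + 1) j → f i j ≠ 2 ∧ f i j ≠ 4) ∧
      f (i + 1) c ≤ f i j ∧ (f (i + 1) c = f i j → f i j ≠ 1 ∧ f i j ≠ 3) := by
  have hs := h.succ_le
  have h0 : f i j ≠ 0 := by
    rcases h.convex i c (i + 1) j i j (Or.inr ⟨rfl, rfl⟩) (Or.inl h1) le_rfl (by omega) hj.le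
      le_rfl (by omega) with h' | h'
    · exact h'
    · omega
  have h2 := h.col h0 h1 (by omega)
  have h3 := h.after i j h0 le_rfl hj.le (Or.inl rfl)
  unfold StdOrd at h3
  omega

/-- East of a moving `k'` or `k`, the lower row contains only `(k + 1)'` and `k + 1`, and the
letters above these lie between the moving letter and the letter below, hence are `k` or `(k + 1)'`.
Row strictness of primed letters fixes the pattern. -/
theorem rows (h : Slide f i c n) (ht : f (i + 1) c = 1 ∨ f (i + 1) c = 2) {p : ℕ}
    (hp : n = c + 1 + p) :
    ∃ m ≤ p, SecondRow (fun j => f (i + 1) (c + 1 + j)) m ∧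
      FirstRow (fun j => f i (c + 1 + j)) m := by
  classical
  have hs := h.succ_le
  have hlast : f (i + 1) (c + 1 + p) = 0 := by
    by_contra h0
    have := h.bound _ _ h0
    omega
  have hex : ∃ j, f (i + 1) (c + 1 + j) = 0 := ⟨p, hlast⟩
  have hU : ∀ j, f (i + 1) (c + 1 + j) ≠ 0 →
      (f (i + 1) (c + 1 + j) = 3 ∨ f (i + 1) (c + 1 + j) = 4) ∧
      (f i (c + 1 + j) = 2 ∨ f i (c + 1 + j) = 3) := by
    intro j hj
    have h1 := h.above (by omega) hj
    have h2 := h.row h.south hj (by omega)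
    have h3 := h.le_four (i + 1) (c + 1 + j)
    omega
  have hmin : ∀ j, j < Nat.find hex → f (i + 1) (c + 1 + j) ≠ 0 := fun j hj => Nat.find_min hex hj
  refine ⟨Nat.find hex, Nat.find_min' hex hlast, ⟨fun j hj => ?_, fun h0 => (hU 0 (hmin 0 h0)).1,
    fun j hj hj0 => ?_⟩, fun j hj => ?_, fun j hj => (hU j (hmin j (by omega))).2⟩
  · by_contra h0
    rcases h.convex (i + 1) c (i + 1) (c + 1 + j) (i + 1) (c + 1 + Nat.find hex) (Or.inl h.south)
      (Or.inl h0) le_rfl le_rfl (by omega) (by omega) (by omega) with h' | h'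
    · exact h' (Nat.find_spec hex)
    · omega
  · have h1 := hU j (hmin j hj)
    have h2 := hU 0 (hmin 0 (by omega))
    have h3 := h.row (hmin 0 (by omega)) (hmin j hj) (by omega)
    show f (i + 1) (c + 1 + j) = 4
    omega
  · have h1 := hU j (hmin j (by omega))
    have h2 := hU (j + 1) (hmin (j + 1) hj)
    have h3 := h.row (a := i) (b := c + 1 + j) (b' := c + 1 + (j + 1)) (by omega) (by omega)
      (by omega)
    show f i (c + 1 + j) = 2
    omega

/-- The letters to the west of the hole. -/
theorem west (h : Slide f i c n) (ht : f (i + 1) c = 2 ∨ f (i + 1) c = 3) :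
    (∀ j < c, f i j = 0) ∨ ∃ d, c = d + 1 ∧ f i d = 1 ∧ (∀ j < d, f i j = 0) ∧
      (f (i + 1) d = 1 ∨ f (i + 1) d = 2) := by
  by_cases h0 : ∀ j < c, f i j = 0
  · exact Or.inl h0
  push Not at h0
  obtain ⟨j, hj, hj0⟩ := h0
  obtain ⟨d, rfl⟩ : ∃ d, c = d + 1 := ⟨c - 1, by omega⟩
  have hij := h.le _ _ hj0
  have hd0 : f i d ≠ 0 := by
    rcases h.convex i j i (d + 1) i d (Or.inl hj0) (Or.inr ⟨rfl, rfl⟩) le_rfl le_rfl (by omega)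
      (by omega) (by omega) with h' | h'
    · exact h'
    · omega
  have hb := h.before i d hd0 le_rfl (by omega)
  unfold StdOrd at hb
  have hbelow : i + 1 ≤ d → f (i + 1) d ≠ 0 := by
    intro hid
    rcases h.convex i d (i + 1) (d + 1) (i + 1) d (Or.inl hd0) (Or.inl h.south) (by omega) le_rfl
      le_rfl (by omega) hid with h' | h'
    · exact h'
    · omega
  have hdiag := h.diag i d
  have hdiag' := h.diag (i + 1) (d + 1)
  have h1 : f i d = 1 := by
    by_cases hid : i + 1 ≤ d
    · have h3 := h.col hd0 (hbelow hid) (by omega)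
      have h4 := h.row (hbelow hid) h.south (by omega)
      omega
    · omega
  have hid : i + 1 ≤ d := hdiag (Or.inl h1)
  refine Or.inr ⟨d, rfl, h1, fun k hk => ?_, ?_⟩
  · by_contra hk0
    have := h.row hk0 hd0 hk
    omega
  · have h4 := h.row (hbelow hid) h.south (by omega)
    have h5 := hbelow hid
    omega

/-- Right after `k'` or `k` has been scanned the gain is positive: `k'` raises it, and `k` raises it
unless it was positive already. -/
theorem pos_of_west {d : ℕ} {s : ℕ × ℕ} (h : f (i + 1) d = 1 ∨ f (i + 1) d = 2) :
    0 < (scan (f (i + 1)) (d + 1) s).1 := by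
  rw [scan]
  generalize scan (f (i + 1)) d s = t
  obtain ⟨x, y⟩ := t
  rcases h with h | h <;> rw [h]
  · simp [scanStep_one]
  · rw [scanStep_two]
    split_ifs
    · simp
    · simp only; omega

theorem east_zero (h : Slide f i c n) (ht : f (i + 1) c = 3 ∨ f (i + 1) c = 4) {j : ℕ}
    (hj : c < j) : f (i + 1) j = 0 := by
  by_contra h0
  have h1 := h.above hj h0
  have h2 := h.row h.south h0 hj
  have h3 := h.le_four (i + 1) j
  omega

/-- The scan of the two rows if the letter is `k + 1`. -/
theorem scan_of_four (h : Slide f i c n) (ht : f (i + 1) c = 4) {s : ℕ × ℕ}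
    (hs : (∀ r, i + 2 ≤ r → ∀ j, f r j = 0) → s = (0, 0)) :
    scan (f i) c (scanStep 4 (scan (f (i + 1)) c s)) =
      scanStep 4 (scan (f i) c (scan (f (i + 1)) c s)) := by
  classical
  have hsl := h.succ_le
  have hprev : ∀ j < c, f i j ≠ 0 → ∀ j', j ≤ j' → j' < c → f i j' ≠ 0 := by
    intro j hj hj0 j' hj' hjc
    have := h.le _ _ hj0
    rcases h.convex i j i c i j' (Or.inl hj0) (Or.inr ⟨rfl, rfl⟩) le_rfl le_rfl hj' hjc.le
      (by omega) with h' | h'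
    · exact h'
    · omega
  have hne4 : ∀ j < c, f i j ≠ 4 := by
    intro j hj h4
    have h1 := hprev j hj (by omega) (c - 1) (by omega) (by omega)
    have h2 := h.before i (c - 1) h1 le_rfl (by omega)
    unfold StdOrd at h2
    rcases Nat.eq_or_lt_of_le (show j ≤ c - 1 by omega) with hjc | hjc
    · rw [← hjc] at h2; omega
    · have := h.row (by omega) h1 hjc
      omega
  by_cases hex : ∃ j, j < c ∧ (f i j = 2 ∨ f i j = 3)
  swap
  · push Not at hex
    refine scan_four fun j hj => ?_
    have := hex j hj
    have := hne4 j hj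
    have := h.le_four i j
    omega
  -- Let `e` be the first column of the upper row containing `k` or `(k + 1)'`. From `e` to `c` the
  -- upper row consists of such letters, and the places below hold `(k + 1)'` or `k + 1`.
  obtain ⟨e, ⟨hec, he⟩, hmin⟩ : ∃ e, (e < c ∧ (f i e = 2 ∨ f i e = 3)) ∧
      ∀ j < e, ¬ (j < c ∧ (f i j = 2 ∨ f i j = 3)) :=
    ⟨Nat.find hex, Nat.find_spec hex, fun j hj => Nat.find_min hex hj⟩
  have hie := h.le i e (by omega)
  have hlt : ∀ j < e, f i j = 0 ∨ f i j = 1 := by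
    intro j hj
    have := hmin j hj
    have := hne4 j (by omega)
    have := h.le_four i j
    omega
  have hge : ∀ j, e ≤ j → j < c → f i j = 2 ∨ f i j = 3 := by
    intro j hj hjc
    have h1 := hprev e hec (by omega) j hj hjc
    have := hne4 j hjc
    have := h.le_four i j
    rcases Nat.eq_or_lt_of_le hj with rfl | hj
    · exact he
    · have := h.row (by omega) h1 hj
      omega
  have hbelow : ∀ j, e ≤ j → j < c → i + 1 ≤ j → f (i + 1) j = 3 ∨ f (i + 1) j = 4 := by
    intro j hj hjc hij
    have h1 := hge j hj hjc
    have h2 : f (i + 1) j ≠ 0 := by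
      rcases h.convex i j (i + 1) c (i + 1) j (Or.inl (by omega)) (Or.inl h.south) (by omega) le_rfl
        le_rfl hjc.le hij with h' | h'
      · exact h'
      · omega
    have h3 := h.col (by omega) h2 (show i < i + 1 by omega)
    have := h.le_four (i + 1) j
    omega
  -- `y` does not decrease before the column `e` and decreases slowly afterwards
  have hdec : ∀ q t, ∀ j, e ≤ j → j ≤ c → (q = e ∨ (q = e + 1 ∧ e + 1 ≤ j)) →
      c - q ≤ (scan (f i) q t).2 → q ≤ j → c - j ≤ (scan (f i) j t).2 := by
    intro q t j
    induction j with
    | zero => intro _ _ hq h1 h2; obtain rfl : q = 0 := by omega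
              exact h1
    | succ j ih =>
      intro h1 h2 hq h3 h4
      rcases Nat.eq_or_lt_of_le h4 with rfl | h4
      · exact h3
      · have := ih (by omega) (by omega) (by omega) h3 (by omega)
        have := (scanStep_snd_le (s := scan (f i) j t) (f i j)).1
        rw [scan]
        omega
  have hconst : ∀ t, ∀ j ≤ e, (scan (f i) j t).2 = t.2 := by
    intro t j
    induction j with
    | zero => intro _; rfl
    | succ j ih =>
      intro hj
      rw [scan, ← ih (by omega)]
      rcases hlt j (by omega) with h' | h' <;> rw [h'] <;> rfl
  -- Commuting `k + 1` past these letters requires a positive need or zero gain. Usually the lower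
  -- row has built up a need of at least `c - e`, which decreases by at most one per column. If
  -- column `e` is on the main diagonal, there is no letter below it and one unit is missing; this
  -- case is separate.
  rcases Nat.eq_or_lt_of_le hie with rfl | hie
  · -- the row `i` begins with `k` on the main diagonal
    have hu : ∀ j, i + 1 ≤ j → j ≤ c → f (i + 1) j = 4 := by
      have h0 : f (i + 1) (i + 1) = 4 := by
        rcases Nat.eq_or_lt_of_le hsl with h' | h'
        · exact (congrArg (f (i + 1)) h').trans ht
        · have h1 := hbelow (i + 1) (by omega) h' le_rfl
          have h2 := h.diag (i + 1) (i + 1)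
          omega
      intro j hj hjc
      rcases Nat.eq_or_lt_of_le hj with rfl | hj
      · exact h0
      rcases Nat.eq_or_lt_of_le hjc with rfl | hjc
      · exact ht
      have h1 := hbelow j (by omega) hjc (by omega)
      have := h.row (by omega) (by omega : f (i + 1) j ≠ 0) hj
      omega
    -- The lower row consists of `k + 1` alone, so no relevant letter fits below it and the scan
    -- starts afresh with zero gain. The first letter of the upper row then costs no need, which
    -- replaces the missing unit.
    obtain rfl : s = (0, 0) := by
      refine hs fun r hr j => ?_
      by_contra h0
      have hrj := h.le _ _ h0
      have h1 := hu (i + 1) le_rfl hsl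
      have h2 : f (i + 1) j ≠ 0 := by
        rcases h.convex (i + 1) (i + 1) r j (i + 1) j (Or.inl (by omega)) (Or.inl h0) le_rfl
          (by omega) (by omega) le_rfl (by omega) with h' | h'
        · exact h'
        · omega
      have h3 := h.row (by omega) h2 (show i + 1 < j by omega)
      have h4 := h.col h2 h0 (by omega)
      have := h.le_four r j
      omega
    have hz : ∀ j ≤ i, f (i + 1) j = 0 := by
      intro j hj
      by_contra h0
      have := h.le _ _ h0
      omega
    have hs1 : ∀ d, i + 1 + d ≤ c → scan (f (i + 1)) (i + 1 + d) (0, 0) = (0, d) := by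
      intro d
      induction d with
      | zero => intro _; exact scan_of_zero fun j hj => hz j (by omega)
      | succ d ih =>
        intro hd
        rw [← Nat.add_assoc, scan, ih (by omega), hu _ (by omega) (by omega), scanStep_four]
    have hs1 : scan (f (i + 1)) c (0, 0) = (0, c - (i + 1)) := by
      have := hs1 (c - (i + 1)) (by omega)
      rwa [show i + 1 + (c - (i + 1)) = c by omega] at this
    rw [hs1]
    have hi0 : scan (f i) i (0, c - (i + 1)) = (0, c - (i + 1)) := by
      refine scan_of_zero fun j hj => ?_
      by_contra h0
      have := h.le _ _ h0
      omega
    refine scan_four fun j hj => ?_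
    rcases Nat.lt_trichotomy j i with hji | rfl | hji
    · have := hlt j hji; omega
    · exact Or.inr (Or.inr ⟨he, Or.inl (by rw [hi0])⟩)
    · refine Or.inr (Or.inr ⟨hge j hji.le hj, Or.inr ?_⟩)
      have h1 : c - (i + 1) ≤ (scan (f i) (i + 1) (0, c - (i + 1))).2 := by
        rw [scan, hi0]
        rcases he with h' | h' <;> rw [h']
        · simp [scanStep_two]
        · simp [scanStep_three]
      have := hdec (i + 1) _ j hji.le hj.le (Or.inr ⟨rfl, hji⟩) h1 hji
      omega
  · have hu : ∀ j, e ≤ j → j ≤ c → j - e ≤ (scan (f (i + 1)) j s).2 := by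
      intro j hj hjc
      induction j, hj using Nat.le_induction with
      | base => simp
      | succ j hj ih =>
        have ih := ih (by omega)
        rw [scan]
        generalize scan (f (i + 1)) j s = t at ih
        obtain ⟨x, y⟩ := t
        simp only at ih
        rcases hbelow j hj (by omega) (by omega) with h' | h' <;> rw [h']
        · have : j = e := by
            by_contra hne
            have h1 := hbelow e le_rfl hec (by omega)
            have := h.row (by omega) (by omega : f (i + 1) j ≠ 0) (show e < j by omega)
            omega
          rw [scanStep_three]
          split_ifs <;> simp only <;> omega
        · rw [scanStep_four]
          simp only
          omega
    have h1 := hu c hec.le le_rfl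
    refine scan_four fun j hj => ?_
    rcases Nat.lt_or_ge j e with hje | hje
    · have := hlt j hje; omega
    · refine Or.inr (Or.inr ⟨hge j hje hj, Or.inr ?_⟩)
      have h2 := hconst (scan (f (i + 1)) c s) e le_rfl
      have := hdec e (scan (f (i + 1)) c s) j hje hj.le (Or.inl rfl) (by omega) hje
      omega

/-- The scan does not change if the letter moves to the hole. -/
theorem scanRows_eq (h : Slide f i c n) (h1 : f' i c = f (i + 1) c) (h2 : f' (i + 1) c = 0)
    (h3 : ∀ a b, ¬ (a = i ∧ b = c) → ¬ (a = i + 1 ∧ b = c) → f' a b = f a b) :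
    scanRows f n 0 n (0, 0) = scanRows f' n 0 n (0, 0) := by
  have hsl := h.succ_le
  have hcn := h.lt_n
  obtain ⟨p, hp⟩ : ∃ p, n = c + 1 + p := Nat.exists_eq_add_of_le hcn
  refine scanRows_eq_of_two (i := i) (by omega) (fun r hr hr' j _ => (h3 _ _ (by omega) (by omega)).symm)
    fun s hs => ?_
  have split : ∀ g s, scan g n s =
      scan (fun j => g (c + 1 + j)) p (scanStep (g c) (scan g c s)) := by
    intro g s
    rw [hp, scan_add, scan]
  rw [split, split, split, split, h.hole, h1, h2, scanStep_zero, scanStep_zero,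
    scan_congr (g := f' i) (g' := f i) (n := c) fun j hj => h3 _ _ (by omega) (by omega),
    scan_congr (g := f' (i + 1)) (g' := f (i + 1)) (n := c) fun j hj =>
      h3 _ _ (by omega) (by omega),
    scan_congr (g := fun j => f' i (c + 1 + j)) (g' := fun j => f i (c + 1 + j)) (n := p)
      fun j hj => h3 _ _ (by omega) (by omega),
    scan_congr (g := fun j => f' (i + 1) (c + 1 + j)) (g' := fun j => f (i + 1) (c + 1 + j)) (n := p)
      fun j hj => h3 _ _ (by omega) (by omega)]
  have h4 := h.le_four (i + 1) c
  have h5 := h.south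
  obtain ht | ht | ht | ht : f (i + 1) c = 1 ∨ f (i + 1) c = 2 ∨ f (i + 1) c = 3 ∨
      f (i + 1) c = 4 := by omega
  · obtain ⟨m, hm, hU, hV⟩ := h.rows (Or.inl ht) hp
    -- Letters west of the hole precede the moving letter in the standardization order; nothing
    -- precedes a `k'` from there.
    have hv : ∀ s, scan (f i) c s = s := fun s => by
      refine scan_of_zero fun j hj => ?_
      by_contra h0
      have := h.before i j h0 le_rfl hj.le
      unfold StdOrd at this
      omega
    rw [hv, hv, ht]
    exact slide_one hU hV hm
  · obtain ⟨m, hm, hU, hV⟩ := h.rows (Or.inr ht) hp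
    rw [ht]
    rcases h.west (Or.inl ht) with h0 | ⟨d, rfl, hd, h0, hd'⟩
    · rw [scan_of_zero h0, scan_of_zero h0]
      exact slide_two hU hV hm
    · have hv : ∀ s, scan (f i) (d + 1) s = scanStep 1 s := fun s => by
        rw [scan, scan_of_zero h0, hd]
      rw [hv, hv]
      exact slide_two' hU hV hm (pos_of_west hd')
  · have hu : ∀ s, scan (fun j => f (i + 1) (c + 1 + j)) p s = s := fun s =>
      scan_of_zero fun j _ => h.east_zero (Or.inl ht) (by omega)
    rw [hu, hu, ht]
    rcases h.west (Or.inr ht) with h0 | ⟨d, rfl, hd, h0, hd'⟩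
    · rw [scan_of_zero h0, scan_of_zero h0]
    · have hv : ∀ s, scan (f i) (d + 1) s = scanStep 1 s := fun s => by
        rw [scan, scan_of_zero h0, hd]
      rw [hv, hv]
      have := pos_of_west (s := s) hd'
      generalize scan (f (i + 1)) (d + 1) s = t at this
      obtain ⟨x, y⟩ := t
      simp only at this
      congr 1
      rw [scanStep_one, scanStep_three, scanStep_three]
      by_cases hy : y = 0
      · simp [hy, scanStep_one]
      · simp only [this.ne', hy, or_self, if_false, scanStep_one, Nat.add_eq_zero_iff, one_ne_zero,
          and_false]
        congr 1
        omega
  · have hu : ∀ s, scan (fun j => f (i + 1) (c + 1 + j)) p s = s := fun s =>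
      scan_of_zero fun j _ => h.east_zero (Or.inr ht) (by omega)
    rw [hu, hu, ht]
    rw [h.scan_of_four ht fun h0 => ?_]
    rw [hs]
    exact scanRows_of_zero fun r hr j _ => h0 r hr j

end Slide

/-! ### The remaining moves of a letter -/

section moves
variable {f f' : ℕ → ℕ → ℕ} {i c n : ℕ}

theorem scan_split (g : ℕ → ℕ) (c p : ℕ) (s : ℕ × ℕ) : scan g (c + 1 + 1 + p) s =
    scan (fun j => g (c + 1 + 1 + j)) p (scanStep (g (c + 1)) (scanStep (g c) (scan g c s))) := by
  rw [scan_add, scan, scan]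

/-- The scan does not change if a letter moves to the west. -/
theorem scanRows_eq_west (hc : c + 1 < n) (hi : i < n) (h0 : f i c = 0) (h1 : f' i c = f i (c + 1))
    (h2 : f' i (c + 1) = 0)
    (h3 : ∀ a b, ¬ (a = i ∧ b = c) → ¬ (a = i ∧ b = c + 1) → f' a b = f a b) :
    scanRows f n 0 n (0, 0) = scanRows f' n 0 n (0, 0) := by
  refine scanRows_eq_of_one hi (fun r hr j _ => (h3 _ _ (by omega) (by omega)).symm) fun s _ => ?_
  obtain ⟨p, rfl⟩ := Nat.exists_eq_add_of_le (show c + 1 + 1 ≤ n from hc)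
  rw [scan_split, scan_split, h0, h1, h2, scanStep_zero, scanStep_zero,
    scan_congr (g := f' i) (g' := f i) (n := c) fun j hj => h3 _ _ (by omega) (by omega),
    scan_congr (g := fun j => f' i (c + 1 + 1 + j)) (g' := fun j => f i (c + 1 + 1 + j)) (n := p)
      fun j hj => h3 _ _ (by omega) (by omega)]

theorem scanStep_one_eq_two {s : ℕ × ℕ} (h : s.1 = 0 ∨ s.2 = 0) :
    scanStep 1 s = scanStep 2 s := by
  obtain ⟨x, y⟩ := s
  rw [scanStep_one, scanStep_two, if_pos h]

theorem scanStep_three_eq_four {s : ℕ × ℕ} (h : s.1 = 0 ∨ s.2 = 0) :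
    scanStep 3 s = scanStep 4 s := by
  obtain ⟨x, y⟩ := s
  rw [scanStep_three, scanStep_four, if_pos h]

/-- Adding a prime to a letter next to the main diagonal. -/
theorem scanRows_eq_prime (hi : i + 1 < n) (hle : ∀ a b, f a b ≠ 0 → a ≤ b)
    (h1 : (f i (i + 1) = 2 ∧ f' i (i + 1) = 1) ∨ (f i (i + 1) = 4 ∧ f' i (i + 1) = 3))
    (h3 : ∀ a b, ¬ (a = i ∧ b = i + 1) → f' a b = f a b)
    (h2 : f i (i + 1) = 2 → (∀ r, i + 1 ≤ r → ∀ j, f r j ≠ 1 ∧ f r j ≠ 2) ∧ f i i ≠ 1 ∧ f i i ≠ 2)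
    (h4 : f i (i + 1) = 4 → ∀ r, i + 1 ≤ r → ∀ j, f r j = 0) :
    scanRows f n 0 n (0, 0) = scanRows f' n 0 n (0, 0) := by
  refine scanRows_eq_of_one (i := i) (by omega)
    (fun r hr j _ => (h3 _ _ (by omega)).symm) fun s hs => ?_
  obtain ⟨p, rfl⟩ := Nat.exists_eq_add_of_le (show i + 1 + 1 ≤ n from hi)
  have hz : ∀ s, scan (f i) i s = s := fun s => by
    refine scan_of_zero fun j hj => ?_
    by_contra h0
    have := hle _ _ h0
    omega
  have hi' : f' i i = f i i := h3 _ _ (by omega)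
  rw [scan_split, scan_split,
    scan_congr (g := f' i) (g' := f i) (n := i) fun j hj => h3 _ _ (by omega),
    scan_congr (g := fun j => f' i (i + 1 + 1 + j)) (g' := fun j => f i (i + 1 + 1 + j)) (n := p)
      fun j hj => h3 _ _ (by omega), hz, hi']
  congr 1
  -- A prime is invisible to the scan when gain or need is zero. For `k` no gain has arisen before;
  -- for `k + 1` at most the letter on the main diagonal has been read, starting from `(0, 0)`.
  rcases h1 with ⟨h1, h1'⟩ | ⟨h1, h1'⟩ <;> rw [h1, h1']
  · have h2 := h2 h1
    have hs0 : s.1 = 0 := by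
      rw [hs]
      exact scanRows_fst_zero (fun r hr j _ => h2.1 r hr j) rfl
    refine (scanStep_one_eq_two (Or.inl ?_)).symm
    obtain ⟨x, y⟩ := s
    simp only at hs0
    subst hs0
    unfold scanStep
    split <;> simp_all
  · have hs0 : s = (0, 0) := by
      rw [hs]
      exact scanRows_of_zero fun r hr j _ => h4 h1 r hr j
    subst hs0
    refine (scanStep_three_eq_four ?_).symm
    unfold scanStep
    split <;> simp

/-- If `k` moves up from the main diagonal, no other `k'` or `k` has been scanned before its new
place: rows further down hold larger letters, and a letter to the west would be on the main
diagonal, where its order contradicts that of the moving letter. -/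
theorem Slide.no_first (h : Slide f i (i + 1) n) (ht : f (i + 1) (i + 1) = 2) :
    (∀ r, i + 1 ≤ r → ∀ j, ¬ (r = i + 1 ∧ j = i + 1) → f r j ≠ 1 ∧ f r j ≠ 2) ∧
      f i i ≠ 1 ∧ f i i ≠ 2 := by
  constructor
  · intro r hr j hne
    by_contra hcon
    have h0 : f r j ≠ 0 := by omega
    have hrj := h.le _ _ h0
    have h1 := h.after r j h0 (by omega) (by omega) (by omega)
    unfold StdOrd at h1
    have h2 : f (i + 1) j ≠ 0 := by
      rcases h.convex (i + 1) (i + 1) r j (i + 1) j (Or.inl (by omega)) (Or.inl h0) le_rfl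
        hr (by omega) le_rfl (by omega) with h' | h'
      · exact h'
      · omega
    have h3 := h.above (j := j) (by omega) h2
    rcases Nat.eq_or_lt_of_le hr with rfl | hr
    · omega
    · have := h.col h2 h0 hr
      omega
  · by_contra hcon
    have h0 : f i i ≠ 0 := by omega
    have h1 := h.before i i h0 le_rfl (by omega)
    have h2 := h.diag i i
    unfold StdOrd at h1
    omega

theorem Slide.no_rows (h : Slide f i (i + 1) n) (ht : f (i + 1) (i + 1) = 4) :
    ∀ r, i + 1 ≤ r → ∀ j, ¬ (r = i + 1 ∧ j = i + 1) → f r j = 0 := by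
  intro r hr j hne
  by_contra h0
  have hrj := h.le _ _ h0
  have h2 : f (i + 1) j ≠ 0 := by
    rcases h.convex (i + 1) (i + 1) r j (i + 1) j (Or.inl (by omega)) (Or.inl h0) le_rfl
      hr (by omega) le_rfl (by omega) with h' | h'
    · exact h'
    · omega
  have := h.east_zero (Or.inr ht) (j := j) (by omega)
  omega

/-! ### Letters that lose their prime on moving to the main diagonal. -/

/-- A filling with coded letters, a hole `(i, i)` and a primed letter to the east of it. -/
structure Leave (f : ℕ → ℕ → ℕ) (i n : ℕ) : Prop where
  hole : f i i = 0
  east : f i (i + 1) = 1 ∨ f i (i + 1) = 3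
  le_four : ∀ a b, f a b ≤ 4
  le : ∀ a b, f a b ≠ 0 → a ≤ b
  bound : ∀ a b, f a b ≠ 0 → b < n
  diag : ∀ a b, f a b = 1 ∨ f a b = 3 → a < b
  lt : ∀ a b a' b', f a b ≠ 0 → f a' b' ≠ 0 → a ≤ a' → b ≤ b' → a < a' ∨ b < b' →
    StdOrd (f a b) a b (f a' b') a' b'
  after : ∀ a b, f a b ≠ 0 → i ≤ a → i ≤ b → (a ≠ i ∨ b ≠ i + 1) →
    StdOrd (f i (i + 1)) i (i + 1) (f a b) a b
  convex : ∀ a b a' b' g h, f a b ≠ 0 ∨ (a = i ∧ b = i) → f a' b' ≠ 0 ∨ (a' = i ∧ b' = i) →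
    a ≤ g → g ≤ a' → b ≤ h → h ≤ b' → g ≤ h → f g h ≠ 0 ∨ (g = i ∧ h = i)

namespace Leave

theorem row (h : Leave f i n) {a b b' : ℕ} (h1 : f a b ≠ 0) (h2 : f a b' ≠ 0) (hb : b < b') :
    f a b ≤ f a b' ∧ (f a b = f a b' → f a b ≠ 1 ∧ f a b ≠ 3) := by
  have := h.lt a b a b' h1 h2 le_rfl hb.le (Or.inr hb)
  unfold StdOrd at this
  omega

theorem col (h : Leave f i n) {a a' b : ℕ} (h1 : f a b ≠ 0) (h2 : f a' b ≠ 0) (ha : a < a') :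
    f a b ≤ f a' b ∧ (f a b = f a' b → f a b ≠ 2 ∧ f a b ≠ 4) := by
  have := h.lt a b a' b h1 h2 ha.le le_rfl (Or.inl ha)
  unfold StdOrd at this
  omega

theorem diag_filled (h : Leave f i n) {r j : ℕ} (hr : i + 1 ≤ r) (h0 : f r j ≠ 0) :
    f (i + 1) (i + 1) ≠ 0 := by
  have := h.le _ _ h0
  rcases h.convex i i r j (i + 1) (i + 1) (Or.inr ⟨rfl, rfl⟩) (Or.inl h0) (by omega)
    hr (by omega) (by omega) (by omega) with h' | h'
  · exact h'
  · omega

theorem above (h : Leave f i n) {j : ℕ} (hj : i + 1 < j) (h1 : f (i + 1) j ≠ 0) :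
    f i j ≠ 0 ∧ f i j ≤ f (i + 1) j ∧ (f i j = f (i + 1) j → f i j ≠ 2 ∧ f i j ≠ 4) ∧
      f i (i + 1) < f i j := by
  have h0 : f i j ≠ 0 := by
    rcases h.convex i i (i + 1) j i j (Or.inr ⟨rfl, rfl⟩) (Or.inl h1) le_rfl (by omega) (by omega)
      le_rfl (by omega) with h' | h'
    · exact h'
    · omega
  have h2 := h.col h0 h1 (by omega)
  have h3 := h.row (a := i) (b := i + 1) (b' := j) (by have := h.east; omega) h0 hj
  have := h.east
  omega

theorem lt_n (h : Leave f i n) : i + 1 < n := h.bound i (i + 1) (by have := h.east; omega)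

/-- The letter loses its prime and moves to the main diagonal. -/
theorem scanRows_eq (h : Leave f i n) (h1 : f' i i = f i (i + 1) + 1) (h2 : f' i (i + 1) = 0)
    (h3 : ∀ a b, ¬ (a = i ∧ b = i) → ¬ (a = i ∧ b = i + 1) → f' a b = f a b)
    (hz : f (i + 1) (i + 1) ≠ f i (i + 1) + 1) :
    scanRows f n 0 n (0, 0) = scanRows f' n 0 n (0, 0) := by
  have hn := h.lt_n
  refine scanRows_eq_of_one (i := i) (by omega)
    (fun r hr j _ => (h3 _ _ (by omega) (by omega)).symm) fun s hs => ?_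
  obtain ⟨p, rfl⟩ := Nat.exists_eq_add_of_le (show i + 1 + 1 ≤ n from hn)
  rw [scan_split, scan_split, h.hole, h1, h2, scanStep_zero, scanStep_zero,
    scan_congr (g := f' i) (g' := f i) (n := i) fun j hj => h3 _ _ (by omega) (by omega),
    scan_congr (g := fun j => f' i (i + 1 + 1 + j)) (g' := fun j => f i (i + 1 + 1 + j)) (n := p)
      fun j hj => h3 _ _ (by omega) (by omega),
    scan_of_zero (g := f i) (n := i) fun j hj => by
      by_contra h0
      have := h.le _ _ h0
      omega]
  congr 1
  have hd := h.diag (i + 1) (i + 1)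
  -- All letters in lower rows are southeast of the one at `(i + 1, i + 1)`, which is unprimed and,
  -- by `hz`, greater than the moving letter without its prime. So what is scanned before cannot
  -- detect the prime.
  have hrow : ∀ r, i + 1 ≤ r → ∀ j, f r j ≠ 0 → f i (i + 1) + 1 < f r j := by
    intro r hr j h0
    have hrj := h.le _ _ h0
    have hd0 := h.diag_filled hr h0
    have h4 := h.after (i + 1) (i + 1) hd0 (by omega) (by omega) (by omega)
    have h5 := h.le_four (i + 1) (i + 1)
    have he := h.east
    unfold StdOrd at h4
    by_cases hne : r = i + 1 ∧ j = i + 1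
    · obtain ⟨rfl, rfl⟩ := hne
      omega
    · have h6 := h.lt (i + 1) (i + 1) r j hd0 h0 hr (by omega) (by omega)
      unfold StdOrd at h6
      omega
  rcases h.east with he | he <;> rw [he] at hrow ⊢
  · refine scanStep_one_eq_two (Or.inl ?_)
    rw [hs]
    refine scanRows_fst_zero (fun r hr j _ => ?_) rfl
    have := hrow r hr j
    omega
  · refine scanStep_three_eq_four (Or.inl ?_)
    rw [hs, scanRows_of_zero fun r hr j _ => ?_]
    have := hrow r hr j
    have := h.le_four r j
    omega

/-- Before the lower row is scanned the state is `(0, 0)`, or `(0, 1)` if a single `k + 1` sits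
below a `(k + 1)'` next to the main diagonal. The two orders then agree or are merged by the upper
row. -/
theorem leave_two {u v : ℕ → ℕ} {m p : ℕ} {s : ℕ × ℕ} (hu : SecondRow u m) (hv : FirstRow v m)
    (hp : m ≤ p) (hs : s = (0, 0) ∨ (s = (0, 1) ∧ 0 < m ∧ u 0 = 3)) :
    scan v p (scanStep 1 (scan u p (scanStep 2 s))) =
      scan v p (scanStep 2 (scanStep 2 (scan u p s))) := by
  rw [hu.scan hp, hu.scan hp]
  rcases hs with rfl | ⟨rfl, hm, hu0⟩
  · by_cases hm : m = 0
    · simp [hm, scanStep_one, scanStep_two]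
    rw [if_neg hm, if_neg hm]
    have hm1 : 1 + (m - 1) = m := by omega
    have := hv.merge' hp (by omega) (x := 1) (by omega)
    rcases hu.head (by omega) with h0 | h0 <;> rw [h0]
    · simpa [scanStep_one, scanStep_two, scanStep_three, hm1, hm] using this
    · simpa [scanStep_one, scanStep_two, scanStep_four, hm1, hm] using this
  · rw [if_neg hm.ne', if_neg hm.ne', hu0]
    simp only [scanStep_one, scanStep_two, scanStep_three, true_or, if_true, Nat.zero_add,
      one_ne_zero, or_self, if_false, Nat.sub_self]
    have h0 : ¬ (False ∨ 1 + 1 + (m - 1) = 0) := by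
      rintro (h | h)
      · exact h
      · omega
    rw [if_neg h0, show 1 + 1 + (m - 1) - 1 = 1 + (m - 1) by omega]

/-- The letter loses its prime and moves to the main diagonal, and the letter on the next place of
the main diagonal takes its place. -/
theorem scanRows_eq' (h : Leave f i n) (h1 : f' i i = f i (i + 1) + 1)
    (h2 : f' i (i + 1) = f i (i + 1) + 1) (h4 : f' (i + 1) (i + 1) = 0)
    (h3 : ∀ a b, ¬ (a = i ∧ b = i) → ¬ (a = i ∧ b = i + 1) → ¬ (a = i + 1 ∧ b = i + 1) →
      f' a b = f a b)
    (hz : f (i + 1) (i + 1) = f i (i + 1) + 1) :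
    scanRows f n 0 n (0, 0) = scanRows f' n 0 n (0, 0) := by
  classical
  have hn := h.lt_n
  have he := h.east
  refine scanRows_eq_of_two (i := i) hn
    (fun r hr hr' j _ => (h3 _ _ (by omega) (by omega) (by omega)).symm) fun s hs => ?_
  obtain ⟨p, hp⟩ := Nat.exists_eq_add_of_le (show i + 1 + 1 ≤ n from hn)
  have split : ∀ g s, (∀ j < i, g j = 0) → scan g n s =
      scan (fun j => g (i + 1 + 1 + j)) p (scanStep (g (i + 1)) (scanStep (g i) s)) := by
    intro g s hg
    rw [hp, scan_add, scan, scan, scan_of_zero hg]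
  have hzero : ∀ r, ∀ j < r, f r j = 0 := by
    intro r j hj
    by_contra h0
    have := h.le _ _ h0
    omega
  rw [split _ _ fun j hj => hzero i j hj, split (f (i + 1)) _ fun j hj => hzero _ j (by omega),
    split (f' i) _ fun j hj => by rw [h3 _ _ (by omega) (by omega) (by omega)]; exact hzero i j hj,
    split (f' (i + 1)) _ fun j hj => by
      rw [h3 _ _ (by omega) (by omega) (by omega)]; exact hzero _ j (by omega),
    h.hole, h1, h2, h4, hz, hzero (i + 1) i (by omega), h3 (i + 1) i (by omega) (by omega) (by omega),
    hzero (i + 1) i (by omega), scanStep_zero, scanStep_zero, scanStep_zero,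
    scan_congr (g := fun j => f' i (i + 1 + 1 + j)) (g' := fun j => f i (i + 1 + 1 + j)) (n := p)
      fun j hj => h3 _ _ (by omega) (by omega) (by omega),
    scan_congr (g := fun j => f' (i + 1) (i + 1 + 1 + j)) (g' := fun j => f (i + 1) (i + 1 + 1 + j))
      (n := p) fun j hj => h3 _ _ (by omega) (by omega) (by omega)]
  have hd0 : f (i + 1) (i + 1) ≠ 0 := by omega
  have hbelow : ∀ r, i + 2 ≤ r → ∀ j, f r j ≠ 0 → f (i + 1) j = 3 ∧ i + 1 < j := by
    intro r hr j h0
    have hrj := h.le _ _ h0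
    have h5 : f (i + 1) j ≠ 0 := by
      rcases h.convex (i + 1) (i + 1) r j (i + 1) j (Or.inl hd0) (Or.inl h0) le_rfl
        (by omega) (by omega) le_rfl (by omega) with h' | h'
      · exact h'
      · omega
    have h6 := h.above (j := j) (by omega) h5
    have h7 := h.col h5 h0 (by omega)
    have h8 := h.le_four r j
    have h9 := h.row hd0 h5 (by omega)
    omega
  rcases he with he | he <;> rw [he]
  · have hU : ∀ j, f (i + 1) (i + 1 + 1 + j) ≠ 0 →
        (f (i + 1) (i + 1 + 1 + j) = 3 ∨ f (i + 1) (i + 1 + 1 + j) = 4) ∧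
        (f i (i + 1 + 1 + j) = 2 ∨ f i (i + 1 + 1 + j) = 3) := by
      intro j hj
      have h5 := h.above (by omega) hj
      have h6 := h.row hd0 hj (by omega)
      have h7 := h.le_four (i + 1) (i + 1 + 1 + j)
      omega
    have hlast : f (i + 1) (i + 1 + 1 + p) = 0 := by
      by_contra h0
      have := h.bound _ _ h0
      omega
    have hex : ∃ j, f (i + 1) (i + 1 + 1 + j) = 0 := ⟨p, hlast⟩
    have hmin : ∀ j, j < Nat.find hex → f (i + 1) (i + 1 + 1 + j) ≠ 0 :=
      fun j hj => Nat.find_min hex hj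
    have hu : SecondRow (fun j => f (i + 1) (i + 1 + 1 + j)) (Nat.find hex) := by
      refine ⟨fun j hj => ?_, fun h0 => (hU 0 (hmin 0 h0)).1, fun j hj hj0 => ?_⟩
      · by_contra h0
        rcases h.convex (i + 1) (i + 1) (i + 1) (i + 1 + 1 + j) (i + 1) (i + 1 + 1 + Nat.find hex)
          (Or.inl hd0) (Or.inl h0) le_rfl le_rfl (by omega) (by omega) (by omega) with h' | h'
        · exact h' (Nat.find_spec hex)
        · omega
      · have h5 := hU j (hmin j hj)
        have h6 := hU 0 (hmin 0 (by omega))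
        have h7 := h.row (hmin 0 (by omega)) (hmin j hj) (by omega)
        show f (i + 1) (i + 1 + 1 + j) = 4
        omega
    have hv : FirstRow (fun j => f i (i + 1 + 1 + j)) (Nat.find hex) := by
      refine ⟨fun j hj => ?_, fun j hj => (hU j (hmin j (by omega))).2⟩
      have h5 := hU j (hmin j (by omega))
      have h6 := hU (j + 1) (hmin (j + 1) hj)
      have h7 := h.row (a := i) (b := i + 1 + 1 + j) (b' := i + 1 + 1 + (j + 1)) (by omega)
        (by omega) (by omega)
      show f i (i + 1 + 1 + j) = 2
      omega
    refine leave_two hu hv (Nat.find_min' hex hlast) ?_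
    -- A letter below the row `i + 1` must have `(k + 1)'` above it. That letter occurs only in the
    -- first place after the diagonal box, so the only possible box is `(i + 2, i + 2)`, with the
    -- letter `k + 1`.
    have hpt : ∀ r, i + 2 ≤ r → ∀ j, f r j ≠ 0 → r = i + 2 ∧ j = i + 2 ∧
        f (i + 1) (i + 2) = 3 ∧ f r j = 4 := by
      intro r hr j h0
      have hrj := h.le _ _ h0
      have h5 := hbelow r hr j h0
      have h6 : j = i + 2 := by
        by_contra hne
        have h7 : f (i + 1) (i + 2) ≠ 0 := by
          rcases h.convex (i + 1) (i + 1) (i + 1) j (i + 1) (i + 2) (Or.inl hd0)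
            (Or.inl (by omega)) le_rfl le_rfl (by omega) (by omega) (by omega) with h' | h'
          · exact h'
          · omega
        have h8 := hU 0 h7
        have h9 := h.row (a := i + 1) (b := i + 2) (b' := j) h7 (by omega) (by omega)
        simp only [Nat.add_zero] at h8
        omega
      subst h6
      obtain rfl : r = i + 2 := by omega
      have h7 := h.col (a := i + 1) (a' := i + 2) (b := i + 2) (by omega) h0 (by omega)
      have h8 := h.diag (i + 2) (i + 2)
      have h9 := h.le_four (i + 2) (i + 2)
      omega
    by_cases h0 : f (i + 2) (i + 2) = 0
    · left
      rw [hs]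
      refine scanRows_of_zero fun r hr j _ => ?_
      by_contra h5
      have h6 := hpt r hr j h5
      rw [h6.1, h6.2.1] at h5
      exact h5 h0
    · right
      have h5 := hpt (i + 2) le_rfl (i + 2) h0
      have h6 := h.bound _ _ h0
      refine ⟨?_, ?_, h5.2.2.1⟩
      · obtain ⟨q, hq⟩ := Nat.exists_eq_add_of_le (show i + 2 + 1 ≤ n from h6)
        have hr1 : scanRows f n (i + 2 + 1) q (0, 0) = (0, 0) := by
          refine scanRows_of_zero fun r hr j _ => ?_
          by_contra h7
          have := hpt r (by omega) _ h7
          omega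
        have hr2 : ∀ s, scan (fun j => f (i + 2) (i + 2 + 1 + j)) q s = s := fun s => by
          refine scan_of_zero fun j _ => ?_
          by_contra h7
          have := hpt (i + 2) le_rfl _ h7
          omega
        rw [hs, show n - (i + 2) = 1 + q by omega, scanRows_add, hr1, scanRows, scanRows,
          Nat.add_zero, hq, scan_add, scan, scan_of_zero fun j hj => hzero _ j hj, h5.2.2.2, hr2]
        rfl
      · by_contra h7
        have h8 := Nat.find_spec hex
        rw [show Nat.find hex = 0 by omega] at h8
        exact absurd (h8.symm.trans h5.2.2.1) (by norm_num)
  · have hs0 : s = (0, 0) := by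
      rw [hs]
      refine scanRows_of_zero fun r hr j _ => ?_
      by_contra h0
      have h5 := hbelow r hr j h0
      have h6 := h.row hd0 (by omega : f (i + 1) j ≠ 0) h5.2
      omega
    have hU : ∀ s, scan (fun j => f (i + 1) (i + 1 + 1 + j)) p s = s := fun s =>
      scan_of_zero fun j _ => by
        by_contra h0
        have h5 := h.above (by omega) h0
        have h6 := h.row hd0 h0 (by omega)
        have h7 := h.le_four (i + 1) (i + 1 + 1 + j)
        omega
    rw [hU, hU, hs0]
    simp [scanStep_three, scanStep_four]

end Leave
end moves

/-! ### The scan of a filling along the moves of a hole -/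

/-- The code of a letter used in `scanStep`. -/
def code (k : ℕ) : Option Letter → ℕ
  | none => 0
  | some l => if l.val = k then (if l.primed then 1 else 2)
      else if l.val = k + 1 then (if l.primed then 3 else 4) else 0

/-- The codes of the entries of a filling. -/
def codes (k : ℕ) (T : Filling) (a b : ℕ) : ℕ := code k (T (a, b))

/-- The result of the scan of a filling. -/
def latticeScan (k n : ℕ) (T : Filling) : ℕ × ℕ := scanRows (codes k T) n 0 n (0, 0)

theorem code_le_four (k : ℕ) (o : Option Letter) : code k o ≤ 4 := by
  unfold code
  split
  · omega
  · split_ifs <;> omega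

theorem code_ne_zero {k : ℕ} {l : Letter} :
    code k (some l) ≠ 0 ↔ l.val = k ∨ l.val = k + 1 := by
  simp only [code]
  split_ifs <;> simp_all

theorem code_primed {k b : ℕ} (h : code k (some ⟨b, true⟩) ≠ 0) :
    (code k (some ⟨b, true⟩) = 1 ∧ code k (some ⟨b, false⟩) = 2) ∨
    (code k (some ⟨b, true⟩) = 3 ∧ code k (some ⟨b, false⟩) = 4) := by
  rw [code_ne_zero] at h
  simp only at h
  rcases h with rfl | rfl <;> simp [code]

theorem primed_of_code {k : ℕ} {l : Letter} (h : code k (some l) = 1 ∨ code k (some l) = 3) :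
    l.primed = true := by
  simp only [code] at h
  split_ifs at h <;> simp_all

/-! ### Sorted chains with a hole, and their translation into codes. -/

theorem Letter.le_iff {x y : Letter} :
    x ≤ y ↔ x.val < y.val ∨ (x.val = y.val ∧ (x.primed = true ∨ y.primed = false)) := Iff.rfl

theorem StdLt.val_le {e f : Box × Letter} (h : StdLt e f) : e.2.val ≤ f.2.val := by
  have := h.1
  rw [Letter.le_iff] at this
  omega

theorem StdLt.stdOrd {k : ℕ} {c d : Box} {l m : Letter} (h : StdLt (c, l) (d, m))
    (hl : code k (some l) ≠ 0) (hm : code k (some m) ≠ 0) :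
    StdOrd (code k (some l)) c.1 c.2 (code k (some m)) d.1 d.2 := by
  obtain ⟨v, p⟩ := l
  obtain ⟨w, q⟩ := m
  obtain ⟨h1, h2⟩ := h
  simp only [Letter.le_iff, Letter.mk.injEq, dg] at h1 h2
  rw [code_ne_zero] at hl hm
  simp only at hl hm
  unfold StdOrd
  rcases hl with rfl | rfl <;> rcases hm with hm | hm <;> subst hm <;> cases p <;> cases q <;>
    simp [code] at h1 h2 ⊢ <;> omega

theorem StdLt.trans {e f g : Box × Letter} (h : StdLt e f) (h' : StdLt f g) : StdLt e g := by
  obtain ⟨c, ⟨u, p⟩⟩ := e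
  obtain ⟨d, ⟨v, q⟩⟩ := f
  obtain ⟨d', ⟨w, r⟩⟩ := g
  simp only [StdLt, Letter.le_iff, Letter.mk.injEq] at h h' ⊢
  obtain ⟨h1, h2⟩ := h
  obtain ⟨h3, h4⟩ := h'
  refine ⟨?_, ?_⟩
  · cases p <;> cases q <;> cases r <;> simp_all <;> omega
  · rintro ⟨rfl, rfl⟩
    obtain rfl : u = v := by omega
    cases p <;> cases q <;> simp_all <;> omega

theorem fill_append_cons_self {V : Type*} {P Q : List (Box × V)} {c : Box} {v : V}
    (h : c ∉ P.map Prod.fst) : fill (P ++ (c, v) :: Q) c = some v := by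
  induction P with
  | nil => simp [fill]
  | cons e P ih =>
    obtain ⟨d, w⟩ := e
    simp only [List.map_cons, List.mem_cons, not_or] at h
    rw [List.cons_append, fill, Function.update_of_ne h.1, ih h.2]

theorem fill_append_cons_of_ne {V : Type*} {P Q : List (Box × V)} {c d : Box} {v : V}
    (h : d ≠ c) : fill (P ++ (c, v) :: Q) d = fill (P ++ Q) d := by
  induction P with
  | nil => simp [fill, h]
  | cons e P ih =>
    obtain ⟨d', w⟩ := e
    by_cases hd : d = d'
    · subst hd; simp [fill]
    · rw [List.cons_append, fill, Function.update_of_ne hd, ih, List.cons_append, fill,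
        Function.update_of_ne hd]

/-- A sorted growing list of labelled boxes, with a hole `x` between its parts `P` and `Q`. -/
structure Hole (n : ℕ) (N : Set Box) (P : List (Box × Letter)) (x : Box)
    (Q : List (Box × Letter)) : Prop where
  grows : Grows N (P.map Prod.fst ++ x :: Q.map Prod.fst)
  sorted : (P ++ Q).Pairwise StdLt
  diag : ∀ e ∈ P ++ Q, e.2.primed = true → 0 < dg e.1
  bound : ∀ c ∈ P.map Prod.fst ++ x :: Q.map Prod.fst, c.2 < n

namespace Hole
variable {k n b : ℕ} {N : Set Box} {P Q : List (Box × Letter)} {x y t : Box} {l : Letter}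

theorem pairwise (h : Hole n N P x Q) :
    (P ++ Q).Pairwise fun e f => StdLt e f ∧ ¬ (f.1.1 ≤ e.1.1 ∧ f.1.2 ≤ e.1.2) := by
  refine List.pairwise_and_iff.2 ⟨h.sorted, ?_⟩
  have h1 := h.grows.pairwise.sublist
    ((List.Sublist.refl (P.map Prod.fst)).append (List.sublist_cons_self x (Q.map Prod.fst)))
  rw [← List.map_append, List.pairwise_map] at h1
  exact h1

theorem nodup (h : Hole n N P x Q) : ((P ++ Q).map Prod.fst).Nodup := by
  have h1 := h.grows.nodup.sublist
    ((List.Sublist.refl (P.map Prod.fst)).append (List.sublist_cons_self x (Q.map Prod.fst)))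
  rwa [← List.map_append] at h1

theorem not_mem (h : Hole n N P x Q) : x ∉ (P ++ Q).map Prod.fst := by
  have h1 := (List.nodup_middle.1 h.grows.nodup)
  rw [List.nodup_cons, ← List.map_append] at h1
  exact h1.1

theorem codes_hole (h : Hole n N P x Q) : codes k (fill (P ++ Q)) x.1 x.2 = 0 := by
  have : fill (P ++ Q) (x.1, x.2) = none := fill_eq_none_iff.2 h.not_mem
  rw [codes, this]
  rfl

theorem exists_letter (h : Hole n N P x Q) {a b : ℕ} (h0 : codes k (fill (P ++ Q)) a b ≠ 0) :
    ∃ m, ((a, b), m) ∈ P ++ Q ∧ codes k (fill (P ++ Q)) a b = code k (some m) ∧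
      code k (some m) ≠ 0 := by
  unfold codes at h0 ⊢
  cases hm : fill (P ++ Q) (a, b) with
  | none => rw [hm] at h0; exact absurd rfl h0
  | some m => rw [hm] at h0; exact ⟨m, (fill_eq_some_iff h.nodup).1 hm, rfl, h0⟩

theorem codes_eq (h : Hole n N P x Q) {m : Letter} (hm : (t, m) ∈ P ++ Q) :
    codes k (fill (P ++ Q)) t.1 t.2 = code k (some m) := by
  rw [codes, (fill_eq_some_iff h.nodup (c := (t.1, t.2))).2 hm]

theorem mem_left (h : Hole n N P x Q) {e : Box × Letter} (he : e ∈ P ++ Q)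
    (h1 : e.1.1 ≤ x.1) (h2 : e.1.2 ≤ x.2) : e ∈ P := by
  rcases List.mem_append.1 he with he | he
  · exact he
  · have := (List.pairwise_cons.1 (List.pairwise_append.1 h.grows.pairwise).2.1).1 e.1
      (List.mem_map_of_mem he)
    exact absurd ⟨h1, h2⟩ this

theorem mem_right (h : Hole n N P x Q) {e : Box × Letter} (he : e ∈ P ++ Q)
    (h1 : x.1 ≤ e.1.1) (h2 : x.2 ≤ e.1.2) : e ∈ Q := by
  rcases List.mem_append.1 he with he | he
  · have := (List.pairwise_append.1 h.grows.pairwise).2.2 e.1 (List.mem_map_of_mem he) x (by simp)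
    exact absurd ⟨h1, h2⟩ this
  · exact he

theorem mem_right' (h : Hole n N P x ((t, l) :: Q)) {e : Box × Letter} (he : e ∈ P ++ (t, l) :: Q)
    (h1 : x.1 ≤ e.1.1) (h2 : x.2 ≤ e.1.2) (hne : e.1 ≠ t) : e ∈ Q := by
  rcases List.mem_cons.1 (h.mem_right he h1 h2) with rfl | he
  · exact absurd rfl hne
  · exact he

theorem lt_left (h : Hole n N P x ((t, l) :: Q)) {e : Box × Letter} (he : e ∈ P) :
    StdLt e (t, l) :=
  (List.pairwise_append.1 h.sorted).2.2 e he _ (by simp)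

theorem lt_right (h : Hole n N P x ((t, l) :: Q)) {e : Box × Letter} (he : e ∈ Q) :
    StdLt (t, l) e :=
  (List.pairwise_cons.1 (List.pairwise_append.1 h.sorted).2.1).1 e he

theorem std_lt (h : Hole n N P x Q) {e f : Box × Letter} (he : e ∈ P ++ Q) (hf : f ∈ P ++ Q)
    (h1 : e.1.1 ≤ f.1.1) (h2 : e.1.2 ≤ f.1.2) : e = f ∨ StdLt e f := by
  rcases pairwise_or h.pairwise he hf with h' | h' | h'
  · exact Or.inl h'
  · exact Or.inr h'.1
  · exact absurd ⟨h1, h2⟩ h'.2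

theorem codes_lt (h : Hole n N P x Q) (a b a' b' : ℕ) (h0 : codes k (fill (P ++ Q)) a b ≠ 0)
    (h0' : codes k (fill (P ++ Q)) a' b' ≠ 0) (h1 : a ≤ a') (h2 : b ≤ b') (h3 : a < a' ∨ b < b') :
    StdOrd (codes k (fill (P ++ Q)) a b) a b (codes k (fill (P ++ Q)) a' b') a' b' := by
  obtain ⟨m, hm, he, h0⟩ := h.exists_letter h0
  obtain ⟨m', hm', he', h0'⟩ := h.exists_letter h0'
  rw [he, he']
  rcases h.std_lt hm hm' h1 h2 with h' | h'
  · simp only [Prod.mk.injEq] at h'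
    omega
  · exact h'.stdOrd h0 h0'

theorem codes_le (h : Hole n N P x Q) (a b : ℕ) (h0 : codes k (fill (P ++ Q)) a b ≠ 0) :
    a ≤ b := by
  obtain ⟨m, hm, -⟩ := h.exists_letter h0
  refine h.grows.le (c := (a, b)) ?_
  have := List.mem_map_of_mem (f := Prod.fst) hm
  simp only [List.map_append, List.mem_append] at this
  simp only [List.mem_append, List.mem_cons]
  tauto

theorem codes_bound (h : Hole n N P x Q) (a b : ℕ) (h0 : codes k (fill (P ++ Q)) a b ≠ 0) :
    b < n := by
  obtain ⟨m, hm, -⟩ := h.exists_letter h0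
  refine h.bound (a, b) ?_
  have := List.mem_map_of_mem (f := Prod.fst) hm
  simp only [List.map_append, List.mem_append] at this
  simp only [List.mem_append, List.mem_cons]
  tauto

theorem codes_diag (h : Hole n N P x Q) (a b : ℕ)
    (h0 : codes k (fill (P ++ Q)) a b = 1 ∨ codes k (fill (P ++ Q)) a b = 3) : a < b := by
  obtain ⟨m, hm, he, -⟩ := h.exists_letter (k := k) (a := a) (b := b) (by omega)
  rw [he] at h0
  have := h.diag _ hm (primed_of_code h0)
  simp only [dg] at this
  omega

theorem codes_after (h : Hole n N P x ((t, l) :: Q)) (hl : code k (some l) ≠ 0) (a b : ℕ)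
    (h0 : codes k (fill (P ++ (t, l) :: Q)) a b ≠ 0) (h1 : x.1 ≤ a) (h2 : x.2 ≤ b)
    (hne : (a, b) ≠ t) : StdOrd (codes k (fill (P ++ (t, l) :: Q)) t.1 t.2) t.1 t.2
      (codes k (fill (P ++ (t, l) :: Q)) a b) a b := by
  obtain ⟨m, hm, he, h0⟩ := h.exists_letter h0
  rw [he, h.codes_eq (t := t) (m := l) (by simp)]
  exact (h.lt_right (h.mem_right' hm h1 h2 hne)).stdOrd hl h0

theorem codes_before (h : Hole n N P x ((t, l) :: Q)) (hl : code k (some l) ≠ 0) (a b : ℕ)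
    (h0 : codes k (fill (P ++ (t, l) :: Q)) a b ≠ 0) (h1 : a ≤ x.1) (h2 : b ≤ x.2) :
    StdOrd (codes k (fill (P ++ (t, l) :: Q)) a b) a b
      (codes k (fill (P ++ (t, l) :: Q)) t.1 t.2) t.1 t.2 := by
  obtain ⟨m, hm, he, h0⟩ := h.exists_letter h0
  rw [he, h.codes_eq (t := t) (m := l) (by simp)]
  exact (h.lt_left (h.mem_left hm h1 h2)).stdOrd h0 hl

theorem mem_of_between (h : Hole n N P x Q) {u v c : Box}
    (hu : u ∈ P.map Prod.fst ++ x :: Q.map Prod.fst)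
    (hv : v ∈ P.map Prod.fst ++ x :: Q.map Prod.fst) (hc : c.1 ≤ c.2) (h1 : u.1 ≤ c.1)
    (h2 : u.2 ≤ c.2) (h3 : c.1 ≤ v.1) (h4 : c.2 ≤ v.2) :
    c = x ∨ ∃ m, (c, m) ∈ P ++ Q := by
  have hcv := h.grows.isIdeal_extend.2 v (Or.inr hv) c hc h3 h4
  rcases hcv with hcv | hcv
  · exact absurd (h.grows.isIdeal.2 c hcv u (h.grows.le hu) h1 h2) (h.grows.not_mem hu)
  · simp only [Set.mem_ofPred_eq, List.mem_append, List.mem_cons, List.mem_map] at hcv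
    rcases hcv with ⟨e, he, rfl⟩ | rfl | ⟨e, he, rfl⟩
    · exact Or.inr ⟨e.2, List.mem_append_left _ he⟩
    · exact Or.inl rfl
    · exact Or.inr ⟨e.2, List.mem_append_right _ he⟩

theorem mem_boxes (h : Hole n N P x Q) {a b : ℕ}
    (hab : codes k (fill (P ++ Q)) a b ≠ 0 ∨ (a = x.1 ∧ b = x.2)) :
    (a, b) ∈ P.map Prod.fst ++ x :: Q.map Prod.fst := by
  rcases hab with hab | ⟨rfl, rfl⟩
  · obtain ⟨m, hm, -⟩ := h.exists_letter hab
    have := List.mem_map_of_mem (f := Prod.fst) hm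
    simp only [List.map_append, List.mem_append] at this
    simp only [List.mem_append, List.mem_cons]
    tauto
  · simp

/-- A box between two boxes of the chain belongs to the chain, and its letter lies between theirs.
The hole may serve as an end because it stands just before a letter with nonzero code. -/
theorem codes_convex (h : Hole n N P x ((t, l) :: Q)) (hl : code k (some l) ≠ 0)
    (a b a' b' g r : ℕ)
    (hab : codes k (fill (P ++ (t, l) :: Q)) a b ≠ 0 ∨ (a = x.1 ∧ b = x.2))
    (hab' : codes k (fill (P ++ (t, l) :: Q)) a' b' ≠ 0 ∨ (a' = x.1 ∧ b' = x.2))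
    (h1 : a ≤ g) (h2 : g ≤ a') (h3 : b ≤ r) (h4 : r ≤ b') (h5 : g ≤ r) :
    codes k (fill (P ++ (t, l) :: Q)) g r ≠ 0 ∨ (g = x.1 ∧ r = x.2) := by
  rcases h.mem_of_between (c := (g, r)) (h.mem_boxes hab) (h.mem_boxes hab') h5 h1 h3 h2 h4 with
    hc | ⟨m, hm⟩
  · exact Or.inr (by rw [← hc]; exact ⟨rfl, rfl⟩)
  · left
    rw [h.codes_eq (t := (g, r)) hm, code_ne_zero]
    have hlow : k ≤ m.val := by
      rcases hab with hab | ⟨rfl, rfl⟩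
      · obtain ⟨m', hm', -, h0⟩ := h.exists_letter hab
        rw [code_ne_zero] at h0
        rcases h.std_lt hm' hm h1 h3 with h' | h'
        · obtain ⟨-, rfl⟩ := Prod.mk.inj h'
          omega
        · have := h'.val_le
          simp only at this
          omega
      · rw [code_ne_zero] at hl
        rcases List.mem_cons.1 (h.mem_right hm h1 h3) with h' | h'
        · obtain ⟨-, rfl⟩ := Prod.mk.inj h'
          omega
        · have := (h.lt_right h').val_le
          simp only at this
          omega
    have hhigh : m.val ≤ k + 1 := by
      rcases hab' with hab | ⟨rfl, rfl⟩
      · obtain ⟨m', hm', -, h0⟩ := h.exists_letter hab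
        rw [code_ne_zero] at h0
        rcases h.std_lt hm hm' h2 h4 with h' | h'
        · obtain ⟨-, rfl⟩ := Prod.mk.inj h'
          omega
        · have := h'.val_le
          simp only at this
          omega
      · rw [code_ne_zero] at hl
        have := (h.lt_left (h.mem_left hm h2 h4)).val_le
        simp only at this
        omega
    omega

theorem slide (h : Hole n N P x ((t, l) :: Q)) (ht : t = (x.1 + 1, x.2))
    (hl : code k (some l) ≠ 0) : Slide (codes k (fill (P ++ (t, l) :: Q))) x.1 x.2 n where
  hole := h.codes_hole
  south := by
    have := h.codes_eq (k := k) (t := t) (m := l) (by simp)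
    rw [ht] at this ⊢
    exact fun h => hl (this.symm.trans h)
  le_four _ _ := code_le_four _ _
  le := h.codes_le
  bound := h.codes_bound
  diag := h.codes_diag
  lt := h.codes_lt
  after a b h0 h1 h2 h3 := by
    have := h.codes_after hl a b h0 h1 h2 (by rintro rfl; simp at ht; omega)
    rw [ht] at this ⊢
    exact this
  before a b h0 h1 h2 := by
    have := h.codes_before hl a b h0 h1 h2
    rw [ht] at this ⊢
    exact this
  convex := h.codes_convex hl

theorem leave {i : ℕ} (h : Hole n N P (i, i) (((i, i + 1), ⟨b, true⟩) :: Q))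
    (hl : code k (some ⟨b, true⟩) ≠ 0) :
    Leave (codes k (fill (P ++ ((i, i + 1), ⟨b, true⟩) :: Q))) i n where
  hole := h.codes_hole
  east := by
    rw [h.codes_eq (t := (i, i + 1)) (m := ⟨b, true⟩) (by simp)]
    have := code_primed hl
    omega
  le_four _ _ := code_le_four _ _
  le := h.codes_le
  bound := h.codes_bound
  diag := h.codes_diag
  lt := h.codes_lt
  after a b h0 h1 h2 h3 := h.codes_after hl a b h0 h1 h2 (by
    intro h4
    simp only [Prod.mk.injEq] at h4
    omega)
  convex := h.codes_convex hl

end Hole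

theorem code_eq_zero_iff {k b : ℕ} :
    code k (some ⟨b, true⟩) = 0 ↔ code k (some ⟨b, false⟩) = 0 := by
  rw [← not_iff_not, ← Ne, ← Ne, code_ne_zero, code_ne_zero]

theorem eq_of_code_succ {k b : ℕ} {m : Letter} (hl : code k (some ⟨b, true⟩) ≠ 0)
    (h : code k (some m) = code k (some ⟨b, true⟩) + 1) : m = ⟨b, false⟩ := by
  rw [code_ne_zero] at hl
  obtain ⟨v, p⟩ := m
  simp only [code] at h hl
  rcases hl with rfl | rfl <;> cases p <;> simp at h ⊢ <;> split_ifs at h <;> simp_all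

namespace Hole
variable {k n b : ℕ} {N : Set Box} {P Q : List (Box × Letter)} {x y z t : Box} {l : Letter}

/-- In a sorted list it suffices to compare a new entry with its neighbors. -/
theorem sorted_insert {e : Box × Letter} (h : (P ++ Q).Pairwise StdLt)
    (h1 : ∀ P₀ f, P = P₀ ++ [f] → StdLt f e) (h2 : ∀ Q₀ f, Q = f :: Q₀ → StdLt e f) :
    (P ++ e :: Q).Pairwise StdLt := by
  rw [List.pairwise_append] at h
  have hP : ∀ f ∈ P, StdLt f e := by
    rcases List.eq_nil_or_concat' P with rfl | ⟨P, f, rfl⟩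
    · simp
    · have hf := h1 P f rfl
      have h3 := (List.pairwise_append.1 h.1).2.2
      intro g hg
      rcases List.mem_append.1 hg with hg | hg
      · exact (h3 g hg f (by simp)).trans hf
      · rw [List.mem_singleton] at hg
        rwa [hg]
  have hQ : ∀ f ∈ Q, StdLt e f := by
    cases Q with
    | nil => simp
    | cons f Q =>
      have hf := h2 Q f rfl
      intro g hg
      rcases List.mem_cons.1 hg with rfl | hg
      · exact hf
      · exact hf.trans ((List.pairwise_cons.1 h.2.1).1 g hg)
  rw [List.pairwise_append, List.pairwise_cons]
  refine ⟨h.1, ⟨hQ, h.2.1⟩, fun f hf g hg => ?_⟩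
  rcases List.mem_cons.1 hg with rfl | hg
  · exact hP f hf
  · exact h.2.2 f hf g hg

theorem le_of_mem (h : Hole n N P x Q) {e : Box × Letter} (he : e ∈ P ++ Q) : 0 ≤ dg e.1 := by
  refine dg_nonneg (h.grows.le ?_)
  have := List.mem_map_of_mem (f := Prod.fst) he
  simp only [List.map_append, List.mem_append] at this
  simp only [List.mem_append, List.mem_cons]
  tauto

theorem grows_from (h : Hole n N P x Q) :
    Grows (extend N (P.map Prod.fst)) (x :: Q.map Prod.fst) := (grows_append.1 h.grows).2

theorem grows_last {f : Box × Letter} (h : Hole n N (P ++ [f]) x Q) :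
    Grows (extend N (P.map Prod.fst)) (f.1 :: x :: Q.map Prod.fst) := by
  have : Grows N (P.map Prod.fst ++ (f.1 :: x :: Q.map Prod.fst)) := by simpa using h.grows
  exact (grows_append.1 this).2

theorem sorted' (h : Hole n N P x ((t, l) :: Q)) : (P ++ Q).Pairwise StdLt :=
  h.sorted.sublist ((List.Sublist.refl P).append (List.sublist_cons_self _ Q))

theorem not_mem' (h : Hole n N P x ((t, l) :: Q)) : t ∉ P.map Prod.fst ∧ x ∉ P.map Prod.fst ∧
    t ≠ x := by
  have h1 := h.nodup
  have h2 := h.not_mem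
  rw [List.map_append, List.map_cons, List.nodup_middle, List.nodup_cons] at h1
  simp only [List.map_append, List.map_cons, List.mem_append, List.mem_cons, not_or] at h1 h2
  exact ⟨h1.1.1, h2.1, fun h => h2.2.1 h.symm⟩

theorem codes_self {c : Box} (h : c ∉ P.map Prod.fst) :
    codes k (fill (P ++ (c, l) :: Q)) c.1 c.2 = code k (some l) := by
  rw [codes, fill_append_cons_self h]

theorem codes_of_ne {c : Box} {i j : ℕ} (h : ¬ (i = c.1 ∧ j = c.2)) :
    codes k (fill (P ++ (c, l) :: Q)) i j = codes k (fill (P ++ Q)) i j := by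
  rw [codes, fill_append_cons_of_ne (by rintro rfl; exact h ⟨rfl, rfl⟩), codes]

theorem codes_removed (h : Hole n N P x ((t, l) :: Q)) :
    codes k (fill (P ++ Q)) t.1 t.2 = 0 ∧ codes k (fill (P ++ Q)) x.1 x.2 = 0 := by
  have h1 := h.nodup
  have h2 := h.not_mem
  rw [List.map_append, List.map_cons, List.nodup_middle, List.nodup_cons, ← List.map_append] at h1
  have h3 : x ∉ (P ++ Q).map Prod.fst := by
    simp only [List.map_append, List.map_cons, List.mem_append, List.mem_cons, not_or] at h2 ⊢
    tauto
  constructor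
  · have : fill (P ++ Q) (t.1, t.2) = none := fill_eq_none_iff.2 h1.1
    rw [codes, this]; rfl
  · have : fill (P ++ Q) (x.1, x.2) = none := fill_eq_none_iff.2 h3
    rw [codes, this]; rfl

theorem exchange_mk {m : Letter} (h : Hole n N P x ((t, l) :: Q)) (hm : m.primed = true → 0 < dg x)
    (hs : (P ++ (x, m) :: Q).Pairwise StdLt) : Hole n N (P ++ [(x, m)]) t Q := by
  refine ⟨by simpa using h.grows, by simpa using hs, fun e he hp => ?_, by simpa using h.bound⟩
  simp only [List.append_assoc, List.singleton_append, List.mem_append, List.mem_cons] at he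
  rcases he with he | rfl | he
  · exact h.diag e (by simp [he]) hp
  · exact hm hp
  · exact h.diag e (by simp [he]) hp

/-- A letter next to the hole moves to the hole. -/
theorem exchange (h : Hole n N P x ((t, l) :: Q)) (ha : Adj x t)
    (hl : l.primed = true → 0 < dg x) : Hole n N (P ++ [(x, l)]) t Q := by
  have hx : 0 ≤ dg x := dg_nonneg (h.grows.le (by simp))
  refine h.exchange_mk hl (sorted_insert h.sorted' ?_ ?_)
  · rintro P f rfl
    have h1 := h.lt_left (e := f) (by simp)
    have h2 := h.grows_last.dg_ne
    refine ⟨h1.1, fun h3 => ?_⟩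
    have h4 := h1.2 h3
    simp only [Adj] at h4 ha ⊢
    exact ⟨fun hp => by have := h4.1 hp; omega, fun hp => by have := h4.2 hp; omega⟩
  · rintro Q f rfl
    have h1 := h.lt_right (e := f) (by simp)
    -- Moving west or north changes the diagonal by one, so only a coincidence with the next box can
    -- destroy the order. That coincidence forces diagonals 0, 1, 0, impossible for equal unprimed
    -- letters by their order and for equal primed letters by positivity.
    have h2 : dg x = dg f.1 → dg x = 0 ∧ dg t = 1 := by
      have : Grows (extend N (P.map Prod.fst)) (x :: t :: f.1 :: Q.map Prod.fst) := h.grows_from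
      exact this.dg_triple
    have h5 := h.diag f (by simp)
    refine ⟨h1.1, fun h3 => ?_⟩
    have h4 := h1.2 h3
    simp only at h3
    rw [← h3] at h5
    simp only [Adj] at h4 ha ⊢
    exact ⟨fun hp => by have := h4.1 hp; have := h5 hp; omega,
      fun hp => by have := h4.2 hp; omega⟩

theorem adj_iff (h : Hole n N P x ((t, l) :: Q)) :
    Adj x t ↔ t = (x.1, x.2 + 1) ∨ t = (x.1 + 1, x.2) := h.grows_from.adj_iff

/-- A move to the west does not change the word at all; a move to the north is the analysis of
`Slide`, trivial if the letter is not relevant for `k`. -/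
theorem latticeScan_exchange (h : Hole n N P x ((t, l) :: Q)) (ha : Adj x t) :
    latticeScan k n (fill (P ++ (t, l) :: Q)) = latticeScan k n (fill (P ++ (x, l) :: Q)) := by
  obtain ⟨h1, h2, h3⟩ := h.not_mem'
  have h4 := h.codes_removed (k := k)
  have hx : x.1 ≤ x.2 := h.grows.le (by simp)
  have hb := h.bound t (by simp)
  have hb' := h.bound x (by simp)
  rcases h.adj_iff.1 ha with ht | ht
  · rw [ht] at hb
    simp only at hb
    refine scanRows_eq_west (i := x.1) (c := x.2) hb (by omega) h.codes_hole ?_ ?_ ?_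
    · rw [codes_self h2]
      have := codes_self (k := k) (l := l) (Q := Q) h1
      rw [ht] at this ⊢
      exact this.symm
    · rw [codes_of_ne (by omega)]
      rw [ht] at h4
      exact h4.1
    · intro a b h5 h6
      rw [codes_of_ne h5, codes_of_ne (by rw [ht]; exact h6)]
  · by_cases hl : code k (some l) = 0
    · refine scanRows_congr fun r j _ => ?_
      by_cases hr : r = t.1 ∧ j = t.2
      · rw [hr.1, hr.2, codes_self h1, hl, codes_of_ne (by rw [ht]; simp), h4.1]
      · rw [codes_of_ne hr]
        by_cases hr : r = x.1 ∧ j = x.2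
        · rw [hr.1, hr.2, codes_self h2, hl, h4.2]
        · rw [codes_of_ne hr]
    · refine (h.slide ht hl).scanRows_eq ?_ ?_ ?_
      · rw [codes_self h2]
        have := codes_self (k := k) (l := l) (Q := Q) h1
        rw [ht] at this ⊢
        exact this.symm
      · rw [codes_of_ne (by omega)]
        rw [ht] at h4
        exact h4.1
      · intro a b h5 h6
        rw [codes_of_ne h5, codes_of_ne (by rw [ht]; exact h6)]

theorem commute (h : Hole n N P x ((t, l) :: Q)) (ha : ¬ Adj x t) :
    Hole n N (P ++ [(t, l)]) x Q := by
  refine ⟨?_, by simpa using h.sorted, by simpa using h.diag, fun c hc => h.bound c ?_⟩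
  · have := h.grows
    rw [grows_append] at this
    have h2 : Grows N (P.map Prod.fst ++ (t :: x :: Q.map Prod.fst)) :=
      grows_append.2 ⟨this.1, Grows.swap this.2 ha⟩
    simpa using h2
  · simp only [List.map_append, List.map_cons, List.map_nil, List.mem_append, List.mem_cons,
      List.not_mem_nil, or_false] at hc ⊢
    tauto

/-- The hole passes equal letters. Commuting past a box changes only the listing, not the filling;
exchanging with it is one move of a letter. The condition keeps primed letters off the main
diagonal. -/
theorem row {L L' : List Box} {x' : Box} (hr : Row BoxMove x L L' x') :
    ∀ {P}, Hole n N P x (L.map (·, l) ++ Q) →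
      (l.primed = true → 0 < dg x ∨ ∀ y ∈ L, ¬ Adj x y) →
      Hole n N (P ++ L'.map (·, l)) x' Q ∧ ∀ k, latticeScan k n (fill (P ++ (L.map (·, l) ++ Q))) =
        latticeScan k n (fill (P ++ (L'.map (·, l) ++ Q))) := by
  induction hr with
  | nil => intro P h _; exact ⟨by simpa using h, fun _ => rfl⟩
  | @cons x t t' x₁ L L' x' hm _ ih =>
    intro P h hl
    have h0 : Hole n N P x ((t, l) :: (L.map (·, l) ++ Q)) := h
    rcases hm with ⟨ha, rfl, rfl⟩ | ⟨ha, rfl, rfl⟩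
    · have hl' : l.primed = true → 0 < dg t' := fun hp => by
        rcases hl hp with h1 | h1
        · exact h1
        · exact absurd ha (h1 _ (by simp))
      have h1 := ih (h0.exchange ha hl') fun hp => Or.inl (h0.diag (x₁, l) (by simp) hp)
      refine ⟨by simpa using h1.1, fun k => ?_⟩
      have h2 := h1.2 k
      have h3 := h0.latticeScan_exchange (k := k) ha
      simp only [List.append_assoc, List.singleton_append] at h2
      simp only [List.map_cons, List.cons_append]
      exact h3.trans h2
    · have h1 := ih (h0.commute ha) fun hp => (hl hp).imp id fun h1 y hy => h1 y (by simp [hy])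
      refine ⟨by simpa using h1.1, fun k => ?_⟩
      simpa using h1.2 k

/-- A letter on the main diagonal receives a prime and moves to the hole north of it. -/
theorem enter (h : Hole n N P x ((y, ⟨b, false⟩) :: Q)) (ha : Adj x y) (hy : dg y = 0) :
    Hole n N (P ++ [(x, ⟨b, true⟩)]) y Q ∧ ∀ k, latticeScan k n (fill (P ++ (y, ⟨b, false⟩) :: Q)) =
      latticeScan k n (fill (P ++ (x, ⟨b, true⟩) :: Q)) := by
  have hx : x.1 ≤ x.2 := h.grows.le (by simp)
  have hyx : y = (x.1 + 1, x.1 + 1) ∧ x.2 = x.1 + 1 := by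
    rcases h.adj_iff.1 ha with rfl | rfl
    · simp only [dg] at hy; omega
    · simp only [dg] at hy
      have : x.2 = x.1 + 1 := by omega
      exact ⟨by rw [this], this⟩
  have hx1 : dg x = 1 := by unfold dg; omega
  have h1 := h.exchange ha (by simp)
  have h11 : (P ++ (x, ⟨b, false⟩) :: Q).Pairwise StdLt := by simpa using h1.sorted
  constructor
  · refine h.exchange_mk (fun _ => by omega) (sorted_insert h.sorted' ?_ ?_)
    · rintro P f rfl
      have h2 := h.lt_left (e := f) (by simp)
      have h3 := h.grows_last.dg_ne
      have h4 := h.le_of_mem (e := f) (by simp)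
      have h5 := h.diag f (by simp)
      obtain ⟨c, ⟨v, p⟩⟩ := f
      simp only [StdLt, Letter.le_iff, Letter.mk.injEq] at h2 h3 h4 h5 ⊢
      cases p <;> simp at h2 h5 ⊢ <;> omega
    · rintro Q f rfl
      have h2 : StdLt (x, ⟨b, false⟩) f :=
        (List.pairwise_cons.1 (List.pairwise_append.1 h11).2.1).1 f (by simp)
      refine StdLt.trans (f := (x, ⟨b, false⟩)) ?_ h2
      simp [StdLt, Letter.le_iff]
  · intro k
    -- The letter first moves north without a prime; adding the prime in the new place is a second,
    -- separate comparison.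
    rw [h.latticeScan_exchange ha]
    obtain ⟨h2, h3, h4⟩ := h.not_mem'
    have h5 := h.codes_removed (k := k)
    have hb := h.bound x (by simp)
    by_cases hl : code k (some ⟨b, true⟩) = 0
    · have hl' := code_eq_zero_iff.1 hl
      refine scanRows_congr fun r j _ => ?_
      by_cases hr : r = x.1 ∧ j = x.2
      · rw [hr.1, hr.2, codes_self h3, codes_self h3, hl, hl']
      · rw [codes_of_ne hr, codes_of_ne hr]
    · have hl' : code k (some ⟨b, false⟩) ≠ 0 := fun h0 => hl (code_eq_zero_iff.2 h0)
      have hs := h.slide (by rw [hyx.1, hyx.2]) hl'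
      have hyc : codes k (fill (P ++ (y, ⟨b, false⟩) :: Q)) y.1 y.2 = code k (some ⟨b, false⟩) :=
        codes_self h2
      have hrel : ∀ i j, ¬ (i = x.1 ∧ j = x.2) → ¬ (i = y.1 ∧ j = y.2) →
          codes k (fill (P ++ (x, ⟨b, false⟩) :: Q)) i j =
          codes k (fill (P ++ (y, ⟨b, false⟩) :: Q)) i j := fun i j h6 h7 => by
        rw [codes_of_ne h6, codes_of_ne h7]
      have hzero : codes k (fill (P ++ (x, ⟨b, false⟩) :: Q)) y.1 y.2 = 0 := by
        rw [codes_of_ne (by rw [hyx.1]; simp), h5.1]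
      have e1 : codes k (fill (P ++ (x, ⟨b, false⟩) :: Q)) x.1 x.2 = code k (some ⟨b, false⟩) :=
        codes_self h3
      have e2 : codes k (fill (P ++ (x, ⟨b, true⟩) :: Q)) x.1 x.2 = code k (some ⟨b, true⟩) :=
        codes_self h3
      have e3 := code_primed hl
      have hy1 : y.1 = x.1 + 1 := by rw [hyx.1]
      have hy2 : y.2 = x.1 + 1 := by rw [hyx.1]
      rw [hy1, hy2] at hyc hrel hzero
      rw [hyx.2] at hs e1 e2 hrel hb
      refine scanRows_eq_prime (i := x.1) hb ?_ ?_ ?_ ?_ ?_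
      · have := h1.codes_le (k := k)
        simpa using this
      · rw [e1, e2]; omega
      · intro i j hij
        rw [← hyx.2] at hij
        rw [codes_of_ne hij, codes_of_ne hij]
      · intro h6
        rw [e1] at h6
        obtain ⟨h7, h8⟩ := hs.no_first (by rw [hyc, h6])
        refine ⟨fun r hr j => ?_, ?_⟩
        · by_cases hne : r = x.1 + 1 ∧ j = x.1 + 1
          · rw [hne.1, hne.2, hzero]; omega
          · rw [hrel r j (by omega) hne]; exact h7 r hr j hne
        · rw [hrel _ _ (by omega) (by simp)]; exact h8
      · intro h6 r hr j
        rw [e1] at h6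
        have h7 := hs.no_rows (by rw [hyc, h6])
        by_cases hne : r = x.1 + 1 ∧ j = x.1 + 1
        · rw [hne.1, hne.2, hzero]
        · rw [hrel r j (by omega) hne]; exact h7 r hr j hne

theorem diag_adj (h : Hole n N P x ((y, l) :: Q)) (ha : Adj x y) (hx : dg x = 0) :
    ∃ i, x = (i, i) ∧ y = (i, i + 1) := by
  obtain ⟨i, j⟩ := x
  have hy : y.1 ≤ y.2 := h.grows.le (by simp)
  rw [dg_eq_zero] at hx
  simp only at hx
  subst hx
  rcases h.adj_iff.1 ha with rfl | rfl
  · exact ⟨i, rfl, rfl⟩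
  · simp only at hy; omega

/-- A letter loses its prime and moves to the hole on the main diagonal. -/
theorem leave_one (h : Hole n N P x ((y, ⟨b, true⟩) :: Q)) (ha : Adj x y) (hx : dg x = 0)
    (hQ : ∀ e ∈ Q, dg e.1 = 0 → e.2 ≠ ⟨b, false⟩) :
    Hole n N (P ++ [(x, ⟨b, false⟩)]) y Q ∧ ∀ k, latticeScan k n (fill (P ++ (y, ⟨b, true⟩) :: Q)) =
      latticeScan k n (fill (P ++ (x, ⟨b, false⟩) :: Q)) := by
  obtain ⟨i, rfl, rfl⟩ := h.diag_adj ha hx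
  have hy1 : dg (i, i + 1) = 1 := by simp [dg]
  constructor
  · refine h.exchange_mk (by simp) (sorted_insert h.sorted' ?_ ?_)
    · rintro P f rfl
      refine (h.lt_left (e := f) (by simp)).trans ?_
      simp [StdLt, Letter.le_iff]
    · rintro Q f rfl
      have h2 := h.lt_right (e := f) (by simp)
      have h3 := hQ f (by simp)
      have h4 := h.le_of_mem (e := f) (by simp)
      have h5 := h.diag f (by simp)
      obtain ⟨c, ⟨v, p⟩⟩ := f
      simp only [StdLt, Letter.le_iff, Letter.mk.injEq, ne_eq] at h2 h3 h4 h5 ⊢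
      rw [hx]
      cases p <;> simp at h2 h3 h5 ⊢ <;> omega
  · intro k
    obtain ⟨h2, h3, h4⟩ := h.not_mem'
    have h5 := h.codes_removed (k := k)
    have e1 : codes k (fill (P ++ ((i, i + 1), ⟨b, true⟩) :: Q)) i (i + 1) =
      code k (some ⟨b, true⟩) := codes_self h2
    have e2 : codes k (fill (P ++ ((i, i), ⟨b, false⟩) :: Q)) i i = code k (some ⟨b, false⟩) :=
      codes_self h3
    by_cases hl : code k (some ⟨b, true⟩) = 0
    · have hl' := code_eq_zero_iff.1 hl
      refine scanRows_congr fun r j _ => ?_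
      by_cases hr : r = i ∧ j = i + 1
      · rw [hr.1, hr.2, e1, hl, codes_of_ne (by simp), h5.1]
      · rw [codes_of_ne hr]
        by_cases hr : r = i ∧ j = i
        · rw [hr.1, hr.2, e2, hl', h5.2]
        · rw [codes_of_ne hr]
    · have e3 := code_primed hl
      refine (h.leave hl).scanRows_eq ?_ ?_ ?_ ?_
      · rw [e1, e2]; omega
      · rw [codes_of_ne (by simp), h5.1]
      · intro r j h6 h7
        rw [codes_of_ne h6, codes_of_ne h7]
      · intro h6
        obtain ⟨m, hm, h7, -⟩ := h.exists_letter (k := k) (a := i + 1) (b := i + 1) (by omega)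
        rw [h6, e1] at h7
        have hm' := eq_of_code_succ hl h7.symm
        have hm'' := h.mem_right' hm (by simp) (by simp) (by simp)
        exact hQ _ hm'' (by simp [dg]) hm'

/-- A letter loses its prime and moves to the hole on the main diagonal, and the next letter on the
main diagonal takes its place. -/
theorem leave_two (h : Hole n N P x ((y, ⟨b, true⟩) :: (z, ⟨b, false⟩) :: Q)) (ha : Adj x y)
    (hx : dg x = 0) (hz : dg z = 0) :
    Hole n N (P ++ [(x, ⟨b, false⟩), (y, ⟨b, false⟩)]) z Q ∧
      ∀ k, latticeScan k n (fill (P ++ (y, ⟨b, true⟩) :: (z, ⟨b, false⟩) :: Q)) =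
      latticeScan k n (fill (P ++ (x, ⟨b, false⟩) :: (y, ⟨b, false⟩) :: Q)) := by
  obtain ⟨i, rfl, rfl⟩ := h.diag_adj ha hx
  have hy1 : dg (i, i + 1) = 1 := by simp [dg]
  have hg : Grows (extend N (P.map Prod.fst)) ((i, i) :: (i, i + 1) :: z :: Q.map Prod.fst) :=
    h.grows_from
  have hzi : z = (i + 1, i + 1) := by
    have := hg.2.2.adj_iff.1 (by unfold Adj; omega)
    rcases this with rfl | rfl
    · simp [dg] at hz
      omega
    · rfl
  subst hzi
  constructor
  · have hs : (P ++ ((i, i), ⟨b, false⟩) :: ((i, i + 1), ⟨b, false⟩) :: Q).Pairwise StdLt := by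
      refine sorted_insert (sorted_insert (h.sorted'.sublist
        ((List.Sublist.refl P).append (List.sublist_cons_self _ Q))) ?_ ?_) ?_ ?_
      · rintro P f rfl
        refine (h.lt_left (e := f) (by simp)).trans ?_
        simp [StdLt, Letter.le_iff]
      · rintro Q f rfl
        have h1 : StdLt ((i + 1, i + 1), ⟨b, false⟩) f :=
          (List.pairwise_cons.1 (List.pairwise_cons.1 (List.pairwise_append.1 h.sorted).2.1).2).1 f
            (by simp)
        have h2 : dg ((i, i + 1) : Box) = dg f.1 → dg ((i, i + 1) : Box) = 0 ∧ _ :=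
          Grows.dg_triple (L := Q.map Prod.fst) hg.2.2
        refine ⟨h1.1, fun h3 => ?_⟩
        have h4 := h1.2 h3
        rw [hz] at h4
        rw [hy1] at h2 ⊢
        refine ⟨by simp, fun _ => ?_⟩
        have := h4.2 rfl
        omega
      · rintro P f rfl
        refine (h.lt_left (e := f) (by simp)).trans ?_
        simp [StdLt, Letter.le_iff]
      · rintro Q f h1
        rw [List.cons.injEq] at h1
        rw [← h1.1]
        simp [StdLt, Letter.le_iff, hx, hy1]
    refine ⟨by simpa using h.grows, by simpa using hs, fun e he hp => h.diag e ?_ hp,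
      by simpa using h.bound⟩
    simp only [List.append_assoc, List.cons_append, List.nil_append, List.mem_append,
      List.mem_cons] at he ⊢
    rcases he with he | rfl | rfl | he
    · exact Or.inl he
    · simp at hp
    · simp at hp
    · exact Or.inr (Or.inr (Or.inr he))
  · intro k
    have hnd := h.grows.nodup
    simp only [List.map_cons, List.nodup_append, List.nodup_cons] at hnd
    have hP : ∀ c ∈ ([(i, i), (i, i + 1), (i + 1, i + 1)] : List Box), c ∉ P.map Prod.fst := by
      intro c hc hc'
      refine hnd.2.2 c hc' c ?_ rfl
      simp only [List.mem_cons, List.not_mem_nil, or_false] at hc ⊢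
      tauto
    have hQ : ∀ c ∈ ([(i, i), (i, i + 1), (i + 1, i + 1)] : List Box), c ∉ Q.map Prod.fst := by
      intro c hc hc'
      simp only [List.mem_cons, List.not_mem_nil, or_false, not_or] at hc hnd
      rcases hc with rfl | rfl | rfl <;> tauto
    have hnone : ∀ c ∈ ([(i, i), (i, i + 1), (i + 1, i + 1)] : List Box),
        codes k (fill (P ++ Q)) c.1 c.2 = 0 := by
      intro c hc
      have h1 : fill (P ++ Q) (c.1, c.2) = none := fill_eq_none_iff.2 (by
        rw [List.map_append, List.mem_append, not_or]
        exact ⟨hP c hc, hQ c hc⟩)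
      rw [codes, h1]; rfl
    have n1 : codes k (fill (P ++ Q)) i i = 0 := hnone (i, i) (by simp)
    have n2 : codes k (fill (P ++ Q)) i (i + 1) = 0 := hnone (i, i + 1) (by simp)
    have n3 : codes k (fill (P ++ Q)) (i + 1) (i + 1) = 0 := hnone (i + 1, i + 1) (by simp)
    have e1 : codes k (fill (P ++ ((i, i + 1), ⟨b, true⟩) :: ((i + 1, i + 1), ⟨b, false⟩) :: Q))
        i (i + 1) = code k (some ⟨b, true⟩) := codes_self (hP (i, i + 1) (by simp))
    have e2 : codes k (fill (P ++ ((i, i + 1), ⟨b, true⟩) :: ((i + 1, i + 1), ⟨b, false⟩) :: Q))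
        (i + 1) (i + 1) = code k (some ⟨b, false⟩) := by
      rw [codes_of_ne (by simp)]
      exact codes_self (hP (i + 1, i + 1) (by simp))
    have e3 : codes k (fill (P ++ ((i, i), ⟨b, false⟩) :: ((i, i + 1), ⟨b, false⟩) :: Q))
        i i = code k (some ⟨b, false⟩) := codes_self (hP (i, i) (by simp))
    have e4 : codes k (fill (P ++ ((i, i), ⟨b, false⟩) :: ((i, i + 1), ⟨b, false⟩) :: Q))
        i (i + 1) = code k (some ⟨b, false⟩) := by
      rw [codes_of_ne (by simp)]
      exact codes_self (hP (i, i + 1) (by simp))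
    have e5 : codes k (fill (P ++ ((i, i), ⟨b, false⟩) :: ((i, i + 1), ⟨b, false⟩) :: Q))
        (i + 1) (i + 1) = 0 := by
      rw [codes_of_ne (by simp), codes_of_ne (by simp), n3]
    have e0 : ∀ r j, ¬ (r = i ∧ j = i) → ¬ (r = i ∧ j = i + 1) → ¬ (r = i + 1 ∧ j = i + 1) →
        codes k (fill (P ++ ((i, i), ⟨b, false⟩) :: ((i, i + 1), ⟨b, false⟩) :: Q)) r j =
        codes k (fill (P ++ ((i, i + 1), ⟨b, true⟩) :: ((i + 1, i + 1), ⟨b, false⟩) :: Q)) r j := by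
      intro r j h1 h2 h3
      rw [codes_of_ne h1, codes_of_ne h2, codes_of_ne h2, codes_of_ne h3]
    by_cases hl : code k (some ⟨b, true⟩) = 0
    · have hl' := code_eq_zero_iff.1 hl
      refine scanRows_congr fun r j _ => ?_
      by_cases h1 : r = i ∧ j = i
      · rw [h1.1, h1.2, e3, hl', codes_of_ne (by simp), codes_of_ne (by simp), n1]
      by_cases h2 : r = i ∧ j = i + 1
      · rw [h2.1, h2.2, e1, e4, hl, hl']
      by_cases h3 : r = i + 1 ∧ j = i + 1
      · rw [h3.1, h3.2, e2, e5, hl']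
      exact (e0 r j h1 h2 h3).symm
    · have hc := code_primed hl
      refine (h.leave hl).scanRows_eq' ?_ ?_ e5 e0 ?_
      · rw [e1, e3]; omega
      · rw [e1, e4]; omega
      · rw [e1, e2]; omega

/-- The hole passes through a strip. -/
theorem pass {B B' : Strip} {x' : Box} (h : Hole n N P x (B.lab (fun p => ⟨b, p⟩) ++ Q))
    (hp : Pass x B B' x') (hB : B.Valid) (hQ : ∀ e ∈ Q, e.2.val ≠ b) :
    Hole n N (P ++ B'.lab fun p => ⟨b, p⟩) x' Q ∧
      ∀ k, latticeScan k n (fill (P ++ (B.lab (fun p => ⟨b, p⟩) ++ Q))) =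
        latticeScan k n (fill (P ++ (B'.lab (fun p => ⟨b, p⟩) ++ Q))) := by
  unfold Strip.lab at h ⊢
  cases hp with
  | @keep D D' x₁ E E' _ h0 h1 h2 =>
    rw [List.append_assoc] at h
    obtain ⟨h3, h4⟩ := row h1 h fun _ => h0
    obtain ⟨h5, h6⟩ := row h2 h3 (by simp)
    refine ⟨by simpa using h5, fun k => ?_⟩
    have := (h4 k).trans (by simpa using h6 k)
    simpa using this
  | @enter D D' x₁ y E E' _ h0 h1 ha hy h2 =>
    rw [List.append_assoc] at h
    obtain ⟨h3, h4⟩ := row h1 h fun _ => Or.inl h0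
    obtain ⟨h5, h6⟩ := enter (Q := E.map (·, ⟨b, false⟩) ++ Q) h3 ha hy
    obtain ⟨h7, h8⟩ := row h2 h5 (by simp)
    refine ⟨by simpa using h7, fun k => ?_⟩
    have e4 := h4 k
    have e6 := h6 k
    have e8 := h8 k
    simp only [List.map_cons, List.map_append, List.map_nil, List.append_assoc, List.cons_append,
      List.nil_append] at e4 e6 e8 ⊢
    exact e4.trans (e6.trans e8)
  | @leave D y E E' _ hx h1 ha h2 =>
    have h' : Hole n N P x (D.map (·, ⟨b, true⟩) ++ ((y, ⟨b, true⟩) ::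
        (E.map (·, ⟨b, false⟩) ++ Q))) := by simpa using h
    obtain ⟨h3, -⟩ := row (row_of_not_adj h1) h' fun _ => Or.inr h1
    rcases hB.cases with hE | ⟨z, E₀, hE, hz, -⟩
    · obtain ⟨h5, h6⟩ := h3.leave_one ha hx (by
        intro e he he0
        rcases List.mem_append.1 he with he | he
        · obtain ⟨c, hc, rfl⟩ := List.mem_map.1 he
          exact absurd he0 (hE c hc).ne'
        · intro h'
          exact hQ e he (by rw [h']))
      obtain ⟨h7, h8⟩ := row h2 h5 (by simp)
      refine ⟨by simpa using h7, fun k => ?_⟩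
      have e6 := h6 k
      have e8 := h8 k
      simp only [List.map_cons, List.map_append, List.map_nil, List.append_assoc, List.cons_append,
        List.nil_append] at e6 e8 ⊢
      exact e6.trans e8
    · obtain rfl : E = z :: E₀ := by simpa using hE
      obtain ⟨h5, h6⟩ := leave_two (Q := E₀.map (·, ⟨b, false⟩) ++ Q) h3 ha hx hz
      have hy : dg y = 1 := by
        obtain ⟨i, -, rfl⟩ := h3.diag_adj ha hx
        simp [dg]
      cases h2 with
      | cons hm h2 =>
        -- Here `y` is on diagonal 1 and `z` on diagonal 0, so they are adjacent and the local move
        -- is an exchange, already accounted for in `leave_two`.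
        rcases hm with ⟨-, rfl, rfl⟩ | ⟨hm, -, -⟩
        · obtain ⟨h7, h8⟩ := row h2 h5 (by simp)
          refine ⟨by simpa using h7, fun k => ?_⟩
          have e6 := h6 k
          have e8 := h8 k
          simp only [List.map_cons, List.map_append, List.map_nil, List.append_assoc,
            List.cons_append, List.nil_append] at e6 e8 ⊢
          exact e6.trans e8
        · exact absurd (by unfold Adj; omega) hm

end Hole

/-! ### The scan along the switching of two lists of strips -/

theorem Grid.nil_through {α β : Type*} {R : α → β → β → α → Prop} (xs : List α) :
    Grid R xs [] [] xs := by
  induction xs with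
  | nil => exact Grid.nil _
  | cons x xs ih => exact Grid.cons ih (Row.nil x)

theorem Grid.hcat {α β : Type*} {R : α → β → β → α → Prop} {xs xs₁ : List α} {ys ys' : List β}
    (h : Grid R xs ys ys' xs₁) : ∀ {xs' : List α} {zs zs' : List β}, Grid R xs₁ zs zs' xs' →
      Grid R xs (ys ++ zs) (ys' ++ zs') xs' := by
  induction h with
  | nil ys => intro xs' zs zs' h'; cases h'; exact Grid.nil _
  | cons _ hr ih =>
    intro xs' zs zs' h'
    cases h' with
    | cons h' hr' => exact Grid.cons (ih h') (hr.append hr')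

/-- A box passes through the strip of a letter. -/
def BoxPass (x : Box) (y y' : NStrip) (x' : Box) : Prop := y'.1 = y.1 ∧ Pass x y.2 y'.2 x'

/-- The boxes of a list of strips. -/
def boxesOf (L : List NStrip) : List Box := L.flatMap fun e => e.2.boxes

@[simp] theorem boxesOf_nil : boxesOf [] = [] := rfl

@[simp] theorem boxesOf_cons (e : NStrip) (L : List NStrip) :
    boxesOf (e :: L) = e.2.boxes ++ boxesOf L := rfl

theorem Passes.grid_boxPass {xs xs' : List Box} {y y' : NStrip} (hy : y'.1 = y.1)
    (h : Passes xs y.2 y'.2 xs') : Grid BoxPass xs [y] [y'] xs' := by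
  obtain ⟨b, B⟩ := y
  obtain ⟨b', B'⟩ := y'
  simp only at hy h
  subst hy
  induction h with
  | nil => exact Grid.nil _
  | cons _ hp ih => exact Grid.cons ih (Row.cons ⟨rfl, hp⟩ (Row.nil _))

theorem Row.grid_boxPass {x x' : NStrip} {ys ys' : List NStrip} (h : Row NPass x ys ys' x') :
    Grid BoxPass x.2.boxes ys ys' x'.2.boxes := by
  induction h with
  | nil => exact Grid.nil_through _
  | cons m _ ih => exact Grid.hcat (m.2.grid_boxPass m.1.2.1) ih

/-- The first tableau is now taken apart into single boxes: its letters are irrelevant for the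
lattice property of the second, each box being just a hole. -/
theorem Grid.grid_boxPass {xs xs' ys ys' : List NStrip} (h : Grid NPass xs ys ys' xs') :
    Grid BoxPass (boxesOf xs) ys ys' (boxesOf xs') := by
  induction h with
  | nil => exact Grid.nil _
  | cons _ hr ih => exact Grid.append ih hr.grid_boxPass

theorem Row.boxes {x x' : Box} {ys ys' : List NStrip} (h : Row BoxPass x ys ys' x') :
    Row BoxMove x (boxesOf ys) (boxesOf ys') x' := by
  induction h with
  | nil => exact Row.nil _
  | cons m _ ih => exact m.2.row.append ih

theorem Hole.passes {n : ℕ} {N : Set Box} {x x' : Box} {Bs Bs' : List NStrip}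
    (hr : Row BoxPass x Bs Bs' x') : ∀ {P : List (Box × Letter)}, Hole n N P x (labs id Bs) →
      (Bs.map Prod.fst).Pairwise (· < ·) → (∀ e ∈ Bs, e.2.Valid) →
      (∀ e ∈ Bs', e.2.Valid) ∧ Bs'.map Prod.fst = Bs.map Prod.fst ∧
      ∀ k, latticeScan k n (fill (P ++ labs id Bs)) = latticeScan k n (fill (P ++ labs id Bs')) := by
  induction hr with
  | nil => intro P _ _ h; exact ⟨h, rfl, fun _ => rfl⟩
  | @cons x y y' x₁ ys ys' x' m _ ih =>
    intro P h hk hv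
    rw [List.map_cons, List.pairwise_cons] at hk
    have h0 : Hole n N P x (y.2.lab (fun p => ⟨y.1, p⟩) ++ labs id ys) := h
    obtain ⟨h1, h2⟩ := h0.pass m.2 (hv y (by simp)) fun e he => by
      obtain ⟨c, l⟩ := e
      obtain ⟨f, hf, h3⟩ := mem_labs.1 he
      have := hk.1 f.1 (List.mem_map_of_mem hf)
      rcases h3 with ⟨-, rfl⟩ | ⟨-, rfl⟩ <;> exact this.ne'
    obtain ⟨h3, h4, h5⟩ := ih h1 hk.2 fun e he => hv e (by simp [he])
    have h6 : y'.2.Valid := by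
      have h7 : Grows (extend N (P.map Prod.fst)) ((x :: y.2.boxes) ++ (labs id ys).map Prod.fst) := by
        simpa using h0.grows_from
      exact m.2.valid (grows_append.1 h7).1 (hv y (by simp))
    refine ⟨?_, by simp [m.1, h4], fun k => ?_⟩
    · intro e he
      rcases List.mem_cons.1 he with rfl | he
      · exact h6
      · exact h3 e he
    · have e5 := h5 k
      rw [labs_cons, labs_cons, m.1]
      simp only [List.append_assoc] at e5
      exact (h2 k).trans e5

theorem Strip.Valid.diag {L : List NStrip} (h : ∀ e ∈ L, e.2.Valid) :
    ∀ e ∈ labs id L, e.2.primed = true → 0 < dg e.1 := by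
  rintro ⟨c, l⟩ he hp
  obtain ⟨e, he', ⟨hc, rfl⟩ | ⟨-, rfl⟩⟩ := mem_labs.1 he
  · exact (h e he').pos c hc
  · simp at hp

theorem map_fst_labs' {V : Type*} {tag : Letter → V} (L : List NStrip) :
    (labs tag L).map Prod.fst = boxesOf L :=
  map_fst_labs L

/-- Removing a box of the first tableau turns it into a hole in front of the second; the boxes are
used up from the last to the first, and each leaves the scan unchanged. -/
theorem latticeScan_passes {n : ℕ} {xs xs' : List Box} {Bs Bs' : List NStrip}
    (hg : Grid BoxPass xs Bs Bs' xs') (hk : (Bs.map Prod.fst).Pairwise (· < ·))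
    (hv : ∀ e ∈ Bs, e.2.Valid) :
    ∀ {N : Set Box}, Grows N (xs ++ boxesOf Bs) → (∀ c ∈ xs ++ boxesOf Bs, c.2 < n) →
      (∀ e ∈ Bs', e.2.Valid) ∧ Bs'.map Prod.fst = Bs.map Prod.fst ∧
      (∀ c ∈ boxesOf Bs', c.2 < n) ∧ Grows N (boxesOf Bs' ++ xs') ∧
      ∀ k, latticeScan k n (fill (labs id Bs)) = latticeScan k n (fill (labs id Bs')) := by
  induction hg with
  | nil Bs =>
    intro N h hn
    exact ⟨hv, rfl, by simpa using hn, by simpa using h, fun _ => rfl⟩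
  | @cons x xs Bs Bs₁ Bs₂ xs' x' _ hr ih =>
    intro N h hn
    obtain ⟨h1, h2, h3, h4, h5⟩ := ih hk hv (N := insert x N) h.2.2
      fun c hc => hn c (by simp only [List.cons_append, List.mem_cons]; exact Or.inr hc)
    have h6 : Grows N (x :: boxesOf Bs₁ ++ xs') := ⟨h.1, h.2.1, h4⟩
    have hx : x.2 < n := hn x (by simp)
    have hole : Hole n N [] x (labs id Bs₁) := by
      refine ⟨?_, ?_, ?_, ?_⟩
      · have := (grows_append.1 h6).1
        rw [map_fst_labs']
        simpa using this
      · exact pairwise_labs (by rw [h2]; exact hk) h1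
      · exact Strip.Valid.diag h1
      · rw [map_fst_labs']
        simpa using ⟨hx, fun a b hab => h3 (a, b) hab⟩
    obtain ⟨h7, h8, h9⟩ := Hole.passes hr hole (by rw [h2]; exact hk) h1
    refine ⟨h7, h8.trans h2, fun c hc => ?_, Grows.row hr.boxes h6, fun k => ?_⟩
    · rcases hr.boxes.mem_of_mem (Or.inl hc) with h' | rfl
      · exact h3 c h'
      · exact hx
    · exact (h5 k).trans (h9 k)

/-! ### The word of a tableau and the scan -/

/-- The height of a word, measured from an initial height; `none` if the lattice property for
`k` and `k + 1` is violated. -/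
def heightStep (k : ℕ) (x : Letter) (h : ℕ) : Option ℕ :=
  if x.val = k + 1 then (if h = 0 then none else some (if x.primed then h else h - 1))
  else some (if x.val = k ∧ x.primed = false then h + 1 else h)

def height (k : ℕ) : List Letter → ℕ → Option ℕ
  | [], h => some h
  | x :: w, h => (heightStep k x h).bind (height k w)

section heightStep
variable {k v h : ℕ} {p : Bool}

theorem heightStep_unprimed : heightStep k ⟨k, false⟩ h = some (h + 1) := by simp [heightStep]

theorem heightStep_primed : heightStep k ⟨k, true⟩ h = some h := by simp [heightStep]

theorem heightStep_succ_unprimed :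
    heightStep k ⟨k + 1, false⟩ h = if h = 0 then none else some (h - 1) := by simp [heightStep]

theorem heightStep_succ_primed :
    heightStep k ⟨k + 1, true⟩ h = if h = 0 then none else some h := by simp [heightStep]

theorem heightStep_of_ne (h1 : v ≠ k + 1) (h2 : ¬ (v = k ∧ p = false)) :
    heightStep k ⟨v, p⟩ h = some h := by
  rw [heightStep, if_neg h1, if_neg h2]

end heightStep

theorem height_append (k : ℕ) (w w' : List Letter) (h : ℕ) :
    height k (w ++ w') h = (height k w h).bind (height k w') := by
  induction w generalizing h with
  | nil => rfl
  | cons x w ih =>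
    rw [List.cons_append, height, height, Option.bind_assoc]
    congr 1
    funext h
    exact ih h

/-- The height is `h` plus the unprimed letters `k` minus the unprimed letters `k + 1` read so far;
it is zero exactly when the counts tie, and then `k + 1` and `(k + 1)'` are forbidden. The initial
height `h` is free to allow induction on the word. -/
theorem height_ne_none {k : ℕ} {w : List Letter} {h : ℕ} : height k w h ≠ none ↔
    ∀ j x, w[j]? = some x → (w.take j).count ⟨k + 1, false⟩ = h + (w.take j).count ⟨k, false⟩ →
      x.val ≠ k + 1 := by
  induction w generalizing h with
  | nil => simp [height]
  | cons y w ih =>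
    have hsplit : (∀ j x, (y :: w)[j]? = some x → ((y :: w).take j).count ⟨k + 1, false⟩ =
        h + ((y :: w).take j).count ⟨k, false⟩ → x.val ≠ k + 1) ↔
        (h = 0 → y.val ≠ k + 1) ∧ ∀ j x, w[j]? = some x → (y :: w.take j).count ⟨k + 1, false⟩ =
        h + (y :: w.take j).count ⟨k, false⟩ → x.val ≠ k + 1 := by
      constructor
      · intro h1
        exact ⟨fun h0 => h1 0 y rfl (by simp [h0]), fun j x hx => h1 (j + 1) x hx⟩
      · rintro ⟨h1, h2⟩ j x hx
        cases j with
        | zero =>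
          obtain rfl : y = x := by simpa using hx
          simpa using fun h0 => h1 h0.symm
        | succ j => exact h2 j x hx
    rw [hsplit, height]
    obtain ⟨v, p⟩ := y
    simp only [List.count_cons, beq_iff_eq, Letter.mk.injEq]
    by_cases h1 : v = k + 1
    · subst h1
      cases p
      · rw [heightStep_succ_unprimed]
        by_cases h0 : h = 0
        · simp [h0]
        · rw [if_neg h0, Option.bind_some, ih]
          simp only [h0, false_imp_iff, true_and]
          refine forall_congr' fun j => forall_congr' fun x => forall_congr' fun _ =>
            imp_congr_left ?_
          simp
          omega
      · rw [heightStep_succ_primed]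
        by_cases h0 : h = 0
        · simp [h0]
        · rw [if_neg h0, Option.bind_some, ih]
          simp [h0]
    · by_cases h2 : v = k ∧ p = false
      · obtain ⟨rfl, rfl⟩ := h2
        rw [heightStep_unprimed, Option.bind_some, ih]
        simp only [h1, ne_eq, not_false_eq_true, implies_true, true_and]
        refine forall_congr' fun j => forall_congr' fun x => forall_congr' fun _ =>
          imp_congr_left ?_
        simp
        omega
      · rw [heightStep_of_ne h1 h2, Option.bind_some, ih]
        simp [h1, h2]

/-! ### From heights to the scan: the criterion for lattice words. -/

/-- The scan of a word. -/
def wordScan (k : ℕ) (s : ℕ × ℕ) (w : List Letter) : ℕ × ℕ :=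
  w.foldr (fun x s => scanStep (code k (some x)) s) s

/-- Putting `x` in front of `w` puts `x.hat` at the end of `ŵ`, so the effect of the old word is
preceded by `x` and followed by `x.hat`. Combining the height conditions at both ends is precisely
`scanStep`. -/
theorem height_hatWord {k : ℕ} (w : List Letter) (h : ℕ) :
    height k (w ++ hatWord w) h = if (wordScan k (0, 0) w).2 ≤ h
      then some (h - (wordScan k (0, 0) w).2 + (wordScan k (0, 0) w).1) else none := by
  induction w generalizing h with
  | nil => simp [hatWord, height, wordScan]
  | cons x w ih =>
    have h1 : x :: w ++ hatWord (x :: w) = x :: ((w ++ hatWord w) ++ [x.hat]) := by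
      simp [hatWord]
    have h2 : wordScan k (0, 0) (x :: w) =
        scanStep (code k (some x)) (wordScan k (0, 0) w) := rfl
    rw [h1, h2, height]
    have h3 : ∀ h, height k ((w ++ hatWord w) ++ [x.hat]) h =
        (if (wordScan k (0, 0) w).2 ≤ h then
          some (h - (wordScan k (0, 0) w).2 + (wordScan k (0, 0) w).1) else none).bind
          (heightStep k x.hat) := by
      intro h
      rw [height_append, ih]
      congr 1
      funext h
      simp [height]
    simp only [funext h3]
    generalize wordScan k (0, 0) w = s
    obtain ⟨X, Y⟩ := s
    obtain ⟨v, p⟩ := x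
    by_cases h4 : v = k
    · subst h4
      cases p
      · rw [heightStep_unprimed, show code v (some ⟨v, false⟩) = 2 by simp [code]]
        simp only [scanStep, Letter.hat, Option.bind_some, Bool.false_eq_true, if_false]
        rcases X with _ | X <;> rcases Y with _ | Y <;> simp [heightStep_succ_primed] <;>
          (try split_ifs) <;> (try simp) <;> omega
      · rw [heightStep_primed, show code v (some ⟨v, true⟩) = 1 by simp [code]]
        simp only [scanStep, Letter.hat, Option.bind_some, if_true]
        split_ifs <;> simp [heightStep_unprimed]
        omega
    · by_cases h5 : v = k + 1
      · subst h5
        cases p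
        · rw [heightStep_succ_unprimed, show code k (some ⟨k + 1, false⟩) = 4 by simp [code]]
          simp only [scanStep, Letter.hat, Bool.false_eq_true, if_false]
          rcases h with _ | h
          · simp
          · simp only [Nat.add_one_ne_zero, if_false, Option.bind_some, Nat.add_sub_cancel,
              Nat.add_le_add_iff_right]
            split_ifs
            · rw [Option.bind_some, heightStep_of_ne (by simp) (by simp)]
              congr 1; omega
            · rfl
        · rw [heightStep_succ_primed, show code k (some ⟨k + 1, true⟩) = 3 by simp [code]]
          simp only [scanStep, Letter.hat, if_true]
          rcases h with _ | h <;> rcases X with _ | X <;> rcases Y with _ | Y <;>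
            simp [heightStep_succ_unprimed] <;>
            (try split_ifs) <;> (try simp) <;> omega
      · have h6 : code k (some ⟨v, p⟩) = 0 := by simp [code, h4, h5]
        rw [heightStep_of_ne h5 (by simp [h4]), h6, scanStep_zero, Option.bind_some]
        have h7 : ∀ h, heightStep k (Letter.hat ⟨v, p⟩) h = some h := by
          intro h
          cases p
          · exact heightStep_of_ne (by simpa using h4) (by simp)
          · exact heightStep_of_ne h5 (by simp [h4])
        split_ifs <;> simp [h7]

theorem isLatticeWord_iff {w : List Letter} :
    IsLatticeWord w ↔ ∀ k, 1 ≤ k → (wordScan k (0, 0) w).2 = 0 := by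
  have h1 : IsLatticeWord w ↔ ∀ k, 1 ≤ k → height k (w ++ hatWord w) 0 ≠ none := by
    simp only [height_ne_none, IsLatticeWord, Nat.zero_add]
    exact ⟨fun h k hk j x h1 h2 => h k j x hk h1 h2, fun h k j x hk h1 h2 => h k hk j x h1 h2⟩
  rw [h1]
  refine forall_congr' fun k => forall_congr' fun _ => ?_
  rw [height_hatWord]
  simp

theorem wordScan_append (k : ℕ) (s : ℕ × ℕ) (w w' : List Letter) :
    wordScan k s (w ++ w') = wordScan k (wordScan k s w') w := by
  simp [wordScan]

theorem wordScan_row (k : ℕ) (g : ℕ → Option Letter) (n : ℕ) (s : ℕ × ℕ) :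
    wordScan k s ((List.range n).reverse.filterMap g) = scan (fun j => code k (g j)) n s := by
  induction n with
  | zero => rfl
  | succ n ih =>
    rw [List.range_succ, List.reverse_append, List.reverse_singleton, List.singleton_append,
      List.filterMap_cons, scan, ← ih]
    cases h : g n with
    | none => rfl
    | some x => rfl

theorem wordScan_wordUpTo (k n : ℕ) (T : Filling) :
    wordScan k (0, 0) (T.wordUpTo n) = latticeScan k n T := by
  have : ∀ m s, wordScan k s ((List.range m).flatMap fun i =>
      (List.range n).reverse.filterMap fun j => T (i, j)) = scanRows (codes k T) n 0 m s := by
    intro m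
    induction m with
    | zero => intro s; rfl
    | succ m ih =>
      intro s
      rw [List.range_succ, List.flatMap_append, wordScan_append, ih, scanRows, Nat.zero_add]
      congr 1
      simp only [List.flatMap_cons, List.flatMap_nil, List.append_nil]
      exact wordScan_row k _ n s
  exact this n _

theorem wordUpTo_eq {T : Filling} {m n : ℕ} (h : ∀ c ∈ T.shape, c.1 < m ∧ c.2 < m) (hmn : m ≤ n) :
    T.wordUpTo n = T.wordUpTo m := by
  have hnone : ∀ c : Box, m ≤ c.1 ∨ m ≤ c.2 → T c = none := by
    intro c hc
    by_contra h0
    have := h c h0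
    omega
  induction n, hmn using Nat.le_induction with
  | base => rfl
  | succ n hn ih =>
    rw [← ih, Filling.wordUpTo, Filling.wordUpTo, List.range_succ, List.flatMap_append]
    have h1 : ∀ i, ((List.range n ++ [n]).reverse.filterMap fun j => T (i, j)) =
        (List.range n).reverse.filterMap fun j => T (i, j) := by
      intro i
      rw [List.reverse_append, List.reverse_singleton, List.singleton_append, List.filterMap_cons,
        hnone (i, n) (Or.inr hn)]
    simp only [h1, List.flatMap_cons, List.flatMap_nil, List.append_nil]
    have h2 : ((List.range n).reverse.filterMap fun j => T (n, j)) = [] :=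
      List.filterMap_eq_nil_iff.2 fun j _ => hnone (n, j) (Or.inl hn)
    rw [h2, List.append_nil]

theorem word_eq {T : Filling} {n : ℕ} (h : ∀ c ∈ T.shape, c.1 < n ∧ c.2 < n) :
    T.word = T.wordUpTo n := by
  have hb : ∀ r ∈ {n | ∃ c ∈ T.shape, n = c.1 + 1 ∨ n = c.2 + 1}, r ≤ n := by
    rintro r ⟨c, hc, hr⟩
    have := h c hc
    omega
  refine (wordUpTo_eq (fun c hc => ?_) (csSup_le' hb)).symm
  have h1 : c.1 + 1 ≤ T.extent := le_csSup ⟨n, hb⟩ ⟨c, hc, Or.inl rfl⟩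
  have h2 : c.2 + 1 ≤ T.extent := le_csSup ⟨n, hb⟩ ⟨c, hc, Or.inr rfl⟩
  exact ⟨h1, h2⟩

theorem isLatticeWord_word_iff {T : Filling} {n : ℕ} (h : ∀ c ∈ T.shape, c.1 < n ∧ c.2 < n) :
    IsLatticeWord T.word ↔ ∀ k, 1 ≤ k → (latticeScan k n T).2 = 0 := by
  rw [isLatticeWord_iff, word_eq h]
  simp only [wordScan_wordUpTo]

/-- The switching preserves the lattice property of the second list. -/
theorem isLatticeWord_grid {N : Set Box} {As Bs Bs' As' : List NStrip}
    (hg : Grid NPass As Bs Bs' As') (hk : (Bs.map Prod.fst).Pairwise (· < ·))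
    (hv : ∀ e ∈ Bs, e.2.Valid) (hN : Grows N (boxesOf As ++ boxesOf Bs)) :
    IsLatticeWord (Filling.word (fill (labs id Bs))) ↔
      IsLatticeWord (Filling.word (fill (labs id Bs'))) := by
  obtain ⟨n, hn⟩ : ∃ n, ∀ c ∈ boxesOf As ++ boxesOf Bs, c.2 < n := by
    refine ⟨((boxesOf As ++ boxesOf Bs).map fun c => c.2 + 1).sum, fun c hc => ?_⟩
    exact List.single_le_sum (by simp) _ (List.mem_map_of_mem (f := fun c : Box => c.2 + 1) hc)
  obtain ⟨-, -, hn', hN', hs⟩ := latticeScan_passes hg.grid_boxPass hk hv hN hn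
  have hb : ∀ {L : List NStrip}, (∀ c ∈ boxesOf L, c.2 < n) → (∀ c ∈ boxesOf L, c.1 ≤ c.2) →
      ∀ c ∈ Filling.shape (fill (labs id L)), c.1 < n ∧ c.2 < n := by
    intro L h1 h2 c hc
    rw [shape_fill, map_fst_labs'] at hc
    have h3 := h1 c hc
    have h4 := h2 c hc
    omega
  rw [isLatticeWord_word_iff (hb (fun c hc => hn c (List.mem_append_right _ hc))
      fun c hc => hN.le (List.mem_append_right _ hc)),
    isLatticeWord_word_iff (hb hn' fun c hc => hN'.le (List.mem_append_left _ hc))]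
  simp only [hs]


/-! ### The switching of two tableaux -/

theorem labs_eq_map {V : Type*} (tag : Letter → V) (L : List NStrip) :
    labs tag L = (labs id L).map fun e => (e.1, tag e.2) := by
  induction L with
  | nil => rfl
  | cons e L ih => rw [labs_cons, ih]; simp [Strip.lab, Function.comp_def]

theorem fill_map {V W : Type*} (f : V → W) (L : List (Box × V)) (c : Box) :
    fill (L.map fun e => (e.1, f e.2)) c = (fill L c).map f := by
  induction L with
  | nil => rfl
  | cons e L ih =>
    obtain ⟨d, v⟩ := e
    by_cases h : c = d
    · subst h; simp [fill]
    · simp [fill, h, ih]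

theorem fill_append_of_mem {V : Type*} {L L' : List (Box × V)} {c : Box}
    (h : c ∈ L.map Prod.fst) : fill (L ++ L') c = fill L c := by
  induction L with
  | nil => simp at h
  | cons e L ih =>
    obtain ⟨d, v⟩ := e
    by_cases hc : c = d
    · subst hc; simp [fill]
    · have : c ∈ L.map Prod.fst := by simpa [hc] using h
      rw [List.cons_append, fill, fill, Function.update_of_ne hc, Function.update_of_ne hc, ih this]

theorem fill_append_of_not_mem {V : Type*} {L L' : List (Box × V)} {c : Box}
    (h : c ∉ L.map Prod.fst) : fill (L ++ L') c = fill L' c := by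
  induction L with
  | nil => rfl
  | cons e L ih =>
    obtain ⟨d, v⟩ := e
    simp only [List.map_cons, List.mem_cons, not_or] at h
    rw [List.cons_append, fill, Function.update_of_ne h.1, ih h.2]

theorem fill_labs {V : Type*} (tag : Letter → V) (L : List NStrip) (c : Box) :
    fill (labs tag L) c = (fill (labs id L) c).map tag := by
  rw [labs_eq_map, fill_map]

theorem fill_labs_eq_none {L : List NStrip} {c : Box} (h : c ∉ boxesOf L) :
    fill (labs (id : Letter → Letter) L) c = none := by
  rw [fill_eq_none_iff, map_fst_labs']
  exact h

theorem union_fill (As Bs : List NStrip) :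
    union (fill (labs id As)) (fill (labs id Bs)) = fill (labs Sum.inl As ++ labs Sum.inr Bs) := by
  funext c
  by_cases h : c ∈ boxesOf As
  · rw [fill_append_of_mem (by rw [map_fst_labs']; exact h), fill_labs Sum.inl]
    cases h' : fill (labs id As) c with
    | none =>
      rw [fill_eq_none_iff, map_fst_labs'] at h'
      exact absurd h h'
    | some x => simp [union, h']
  · rw [fill_append_of_not_mem (by rw [map_fst_labs']; exact h), fill_labs Sum.inr]
    simp [union, fill_labs_eq_none h]

theorem second_fill {As Bs : List NStrip} :
    PairFilling.second (fill (labs Sum.inr Bs ++ labs Sum.inl As)) = fill (labs id Bs) := by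
  funext c
  by_cases h : c ∈ boxesOf Bs
  · rw [PairFilling.second, fill_append_of_mem (by rw [map_fst_labs']; exact h), fill_labs Sum.inr]
    cases fill (labs id Bs) c <;> rfl
  · rw [PairFilling.second, fill_append_of_not_mem (by rw [map_fst_labs']; exact h),
      fill_labs Sum.inl, fill_labs_eq_none h]
    cases fill (labs id As) c <;> rfl

theorem first_fill {As Bs : List NStrip} (hd : (boxesOf Bs ++ boxesOf As).Nodup) :
    PairFilling.first (fill (labs Sum.inr Bs ++ labs Sum.inl As)) = fill (labs id As) := by
  funext c
  by_cases h : c ∈ boxesOf Bs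
  · have h' : c ∉ boxesOf As := fun h' => (List.nodup_append.1 hd).2.2 c h c h' rfl
    rw [PairFilling.first, fill_append_of_mem (by rw [map_fst_labs']; exact h), fill_labs Sum.inr,
      fill_labs_eq_none h']
    cases fill (labs id Bs) c <;> rfl
  · rw [PairFilling.first, fill_append_of_not_mem (by rw [map_fst_labs']; exact h),
      fill_labs Sum.inl]
    cases fill (labs id As) c <;> rfl

theorem weight_fill {L : List NStrip} (h : (boxesOf L).Nodup) (k : ℕ) :
    Filling.weight (fill (labs id L)) k =
      ((L.map NStrip.size).map fun s => if s.1 = k then s.2 else 0).sum := by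
  have hnd : ((labs (id : Letter → Letter) L).map Prod.fst).Nodup := by rwa [map_fst_labs']
  have h1 : {c | ∃ p, fill (labs id L) c = some (⟨k, p⟩ : Letter)} =
      {c | c ∈ ((labs id L).filter fun e => e.2.val = k).map Prod.fst} := by
    ext c
    simp only [Set.mem_ofPred_eq, fill_eq_some_iff hnd, List.mem_map, List.mem_filter,
      decide_eq_true_eq]
    constructor
    · rintro ⟨p, hp⟩
      exact ⟨_, ⟨hp, rfl⟩, rfl⟩
    · rintro ⟨⟨c, ⟨v, p⟩⟩, ⟨hp, rfl⟩, rfl⟩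
      exact ⟨p, hp⟩
  have h2 : (((labs id L).filter fun e => e.2.val = k).map Prod.fst).Nodup :=
    hnd.sublist (List.filter_sublist.map _)
  rw [Filling.weight, h1]
  have h3 : {c | c ∈ ((labs id L).filter fun e => e.2.val = k).map Prod.fst} =
      ((((labs id L).filter fun e => e.2.val = k).map Prod.fst).toFinset : Set Box) := by
    ext c; simp
  rw [h3, Set.ncard_coe_finset, List.toFinset_card_of_nodup h2, List.length_map]
  clear h h1 h2 h3 hnd
  induction L with
  | nil => rfl
  | cons e L ih =>
    rw [labs_cons, List.filter_append, List.length_append, ih, List.map_cons, List.map_cons,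
      List.sum_cons]
    congr 1
    obtain ⟨b, B⟩ := e
    by_cases hb : b = k
    · subst hb
      simp [Strip.lab, NStrip.size, Strip.boxes, List.filter_append, List.filter_map,
        Function.comp_def]
    · simp [Strip.lab, NStrip.size, hb, List.filter_append, List.filter_map, Function.comp_def]

/-- Equal weights give equal largest entries, so the reversed switching uses the schedule of the
same size. -/
theorem maxEntry_eq_of_weight {L L' : List NStrip}
    (h : ∀ k, Filling.weight (fill (labs id L)) k = Filling.weight (fill (labs id L')) k) :
    Filling.maxEntry (fill (labs id L)) = Filling.maxEntry (fill (labs id L')) := by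
  have key : ∀ L : List NStrip, {k | ∃ c p, fill (labs id L) c = some (⟨k, p⟩ : Letter)} =
      {k | Filling.weight (fill (labs id L)) k ≠ 0} := by
    intro L
    ext k
    have hfin : {c | ∃ p, fill (labs id L) c = some (⟨k, p⟩ : Letter)}.Finite := by
      refine (List.finite_toSet ((labs (id : Letter → Letter) L).map Prod.fst)).subset ?_
      rintro c ⟨p, hp⟩
      by_contra hc
      replace hc := fill_eq_none_iff.2 hc
      rw [hc] at hp
      simp at hp
    rw [Set.mem_ofPred_eq, Set.mem_ofPred_eq, Filling.weight, ← Nat.pos_iff_ne_zero,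
      Set.ncard_pos hfin]
    rfl
  rw [Filling.maxEntry, Filling.maxEntry, key, key]
  simp only [h]

theorem pairs_eq_schedule {As Bs : List NStrip} {m n : ℕ}
    (hA : As.map Prod.fst = (List.range m).map (· + 1))
    (hB : Bs.map Prod.fst = (List.range n).map (· + 1)) : pairs As Bs = schedule m n := by
  have h1 : ∀ L : List NStrip, pairs As L =
      (As.map Prod.fst).reverse.flatMap fun a => (L.map Prod.fst).map fun b => (a, b) := by
    intro L
    rw [pairs, ← List.map_reverse, List.flatMap_map]
    simp [Function.comp_def]
  rw [h1, hA, hB, schedule, ← List.map_reverse, List.flatMap_map]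
  simp [Function.comp_def]

/-- A pair of tableaux given by lists of strips, one for each letter up to the largest entry. -/
structure Listed (N : Set Box) (As Bs : List NStrip) : Prop where
  valid₁ : ∀ e ∈ As, e.2.Valid
  valid₂ : ∀ e ∈ Bs, e.2.Valid
  keys₁ : As.map Prod.fst = (List.range (Filling.maxEntry (fill (labs id As)))).map (· + 1)
  keys₂ : Bs.map Prod.fst = (List.range (Filling.maxEntry (fill (labs id Bs)))).map (· + 1)
  grows : Grows N (boxesOf As ++ boxesOf Bs)

theorem pairwise_keys (m : ℕ) : ((List.range m).map (· + 1)).Pairwise (· < ·) := by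
  rw [List.pairwise_map]
  exact List.pairwise_lt_range.imp fun h => by omega

theorem one_le_of_keys {L : List NStrip} {m : ℕ} (h : L.map Prod.fst = (List.range m).map (· + 1)) :
    ∀ e ∈ L, 1 ≤ e.1 := by
  intro e he
  have := List.mem_map_of_mem (f := Prod.fst) he
  rw [h] at this
  obtain ⟨j, -, h2⟩ := List.mem_map.1 this
  omega

namespace Listed
variable {N : Set Box} {As Bs : List NStrip}

theorem switch (h : Listed N As Bs) : ∃ Bs' As', Grid NPass As Bs Bs' As' ∧ Listed N Bs' As' ∧
    (∀ k, Filling.weight (fill (labs id Bs')) k = Filling.weight (fill (labs id Bs)) k) ∧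
    (∀ k, Filling.weight (fill (labs id As')) k = Filling.weight (fill (labs id As)) k) ∧
    ∀ P Q, SwitchesTo (fill (labs id As)) (fill (labs id Bs)) P Q ↔
      P = fill (labs id Bs') ∧ Q = fill (labs id As') := by
  have hpA := pairwise_keys (Filling.maxEntry (fill (labs id As)))
  have hpB := pairwise_keys (Filling.maxEntry (fill (labs id Bs)))
  rw [← h.keys₁] at hpA
  rw [← h.keys₂] at hpB
  obtain ⟨Bs', As', hg, hB, hA, hN, hrun⟩ := runAll_grid (N := N) (R := []) h.valid₁
    (hpA.imp fun h => h.ne) h.valid₂ (hpB.imp fun h => h.ne) (by simp)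
    (by simpa [map_fst_labs'] using h.grows)
  have hN' : Grows N (boxesOf Bs' ++ boxesOf As') := by
    simpa [map_fst_labs'] using hN
  have hs := (hg.mono fun _ _ _ _ h => h.1).size
  have hd := h.grows.nodup
  have hd' := hN'.nodup
  have w1 : ∀ k, Filling.weight (fill (labs id Bs')) k = Filling.weight (fill (labs id Bs)) k := by
    intro k
    rw [weight_fill (List.nodup_append.1 hd').1, weight_fill (List.nodup_append.1 hd).2.1, hs.1]
  have w2 : ∀ k, Filling.weight (fill (labs id As')) k = Filling.weight (fill (labs id As)) k := by
    intro k
    rw [weight_fill (List.nodup_append.1 hd').2.1, weight_fill (List.nodup_append.1 hd).1, hs.2]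
  refine ⟨Bs', As', hg, ⟨hB, hA, ?_, ?_, hN'⟩, w1, w2, fun P Q => ?_⟩
  · rw [maxEntry_eq_of_weight w1, ← h.keys₂]
    exact map_fst_of_size hs.1
  · rw [maxEntry_eq_of_weight w2, ← h.keys₁]
    exact map_fst_of_size hs.2
  · have hrun' : ∀ V, RunAll (schedule (Filling.maxEntry (fill (labs id As)))
        (Filling.maxEntry (fill (labs id Bs))))
        (union (fill (labs id As)) (fill (labs id Bs))) V ↔
        V = fill (labs Sum.inr Bs' ++ labs Sum.inl As') := by
      rw [← pairs_eq_schedule h.keys₁ h.keys₂, union_fill]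
      simpa using hrun
    simp only [SwitchesTo, hrun', exists_eq_left, second_fill, first_fill hd']

theorem symm (h : Listed N As Bs) {Bs' As' : List NStrip} (hg : Grid NPass As Bs Bs' As')
    (h' : Listed N Bs' As') : Grid NPass Bs' As' As Bs ∧
      SwitchesTo (fill (labs id Bs')) (fill (labs id As')) (fill (labs id As))
        (fill (labs id Bs)) := by
  obtain ⟨As₁, Bs₁, hg₁, -, -, -, h₁⟩ := h'.switch
  -- The reversed switching also produces a grid, and the transposed original grid has the same
  -- input; uniqueness identifies them.
  have := Grid.unique NSwap.unique (hg₁.mono fun _ _ _ _ h => h.1)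
    (Grid.symm NSwap.symm (hg.mono fun _ _ _ _ h => h.1))
  obtain ⟨rfl, rfl⟩ := this
  exact ⟨hg₁, (h₁ _ _).2 ⟨rfl, rfl⟩⟩

theorem isSSYT {nu : StrictPartition} (h : Listed (shiftedShape nu) As Bs) :
    IsSSYT (fill (labs id As)) ∧ IsSSYT (fill (labs id Bs)) ∧
      Extends (fill (labs id Bs)) (fill (labs id As)) := by
  have hg := grows_append.1 h.grows
  have hfin : ∀ {N : Set Box} (L : List Box), N.Finite → (extend N L).Finite :=
    fun L hN => hN.union (List.finite_toSet L)
  have hfin₁ := hfin (boxesOf As) (finite_shiftedShape nu)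
  obtain ⟨mu, hmu⟩ := exists_strictPartition hg.1.isIdeal_extend hfin₁
  rw [← hmu] at hg hfin₁
  obtain ⟨lam, hlam⟩ := exists_strictPartition hg.2.isIdeal_extend (hfin (boxesOf Bs) hfin₁)
  have hkA := pairwise_keys (Filling.maxEntry (fill (labs id As)))
  have hkB := pairwise_keys (Filling.maxEntry (fill (labs id Bs)))
  rw [← h.keys₁] at hkA
  rw [← h.keys₂] at hkB
  obtain ⟨h1, h2, h3⟩ := isSSYT_fill (nu := nu) (mu := mu) (L := As)
    (by rw [map_fst_labs']; exact hg.1) (by rw [map_fst_labs']; exact hmu) hkA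
    (one_le_of_keys h.keys₁) h.valid₁
  obtain ⟨h4, h5, h6⟩ := isSSYT_fill (nu := mu) (mu := lam) (L := Bs)
    (by rw [map_fst_labs']; exact hg.2) (by rw [map_fst_labs']; exact hlam) hkB
    (one_le_of_keys h.keys₂) h.valid₂
  exact ⟨h1, h4, lam, mu, nu, h3, h6, h2, h5⟩

theorem pairwise_keys₂ (h : Listed N As Bs) : (Bs.map Prod.fst).Pairwise (· < ·) := by
  rw [h.keys₂]
  exact pairwise_keys _

end Listed

theorem IsModifiedLRS.of_weight {T T' : Filling} (h : IsModifiedLRS T) (hT' : IsSSYT T')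
    (hw : ∀ k, T'.weight k = T.weight k) (hl : IsLatticeWord T.word ↔ IsLatticeWord T'.word) :
    IsModifiedLRS T' := by
  obtain ⟨mu, hmu⟩ := h.weight_strict
  exact { hT' with
    weight_strict := ⟨mu, fun k => (hw _).trans (hmu k)⟩
    lattice := hl.1 h.lattice }

end ShiftedTableau

/-! ### The theorem: both tableaux as lists of strips, switched and switched back. -/

theorem mainTheorem9 (S T : ShiftedTableau.Filling)
    (hS : ShiftedTableau.IsSSYT S) (hT : ShiftedTableau.IsSSYT T)
    (hST : ShiftedTableau.Extends T S) :
    -- the switching of `(S, T)` is defined: the algorithm has exactly one outcome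
    (∃! R : ShiftedTableau.Filling × ShiftedTableau.Filling,
      ShiftedTableau.SwitchesTo S T R.1 R.2) ∧
    ∀ P Q : ShiftedTableau.Filling, ShiftedTableau.SwitchesTo S T P Q →
      -- the outcome is again a pair of semistandard tableaux, the second extending the first
      (ShiftedTableau.IsSSYT P ∧ ShiftedTableau.IsSSYT Q ∧ ShiftedTableau.Extends Q P) ∧
      -- involution
      ShiftedTableau.SwitchesTo P Q S T ∧
      (ShiftedTableau.IsModifiedLRS T → ShiftedTableau.IsModifiedLRS P) ∧
      (ShiftedTableau.IsModifiedLRS S → ShiftedTableau.IsModifiedLRS Q) := by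
  open ShiftedTableau in
  obtain ⟨lam, mu, nu, h1, h2, h3, h4⟩ := hST
  obtain ⟨As, hkA, hvA, hgA, hmu, rfl⟩ := hS.exists_labs h1 h3
  obtain ⟨Bs, hkB, hvB, hgB, -, rfl⟩ := hT.exists_labs h2 h4
  rw [map_fst_labs'] at hgA hmu hgB
  have hL : Listed (shiftedShape nu) As Bs :=
    ⟨hvA, hvB, hkA, hkB, grows_append.2 ⟨hgA, hmu ▸ hgB⟩⟩
  obtain ⟨Bs', As', hg, hL', w₁, w₂, hsw⟩ := hL.switch
  obtain ⟨hg', hsw'⟩ := hL.symm hg hL'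
  refine ⟨⟨(fill (labs id Bs'), fill (labs id As')), (hsw _ _).2 ⟨rfl, rfl⟩, ?_⟩, ?_⟩
  · rintro ⟨P, Q⟩ h
    obtain ⟨rfl, rfl⟩ := (hsw P Q).1 h
    rfl
  · intro P Q h
    obtain ⟨rfl, rfl⟩ := (hsw P Q).1 h
    obtain ⟨hP, hQ, hQP⟩ := hL'.isSSYT
    exact ⟨⟨hP, hQ, hQP⟩, hsw',
      fun hB => hB.of_weight hP w₁ (isLatticeWord_grid hg hL.pairwise_keys₂ hvB hL.grows),
      -- Statement (c) is the lattice invariance for the reversed switching, which carries `Q` back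
      -- to `S`, read from right to left.
      fun hA => hA.of_weight hQ w₂
        (isLatticeWord_grid hg' hL'.pairwise_keys₂ hL'.valid₂ hL'.grows).symm⟩
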